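/- A transducer $\mathcal T=\langle\Sigma_I,\Sigma_O,Q,q_0,\delta,\ell\rangle$ consists of finite alphabets $\Sigma_I,\Sigma_O$, a finite set $Q$ of states, an initial state $q_0\in Q$, a transition function $\delta:Q\times\Sigma_I\to Q$ and a labelling $\ell:Q\to\Sigma_O$. Its output on $w=\sigma_1\cdots\sigma_n\in\Sigma_I^*$ is $\mathcal T(w)=\ell(q_1)\cdots\ell(q_n)$, where $q_i=\delta(q_{i-1},\sigma_i)$ for $1\le i\le n$. Let $k>0$. A word is a $k$-round word if its length is $kR$ for some $R\in\mathbb N$; its rounds are the $R$ consecutive infixes of length $k$ into which it decomposes. Two $k$-round words $x,y$ with the same number of rounds are $k$-round equivalent, written $x\asymp_k y$, if for every $r$ the $r$-th round of $y$ is a permutation of the $r$-th round of $x$. For transducers $\mathcal T_1,\mathcal T_2$ over the same alphabets $\Sigma_I,\Sigma_O$ and an NFA over $\Sigma_I$ with language $\Lambda\subseteq\Sigma_I^*$, write $\mathcal T_1\prec_{k,\Lambda}\mathcal T_2$ if for every $k$-round word $x\in\Lambda$ there is a $k$-round word $x'\in\Sigma_I^*$ such that $x\asymp_k x'$ and $\mathcal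 T_1(x)\asymp_k\mathcal T_2(x')$. **Theorem.** The following decision problem is in $\mathsf{PSPACE}$: given transducers $\mathcal T_1,\mathcal T_2$ over the same input and output alphabets, an NFA for a language $\Lambda$ over the input alphabet (with a single initial state and without $\varepsilon$-transitions), and an integer $k>0$ in unary, decide whether $\mathcal T_1\prec_{k,\Lambda}\mathcal T_2$. Here the alphabets and state sets are part of the input. The transducers and the NFA are given by explicit tables, with letters and states numbered and the numbers written in binary. -/

import Mathlib

/-! ### Deterministic polynomial space -/

/-- The space occupied by a configuration of a (multi-stack) Turing machine: the total number of
symbols stored on its stacks. -/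
def cfgSpace (tm : Turing.FinTM2) (c : tm.Cfg) : ℕ :=
  letI := tm.kFin
  ∑ i : tm.K, (Turing.TM2.Cfg.stk c i).length

/-- The language `L` over the alphabet `A` is in `PSPACE`: there are a deterministic Turing machine
with input alphabet `A` (all of whose stack alphabets are finite) and a polynomial `p` such that on
every input word `w` the machine halts with output `true` if `w ∈ L` and with output `false` if
`w ∉ L`, and no configuration reached during the computation uses more than `p (|w|)` space. -/
def InPSPACE {A : Type} (L : Language A) : Prop :=
  ∃ (M : Turing.TM2ComputableAux A Bool) (p : Polynomial ℕ),
    (∀ i : M.tm.K, Finite (M.tm.Γ i)) ∧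
    ∀ w : List A,
      (w ∈ L → Nonempty (Turing.TM2Outputs M.tm (w.map M.inputAlphabet.symm)
        (some [M.outputAlphabet.symm true]))) ∧
      (w ∉ L → Nonempty (Turing.TM2Outputs M.tm (w.map M.inputAlphabet.symm)
        (some [M.outputAlphabet.symm false]))) ∧
      ∀ c : M.tm.Cfg,
        StateTransition.Reaches M.tm.step (Turing.initList M.tm (w.map M.inputAlphabet.symm)) c →
          cfgSpace M.tm c ≤ p.eval w.length

/-! ### Words, rounds and transducers -/

/-- The Parikh vector of a word: the number of occurrences of each letter. -/
def parikh {α : Type*} [DecidableEq α] (w : List α) : α → ℕ :=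
  fun a => w.count a

/-- `w` is a `k`-round word: its length is `k * R` for some `R`. -/
def IsRoundWord {α : Type*} (k : ℕ) (w : List α) : Prop :=
  ∃ R : ℕ, w.length = k * R

/-- The `r`-th round of `w`, that is, its infix of length `k` starting at position `r * k`. -/
def roundAt {α : Type*} (k r : ℕ) (w : List α) : List α :=
  (w.drop (r * k)).take k

/-- `k`-round equivalence: `x` and `y` consist of the same number `R` of rounds of length `k`, and
corresponding rounds are permutations of each other. -/
def RoundEquiv {α : Type*} [DecidableEq α] (k : ℕ) (x y : List α) : Prop :=
  ∃ R : ℕ, x.length = k * R ∧ y.length = k * R ∧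
    ∀ r < R, parikh (roundAt k r x) = parikh (roundAt k r y)

/-- A (letter-to-letter) transducer with input alphabet `I`, output alphabet `O`, states `Q`. -/
structure Transducer (I O Q : Type*) where
  /-- the initial state -/
  start : Q
  /-- the transition function -/
  step : Q → I → Q
  /-- the labelling of the states by output letters -/
  label : Q → O

namespace Transducer

variable {I O Q : Type*}

/-- The output of the run that starts in state `q`; the label of `q` itself is not output. -/
def outputFrom (T : Transducer I O Q) : Q → List I → List O
  | _, [] => []
  | q, a :: w => T.label (T.step q a) :: T.outputFrom (T.step q a) w

/-- The output of the transducer on a word. -/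
def output (T : Transducer I O Q) (w : List I) : List O :=
  T.outputFrom T.start w

end Transducer

/-- `T₂` `k`-round simulates `T₁` restricted to the language `L`. -/
def RoundSimulated {I O Q₁ Q₂ : Type*} [DecidableEq I] [DecidableEq O] (k : ℕ) (L : Language I)
    (T₁ : Transducer I O Q₁) (T₂ : Transducer I O Q₂) : Prop :=
  ∀ x ∈ L, IsRoundWord k x →
    ∃ x' : List I, IsRoundWord k x' ∧ RoundEquiv k x x' ∧
      RoundEquiv k (T₁.output x) (T₂.output x')

/-- The data of a nondeterministic automaton with a single initial state and with finite sets of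
successors and of accepting states. -/
structure AutomatonData (α Q : Type*) where
  /-- the initial state -/
  start : Q
  /-- the transition function -/
  step : Q → α → Finset Q
  /-- the accepting states -/
  accept : Finset Q

/-- The automaton as an `NFA`. -/
def AutomatonData.toNFA {α Q : Type*} (A : AutomatonData α Q) : NFA α Q where
  step q a := A.step q a
  start := {A.start}
  accept := A.accept

/-! ### Instances of the decision problem and their encoding -/

/-- An instance of fixed round simulation. The alphabets and the sets of states are
`{0, …, n - 1}` for various `n`. -/
structure Instance where
  /-- number of input letters -/
  nI : ℕ
  /-- number of output letters -/
  nO : ℕ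
  /-- number of states of the first transducer -/
  n₁ : ℕ
  /-- number of states of the second transducer -/
  n₂ : ℕ
  /-- number of states of the automaton -/
  m : ℕ
  /-- the transducer that is to be simulated -/
  T₁ : Transducer (Fin nI) (Fin nO) (Fin n₁)
  /-- the simulating transducer -/
  T₂ : Transducer (Fin nI) (Fin nO) (Fin n₂)
  /-- the automaton to whose language the inputs are restricted -/
  aut : AutomatonData (Fin nI) (Fin m)
  /-- the length of a round -/
  k : ℕ
  k_pos : 0 < k

/-- The table of a transducer: the initial state, the values of the transition function, row by row,
and the labels of the states. -/
def Transducer.table {a b n : ℕ} (T : Transducer (Fin a) (Fin b) (Fin n)) : List ℕ :=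
  (T.start : ℕ) ::
    ((List.finRange n).flatMap (fun q => (List.finRange a).map fun i => (T.step q i : ℕ)) ++
      (List.finRange n).map fun q => (T.label q : ℕ))

/-- The table of an automaton: the initial state, the transition relation as a `0`-`1` table, and
the set of accepting states as a `0`-`1` list. -/
def AutomatonData.table {a n : ℕ} (A : AutomatonData (Fin a) (Fin n)) : List ℕ :=
  (A.start : ℕ) ::
    ((List.finRange n).flatMap (fun q => (List.finRange a).flatMap fun i =>
        (List.finRange n).map fun q' => if q' ∈ A.step q i then 1 else 0) ++
      (List.finRange n).map fun q => if q ∈ A.accept then 1 else 0)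

/-- A list of natural numbers as a word over the alphabet `{0, 1, #}`, where the letters are
`some false`, `some true` and `none`: each number is written in binary, least significant digit
first and without superfluous zeros, and is followed by the separator `#`. -/
def encodeNats (l : List ℕ) : List (Option Bool) :=
  l.flatMap fun n => n.bits.map some ++ [none]

/-- The encoding of an instance: `k` in unary, followed by the sizes of the alphabets and of the
sets of states and by the tables of the three machines, with all numbers in binary. -/
def Instance.encode (X : Instance) : List (Option Bool) :=
  List.replicate X.k (some true) ++ none ::
    encodeNats ([X.nI, X.nO, X.n₁, X.n₂, X.m] ++ X.T₁.table ++ X.T₂.table ++ X.aut.table)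

/-- Fixed round simulation, as a language: the encodings of those instances `T₁, T₂, Λ, k` for
which `T₁` is `k`-round simulated by `T₂` restricted to the language of `Λ`. -/
def fixedRoundSimulation : Language (Option Bool) :=
  {w | ∃ X : Instance, X.encode = w ∧ RoundSimulated X.k X.aut.toNFA.accepts X.T₁ X.T₂}

/-!
Polynomial space is used through programs on counters that hold natural numbers (`Prog`). A
counter becomes a stack with the digits of its value in bijective base 3, so that the number of a
word over the three-letter input alphabet is stored by the word itself, and incrementing or
decrementing needs one auxiliary stack for the carries. A program whose counters keep polynomially
many digits therefore yields a machine that uses polynomial space (`inPSPACE_of_run`).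

The functions that such programs compute (`PSpaceFun`) are closed under composition and under
recursion with intermediate values of polynomially many digits (`PSpaceFun.natRec`); the number of
iterations may be exponential. This gives arithmetic, bounded quantifiers and the decoding of
words. It also gives Savitch's theorem (`PSpaceFun.search`): in a graph on the numbers below `M`
whose edges are decidable in polynomial space, reachability is decided by a depth-first search for
the middle vertices of paths of length at most `2 ^ d`. The stack of this search is one number
with `M.size` digits in base `2 * M`, which increases in every step.

Round simulation is reduced to reachability by a subset construction. While a word `x` is read
round by round, one keeps the state of `T₁`, a state of the automaton, and the set of those states
of `T₂` that are reached by some `x'` with `x ≍ₖ x'` and `T₁(x) ≍ₖ T₂(x')`. These triples can be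
updated from one round to the next one, and the simulation fails if and only if a triple is
reachable that consists of any state of `T₁`, an accepting state of the automaton and the empty
set (`roundSimulated_iff`). A triple is coded by a number below `n₁ * m * 2 ^ n₂`. A round, an
answer to it and a run of the automaton on it are words of length `k` or `k + 1` and are coded by
numbers with polynomially many digits because `k` is given in unary. Hence the steps between
triples are decidable in polynomial space by bounded quantifiers (`PSpaceFun.raw_step`), and so is
the simulation.
-/

open Relation Function

/-! ### Numbers as words over three letters -/

/-- The letters of the input alphabet as the digits `1, 2, 3`. -/
def digitVal : Option Bool → ℕ
  | some false => 1
  | some true => 2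
  | none => 3

/-- The number denoted by a word in bijective base 3, least significant digit first. Every number
is denoted by exactly one word, and the empty word denotes `0`. -/
def wordVal : List (Option Bool) → ℕ
  | [] => 0
  | a :: l => digitVal a + 3 * wordVal l

theorem digitVal_pos (a : Option Bool) : 0 < digitVal a := by
  rcases a with _ | _ | _ <;> simp [digitVal]

theorem two_pow_length_le (l : List (Option Bool)) : 2 ^ l.length ≤ wordVal l + 1 := by
  induction l with
  | nil => simp [wordVal]
  | cons a l ih =>
    have := digitVal_pos a
    simp only [List.length_cons, wordVal, pow_succ]
    omega

theorem wordVal_lt (l : List (Option Bool)) : wordVal l < 4 ^ l.length := by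
  induction l with
  | nil => simp [wordVal]
  | cons a l ih =>
    have : digitVal a ≤ 3 := by rcases a with _ | _ | _ <;> simp [digitVal]
    simp only [List.length_cons, wordVal, pow_succ]
    omega

theorem wordVal_eq_zero {l : List (Option Bool)} : wordVal l = 0 ↔ l = [] := by
  cases l with
  | nil => simp [wordVal]
  | cons a l => have := digitVal_pos a; simp [wordVal]; omega

theorem wordVal_eq_one {l : List (Option Bool)} (h : wordVal l = 1) : l = [some false] := by
  cases l with
  | nil => simp [wordVal] at h
  | cons a l =>
    have h0 : wordVal l = 0 := by have := digitVal_pos a; simp only [wordVal] at h; omega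
    rw [wordVal_eq_zero] at h0
    subst h0
    rcases a with _ | _ | _ <;> simp_all [wordVal, digitVal]

/-! ### Programs on counters -/

/-- While programs on counters that hold natural numbers. -/
inductive Prog
  | skip
  | inc (r : ℕ)
  | dec (r : ℕ)
  | seq (p q : Prog)
  | loop (r : ℕ) (p : Prog)

/-- `Run N p s t`: started in the state `s`, the program `p` terminates in the state `t`, and every
value that is stored by an increment is at most `N`. The program `loop r p` repeats `p` while the
counter `r` is not zero. -/
inductive Run (N : ℕ) : Prog → (ℕ → ℕ) → (ℕ → ℕ) → Prop
  | skip (s) : Run N .skip s s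
  | inc (r s) : s r + 1 ≤ N → Run N (.inc r) s (update s r (s r + 1))
  | dec (r s) : Run N (.dec r) s (update s r (s r - 1))
  | seq {p q s t u} : Run N p s t → Run N q t u → Run N (.seq p q) s u
  | loop_zero {r p s} : s r = 0 → Run N (.loop r p) s s
  | loop_succ {r p s t u} : s r ≠ 0 → Run N p s t → Run N (.loop r p) t u → Run N (.loop r p) s u

theorem Run.le {N : ℕ} {p : Prog} {s t : ℕ → ℕ} (h : Run N p s t) (hs : ∀ r, s r ≤ N) :
    ∀ r, t r ≤ N := by
  induction h with
  | skip s => exact hs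
  | inc r s h => intro j; by_cases hj : j = r <;> simp [hj, h, hs]
  | dec r s =>
    intro j
    by_cases hj : j = r
    · subst hj; have := hs j; simp; omega
    · simp [hj, hs]
  | seq _ _ ih1 ih2 => exact ih2 (ih1 hs)
  | loop_zero => exact hs
  | loop_succ _ _ _ ih1 ih2 => exact ih2 (ih1 hs)

/-- A number that is larger than all counters that occur in a program. -/
def Prog.regs : Prog → ℕ
  | .skip => 0
  | .inc r => r + 1
  | .dec r => r + 1
  | .seq p q => max p.regs q.regs
  | .loop r p => max (r + 1) p.regs

/-! ### Compilation into multi-stack machines -/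

/-- The labels of the compiled program. -/
def Prog.Label : Prog → Type
  | .skip => Unit
  | .inc _ => Bool
  | .dec _ => Bool
  | .seq p q => p.Label ⊕ q.Label
  | .loop _ p => Option p.Label

/-- A program has finitely many labels. -/
@[reducible] noncomputable def Prog.labelFintype : (p : Prog) → Fintype p.Label
  | .skip => inferInstanceAs (Fintype Unit)
  | .inc _ => inferInstanceAs (Fintype Bool)
  | .dec _ => inferInstanceAs (Fintype Bool)
  | .seq p q =>
    letI := p.labelFintype
    letI := q.labelFintype
    inferInstanceAs (Fintype (p.Label ⊕ q.Label))
  | .loop _ p =>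
    letI := p.labelFintype
    inferInstanceAs (Fintype (Option p.Label))

/-- The label at which a compiled program starts. -/
def Prog.entry : (p : Prog) → p.Label
  | .skip => ()
  | .inc _ => false
  | .dec _ => false
  | .seq p _ => Sum.inl p.entry
  | .loop _ _ => (none : Option _)

/-- The stack alphabets: `none` is the output stack, all the others hold digits. -/
abbrev StackAlphabet (n : ℕ) : Option (Fin (n + 1)) → Type
  | none => Bool
  | some _ => Option Bool

/-- The statements of the machines: the internal state holds the symbol that was popped last. -/
abbrev MStmt (n : ℕ) (Λ : Type) := Turing.TM2.Stmt (StackAlphabet n) Λ (Option (Option Bool))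

/-- The configurations of the machines. -/
abbrev MCfg (n : ℕ) (Λ : Type) := Turing.TM2.Cfg (StackAlphabet n) Λ (Option (Option Bool))

/-- The stack of a counter. -/
def regStack (n r : ℕ) : Fin (n + 1) := Fin.ofNat (n + 1) r

/-- The digit that is one larger; an exhausted stack is continued by the digit `1`. The case of the
digit `3`, which produces a carry, is irrelevant. -/
def succDigit : Option (Option Bool) → Option Bool
  | none => some false
  | some (some false) => some true
  | some _ => none

/-- The digit that is one smaller, for digits other than `1`. -/
def predDigit : Option (Option Bool) → Option Bool
  | some none => some true
  | _ => some false

open Turing.TM2.Stmt in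
/-- Empties the auxiliary stack and pushes the digit `d` to the stack `i` as often as there were
symbols on the auxiliary stack. -/
def restoreStmt {n : ℕ} {Λ : Type} (i : Fin (n + 1)) (d : Option Bool) (self exit : Λ) :
    MStmt n Λ :=
  pop (some (Fin.last n)) (fun _ a => a)
    (branch (fun v => v.isSome) (push (some i) (fun _ => d) (goto fun _ => self))
      (goto fun _ => exit))

open Turing.TM2.Stmt in
/-- Replaces the leading digits `3` of the stack `i` by as many symbols on the auxiliary stack and
increments the digit below. -/
def incStmt {n : ℕ} {Λ : Type} (i : Fin (n + 1)) (self next : Λ) : MStmt n Λ :=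
  pop (some i) (fun _ a => a)
    (branch (fun v => v == some none)
      (push (some (Fin.last n)) (fun _ => none) (goto fun _ => self))
      (push (some i) (fun v => succDigit v) (goto fun _ => next)))

open Turing.TM2.Stmt in
/-- Replaces the leading digits `1` of the stack `i` by as many symbols on the auxiliary stack and
decrements the digit below; if there is none, the last of these digits is dropped. -/
def decStmt {n : ℕ} {Λ : Type} (i : Fin (n + 1)) (self next : Λ) : MStmt n Λ :=
  pop (some i) (fun _ a => a)
    (branch (fun v => v == some (some false))
      (push (some (Fin.last n)) (fun _ => none) (goto fun _ => self))
      (branch (fun v => v.isSome)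
        (push (some i) (fun v => predDigit v) (goto fun _ => next))
        (pop (some (Fin.last n)) (fun v _ => v) (goto fun _ => next))))

open Turing.TM2.Stmt in
/-- The statements of a compiled program whose labels are embedded by `ι` and which finally jumps to
the label `exit`. Incrementing and decrementing count the carries on the auxiliary stack. -/
def Prog.code {n : ℕ} {Λ : Type} : (p : Prog) → (p.Label → Λ) → Λ → p.Label → MStmt n Λ
  | .skip, _, exit, _ => goto fun _ => exit
  | .inc r, ι, exit, l =>
    match l with
    | false => incStmt (regStack n r) (ι false) (ι true)
    | true => restoreStmt (regStack n r) (some false) (ι true) exit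
  | .dec r, ι, exit, l =>
    match l with
    | false => decStmt (regStack n r) (ι false) (ι true)
    | true => restoreStmt (regStack n r) none (ι true) exit
  | .seq p q, ι, exit, l =>
    match l with
    | .inl l => p.code (fun l => ι (.inl l)) (ι (.inr q.entry)) l
    | .inr l => q.code (fun l => ι (.inr l)) exit l
  | .loop r p, ι, exit, l =>
    match l with
    | none =>
      peek (some (regStack n r)) (fun _ a => a)
        (branch (fun v => v.isSome) (goto fun _ => ι (some p.entry)) (goto fun _ => exit))
    | some l => p.code (fun l => ι (some l)) (ι none) l

/-- The number of symbols on the stacks. -/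
def stackSpace {n : ℕ} (S : ∀ k, List (StackAlphabet n k)) : ℕ := ∑ k, (S k).length

/-- Reachability through configurations with at most `B` symbols on the stacks. -/
def ReachesIn {n : ℕ} {Λ : Type} (m : Λ → MStmt n Λ) (B : ℕ) : MCfg n Λ → MCfg n Λ → Prop :=
  ReflTransGen fun a b => b ∈ Turing.TM2.step m a ∧ stackSpace b.stk ≤ B

/-- The stacks hold the values of the counters, the auxiliary and the output stack are empty. -/
structure Represents (n : ℕ) (S : ∀ k, List (StackAlphabet n k)) (s : ℕ → ℕ) : Prop where
  val : ∀ i : Fin (n + 1), i ≠ Fin.last n → wordVal (S (some i)) = s i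
  aux : S (some (Fin.last n)) = []
  out : S none = []

theorem stackSpace_update {n : ℕ} (S : ∀ k, List (StackAlphabet n k)) (k) (l) :
    stackSpace (update S k l) + (S k).length = stackSpace S + l.length := by
  unfold stackSpace
  rw [← Finset.add_sum_erase _ _ (Finset.mem_univ k), ← Finset.add_sum_erase (a := k) _ _
    (Finset.mem_univ k)]
  have : ∀ x ∈ Finset.univ.erase k, (update S k l x).length = (S x).length := by
    intro x hx
    rw [update_of_ne (Finset.ne_of_mem_erase hx)]
  rw [Finset.sum_congr rfl this]
  simp; omega

/-- The stacks `S` with the contents of the stack `i` and of the auxiliary stack replaced. -/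
def putStacks {n : ℕ} (S : ∀ k, List (StackAlphabet n k)) (i : Fin (n + 1))
    (l a : List (Option Bool)) : ∀ k, List (StackAlphabet n k) :=
  update (update S (some i) l) (some (Fin.last n)) a

section putStacks

variable {n : ℕ} (S : ∀ k, List (StackAlphabet n k)) (i : Fin (n + 1)) (l a b : List (Option Bool))

theorem putStacks_aux : putStacks S i l a (some (Fin.last n)) = a := by
  simp [putStacks]

theorem putStacks_self (hi : i ≠ Fin.last n) : putStacks S i l a (some i) = l := by
  rw [putStacks, update_of_ne (by simpa using hi), update_self]

theorem putStacks_of_ne {k} (h1 : k ≠ some i) (h2 : k ≠ some (Fin.last n)) :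
    putStacks S i l a k = S k := by
  rw [putStacks, update_of_ne h2, update_of_ne h1]

theorem update_putStacks_aux :
    update (putStacks S i l a) (some (Fin.last n)) b = putStacks S i l b := by
  simp [putStacks]

theorem update_putStacks_self (hi : i ≠ Fin.last n) :
    update (putStacks S i l a) (some i) b = putStacks S i b a := by
  rw [putStacks, update_comm (by simpa using Ne.symm hi), update_idem, putStacks]

theorem stackSpace_putStacks (hi : i ≠ Fin.last n) :
    stackSpace (putStacks S i l a) + (S (some i)).length + (S (some (Fin.last n))).length =
      stackSpace S + l.length + a.length := by
  have h1 := stackSpace_update (update S (some i) l) (some (Fin.last n)) a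
  have h2 := stackSpace_update S (some i) l
  rw [update_of_ne (by simpa using Ne.symm hi)] at h1
  rw [putStacks]
  omega

theorem putStacks_eq (ha : S (some (Fin.last n)) = []) :
    putStacks S i (S (some i)) [] = S := by
  rw [putStacks, update_eq_self, ← ha, update_eq_self]

end putStacks

theorem ReachesIn.head {n : ℕ} {Λ : Type} {m : Λ → MStmt n Λ} {B : ℕ} {l l' : Λ} {v v'}
    {S S'} {c : MCfg n Λ} (h : Turing.TM2.stepAux (m l) v S = ⟨some l', v', S'⟩)
    (hB : stackSpace S' ≤ B) (hr : ReachesIn m B ⟨some l', v', S'⟩ c) :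
    ReachesIn m B ⟨some l, v, S⟩ c :=
  ReflTransGen.head ⟨by simp [h], hB⟩ hr

section Step

variable {n B : ℕ} {Λ : Type} {m : Λ → MStmt n Λ} {i : Fin (n + 1)}
  (S : ∀ k, List (StackAlphabet n k))

/-- The second phase of an increment or a decrement: the carries that were counted by `c` symbols on
the auxiliary stack are turned into digits `d`. -/
theorem reachesIn_restore (hi : i ≠ Fin.last n) {d : Option Bool} {self exit : Λ}
    (hm : m self = restoreStmt i d self exit) (c : ℕ) : ∀ (l : List (Option Bool)) (v),
    stackSpace (putStacks S i l (.replicate c none)) ≤ B →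
    ReachesIn m B ⟨some self, v, putStacks S i l (.replicate c none)⟩
      ⟨some exit, none, putStacks S i (.replicate c d ++ l) []⟩ := by
  induction c with
  | zero =>
    intro l v hB
    refine ReachesIn.head ?_ hB ReflTransGen.refl
    simp [hm, restoreStmt, putStacks_aux, update_putStacks_aux]
  | succ c ih =>
    intro l v hB
    have hB' : stackSpace (putStacks S i (d :: l) (.replicate c none)) ≤ B := by
      have h1 := stackSpace_putStacks S i l (.replicate (c + 1) none) hi
      have h2 := stackSpace_putStacks S i (d :: l) (.replicate c none) hi
      simp only [List.length_replicate, List.length_cons] at h1 h2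
      omega
    have := ih (d :: l) (some none) hB'
    rw [List.replicate_succ' (a := d), List.append_assoc, List.singleton_append]
    refine ReachesIn.head ?_ hB' this
    simp [hm, restoreStmt, putStacks_aux, update_putStacks_aux, List.replicate_succ,
      update_putStacks_self, putStacks_self, hi]

/-- Adding `1` turns the leading digits `3` into digits `1`. -/
theorem wordVal_carry (c : ℕ) {l l' : List (Option Bool)} (h : wordVal l' = wordVal l + 1) :
    wordVal (.replicate c (some false) ++ l') = wordVal (.replicate c none ++ l) + 1 := by
  induction c with
  | zero => simpa using h
  | succ c ih => simp only [List.replicate_succ, List.cons_append, wordVal, ih, digitVal]; ring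

/-- An increment, after `c` leading digits `3` were moved to the auxiliary stack. -/
theorem reachesIn_inc (hi : i ≠ Fin.last n) {l₁ l₂ exit : Λ} (h₁ : m l₁ = incStmt i l₁ l₂)
    (h₂ : m l₂ = restoreStmt i (some false) l₂ exit) (l : List (Option Bool)) : ∀ (c : ℕ) (v),
    stackSpace (putStacks S i l (.replicate c none)) + 1 ≤ B →
    ∃ l', wordVal l' = wordVal (.replicate c none ++ l) + 1 ∧
      ReachesIn m B ⟨some l₁, v, putStacks S i l (.replicate c none)⟩
        ⟨some exit, none, putStacks S i l' []⟩ := by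
  -- `d` is the first symbol that is not the digit `3`, or `none` at the end of the stack.
  have key : ∀ (d : Option (Option Bool)) (t : List (Option Bool)) (c : ℕ) (v), d ≠ some none →
      wordVal (succDigit d :: t) = wordVal (d.toList ++ t) + 1 →
      (d = none → t = []) →
      stackSpace (putStacks S i (d.toList ++ t) (.replicate c none)) + 1 ≤ B →
      ∃ l', wordVal l' = wordVal (.replicate c none ++ (d.toList ++ t)) + 1 ∧
      ReachesIn m B ⟨some l₁, v, putStacks S i (d.toList ++ t) (.replicate c none)⟩
        ⟨some exit, none, putStacks S i l' []⟩ := by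
    intro d t c v hd hw ht hB
    have hB' : stackSpace (putStacks S i (succDigit d :: t) (.replicate c none)) ≤ B := by
      have h1 := stackSpace_putStacks S i (d.toList ++ t) (.replicate c none) hi
      have h2 := stackSpace_putStacks S i (succDigit d :: t) (.replicate c none) hi
      simp only [List.length_replicate, List.length_cons, List.length_append] at h1 h2
      omega
    refine ⟨_, wordVal_carry c hw, ReachesIn.head ?_ hB' (reachesIn_restore S hi h₂ c _ d hB')⟩
    rcases d with _ | d
    · simp [h₁, incStmt, putStacks_self, hi, update_putStacks_self, ht]
    · rcases d with _ | d
      · exact absurd rfl hd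
      · simp [h₁, incStmt, putStacks_self, hi, update_putStacks_self]
  induction l with
  | nil => exact fun c v => key none [] c v (by simp) rfl (fun _ => rfl)
  | cons a l ih =>
    intro c v hB
    rcases a with _ | b
    · have hB' : stackSpace (putStacks S i l (.replicate (c + 1) none)) + 1 ≤ B := by
        have h1 := stackSpace_putStacks S i (none :: l) (.replicate c none) hi
        have h2 := stackSpace_putStacks S i l (.replicate (c + 1) none) hi
        simp only [List.length_replicate, List.length_cons] at h1 h2
        omega
      obtain ⟨l', hl', hr⟩ := ih (c + 1) (some none) hB'
      refine ⟨l', by simpa [List.replicate_succ'] using hl', ReachesIn.head ?_ (by omega) hr⟩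
      simp [h₁, incStmt, putStacks_self, hi, update_putStacks_self, putStacks_aux,
        update_putStacks_aux, List.replicate_succ]
    · refine key (some (some b)) l c v (by simp) ?_ (by simp) hB
      cases b <;> simp [succDigit, wordVal, digitVal] <;> ring

/-- A decrement, after `c` leading digits `1` were moved to the auxiliary stack. -/
theorem reachesIn_dec (hi : i ≠ Fin.last n) {l₁ l₂ exit : Λ} (h₁ : m l₁ = decStmt i l₁ l₂)
    (h₂ : m l₂ = restoreStmt i none l₂ exit) (l : List (Option Bool)) : ∀ (c : ℕ) (v),
    stackSpace (putStacks S i l (.replicate c none)) ≤ B →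
    ∃ l', wordVal l' = wordVal (.replicate c (some false) ++ l) - 1 ∧
      ReachesIn m B ⟨some l₁, v, putStacks S i l (.replicate c none)⟩
        ⟨some exit, none, putStacks S i l' []⟩ := by
  induction l with
  | nil =>
    intro c v hB
    have hB' : stackSpace (putStacks S i [] (.replicate (c - 1) none)) ≤ B := by
      have h1 := stackSpace_putStacks S i [] (.replicate c none) hi
      have h2 := stackSpace_putStacks S i [] (.replicate (c - 1) none) hi
      simp only [List.length_replicate] at h1 h2
      omega
    refine ⟨_, ?_, ReachesIn.head ?_ hB' (reachesIn_restore S hi h₂ (c - 1) [] none hB')⟩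
    · rcases c with _ | c
      · simp [wordVal]
      · rw [List.replicate_succ', List.append_assoc,
          wordVal_carry c (l' := [some false] ++ []) (l := []) rfl]
        simp
    · simp [h₁, decStmt, putStacks_self, hi, update_putStacks_self, putStacks_aux,
        update_putStacks_aux]
  | cons a l ih =>
    intro c v hB
    by_cases ha : a = some false
    · subst ha
      have hB' : stackSpace (putStacks S i l (.replicate (c + 1) none)) ≤ B := by
        have h1 := stackSpace_putStacks S i (some false :: l) (.replicate c none) hi
        have h2 := stackSpace_putStacks S i l (.replicate (c + 1) none) hi
        simp only [List.length_replicate, List.length_cons] at h1 h2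
        omega
      obtain ⟨l', hl', hr⟩ := ih (c + 1) (some (some false)) hB'
      refine ⟨l', by simpa [List.replicate_succ'] using hl', ReachesIn.head ?_ hB' hr⟩
      simp [h₁, decStmt, putStacks_self, hi, update_putStacks_self, putStacks_aux,
        update_putStacks_aux, List.replicate_succ]
    · have hB' : stackSpace (putStacks S i (predDigit (some a) :: l) (.replicate c none)) ≤ B := by
        have h1 := stackSpace_putStacks S i (a :: l) (.replicate c none) hi
        have h2 := stackSpace_putStacks S i (predDigit (some a) :: l) (.replicate c none) hi
        simp only [List.length_replicate, List.length_cons] at h1 h2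
        omega
      have hv : wordVal (a :: l) = wordVal (predDigit (some a) :: l) + 1 := by
        rcases a with _ | _ | _
        · simp [predDigit, wordVal, digitVal]; ring
        · exact absurd rfl ha
        · simp [predDigit, wordVal, digitVal]; ring
      refine ⟨_, ?_, ReachesIn.head ?_ hB' (reachesIn_restore S hi h₂ c _ (some a) hB')⟩
      · rw [wordVal_carry c hv, Nat.add_sub_cancel]
      · simp [h₁, decStmt, putStacks_self, hi, update_putStacks_self, beq_eq_false_iff_ne.2 ha]

end Step

/-- A counter with value at most `N` occupies at most `log₂ (N + 1)` symbols. -/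
theorem stackSpace_le {n N : ℕ} {S : ∀ k, List (StackAlphabet n k)} {s : ℕ → ℕ}
    (h : Represents n S s) (hs : ∀ r, s r ≤ N) : stackSpace S ≤ n * Nat.log 2 (N + 1) := by
  rw [stackSpace, Fintype.sum_option, Fin.sum_univ_castSucc, h.out, h.aux]
  have : ∀ i : Fin n, (S (some i.castSucc)).length ≤ Nat.log 2 (N + 1) := by
    intro i
    refine Nat.le_log_of_pow_le (by norm_num) ((two_pow_length_le _).trans ?_)
    rw [h.val _ (Fin.castSucc_lt_last i).ne]
    exact Nat.succ_le_succ (hs _)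
  simpa using Finset.sum_le_card_nsmul Finset.univ _ _ fun i _ => this i

theorem Represents.putStacks {n : ℕ} {S : ∀ k, List (StackAlphabet n k)} {s : ℕ → ℕ}
    (h : Represents n S s) {i : Fin (n + 1)} (hi : i ≠ Fin.last n) {l : List (Option Bool)} {x : ℕ}
    (hl : wordVal l = x) : Represents n (putStacks S i l []) (update s i x) where
  val j hj := by
    by_cases hji : j = i
    · subst hji; simp [putStacks_self, hi, hl]
    · rw [putStacks_of_ne _ _ _ _ (by simpa using hji) (by simpa using hj), h.val j hj,
        update_of_ne (by simpa [Fin.ext_iff] using hji)]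
  aux := putStacks_aux _ _ _ _
  out := by rw [putStacks_of_ne _ _ _ _ (by simp) (by simp), h.out]

theorem regStack_val {n r : ℕ} (h : r < n) : (regStack n r : ℕ) = r := by
  simp [regStack, Nat.mod_eq_of_lt (h.trans n.lt_succ_self)]

theorem regStack_ne {n r : ℕ} (h : r < n) : regStack n r ≠ Fin.last n := by
  rw [Ne, Fin.ext_iff, regStack_val h, Fin.val_last]; omega

/-- The compiled program simulates the program, in space linear in the number of digits of the
largest value. -/
theorem Run.reachesIn {n N B : ℕ} {Λ : Type} {m : Λ → MStmt n Λ} {p : Prog} {s t : ℕ → ℕ}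
    (h : Run N p s t) (hB : n * Nat.log 2 (N + 1) + 1 ≤ B) (hp : p.regs ≤ n) (hs : ∀ r, s r ≤ N) :
    ∀ (ι : p.Label → Λ) (exit : Λ), (∀ l, m (ι l) = p.code ι exit l) →
      ∀ S v, Represents n S s → ∃ S' v', Represents n S' t ∧
        ReachesIn m B ⟨some (ι p.entry), v, S⟩ ⟨some exit, v', S'⟩ := by
  induction h with
  | skip s =>
    intro ι exit hm S v hS
    have := stackSpace_le hS hs
    exact ⟨S, v, hS, ReachesIn.head (by rw [hm]; simp [Prog.code]) (by omega) ReflTransGen.refl⟩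
  | inc r s hr =>
    intro ι exit hm S v hS
    have hr' : r < n := hp
    have := stackSpace_le hS hs
    have hi := regStack_ne hr'
    have hv := hS.val _ hi
    have hput := putStacks_eq S (regStack n r) hS.aux
    obtain ⟨l', hl', hreach⟩ := reachesIn_inc (B := B) S hi (hm false) (hm true)
      (S (some (regStack n r))) 0 v (by rw [List.replicate_zero, hput]; omega)
    rw [List.replicate_zero, List.nil_append, hv] at hl'
    rw [List.replicate_zero, hput] at hreach
    have := hS.putStacks hi hl'
    rw [regStack_val hr'] at this
    exact ⟨_, _, this, hreach⟩
  | dec r s =>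
    intro ι exit hm S v hS
    have hr' : r < n := hp
    have := stackSpace_le hS hs
    have hi := regStack_ne hr'
    have hv := hS.val _ hi
    have hput := putStacks_eq S (regStack n r) hS.aux
    obtain ⟨l', hl', hreach⟩ := reachesIn_dec (B := B) S hi (hm false) (hm true)
      (S (some (regStack n r))) 0 v (by rw [List.replicate_zero, hput]; omega)
    rw [List.replicate_zero, List.nil_append, hv] at hl'
    rw [List.replicate_zero, hput] at hreach
    have := hS.putStacks hi hl'
    rw [regStack_val hr'] at this
    exact ⟨_, _, this, hreach⟩
  | @seq p q s t u h1 h2 ih1 ih2 =>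
    intro ι exit hm S v hS
    simp only [Prog.regs, max_le_iff] at hp
    obtain ⟨S1, v1, hS1, hr1⟩ := ih1 hp.1 hs (fun l => ι (.inl l)) (ι (.inr q.entry))
      (fun l => hm (.inl l)) S v hS
    obtain ⟨S2, v2, hS2, hr2⟩ := ih2 hp.2 (h1.le hs) (fun l => ι (.inr l)) exit
      (fun l => hm (.inr l)) S1 v1 hS1
    exact ⟨S2, v2, hS2, hr1.trans hr2⟩
  | @loop_zero r p s hr =>
    intro ι exit hm S v hS
    have hr' : r < n := (le_max_left _ _).trans hp
    have := stackSpace_le hS hs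
    have hv := hS.val _ (regStack_ne hr')
    rw [regStack_val hr', hr, wordVal_eq_zero] at hv
    refine ⟨S, none, hS, ReachesIn.head ?_ (by omega) ReflTransGen.refl⟩
    rw [hm]
    simp [Prog.code, Prog.entry, hv]
  | @loop_succ r p s t u hr h1 h2 ih1 ih2 =>
    intro ι exit hm S v hS
    have hr' : r < n := (le_max_left _ _).trans hp
    have := stackSpace_le hS hs
    have hv := hS.val _ (regStack_ne hr')
    rw [regStack_val hr'] at hv
    obtain ⟨a, l, hl⟩ : ∃ a l, S (some (regStack n r)) = a :: l := by
      cases hl : S (some (regStack n r)) with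
      | nil => rw [hl] at hv; exact absurd hv.symm hr
      | cons a l => exact ⟨a, l, rfl⟩
    obtain ⟨S1, v1, hS1, hr1⟩ := ih1 ((le_max_right _ _).trans hp) hs (fun l => ι (some l))
      (ι none) (fun l => hm (some l)) S (some a) hS
    obtain ⟨S2, v2, hS2, hr2⟩ := ih2 hp (h1.le hs) ι exit hm S1 v1 hS1
    refine ⟨S2, v2, hS2, ReachesIn.head ?_ (by omega) (hr1.trans hr2)⟩
    rw [hm]
    simp [Prog.code, Prog.entry, hl]

/-- The last statement of the machine: it pops the verdict from the stack of the counter `1` and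
pushes it to the output stack. -/
def verdictStmt {n : ℕ} {Λ : Type} : MStmt n Λ :=
  .pop (some (regStack n 1)) (fun _ a => a) (.branch (fun v => v.isSome)
    (.push none (fun _ => true) (.load (fun _ => none) .halt))
    (.push none (fun _ => false) (.load (fun _ => none) .halt)))

/-- The machine of a program with input counter `0` and output counter `1`, with `n` counters. -/
noncomputable def Prog.machine (p : Prog) (n : ℕ) : Turing.FinTM2 where
  K := Option (Fin (n + 1))
  k₀ := some (regStack n 0)
  k₁ := none
  Γ := StackAlphabet n
  Λ := Option p.Label
  main := some p.entry
  ΛFin := letI := p.labelFintype; inferInstanceAs (Fintype (Option p.Label))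
  σ := Option (Option Bool)
  initialState := none
  Γk₀Fin := inferInstanceAs (Fintype (Option Bool))
  m
    | none => verdictStmt
    | some l => p.code some none l

/-- An upper bound for numbers with polynomially many binary digits. -/
def bd (c m : ℕ) : ℕ := 2 ^ (m.size + 2) ^ c

theorem initList_stk_self (tm : Turing.FinTM2) (w : List (tm.Γ tm.k₀)) :
    (Turing.initList tm w).stk tm.k₀ = w := by
  simp only [Turing.initList, dite_true]
  rfl

theorem initList_stk_of_ne (tm : Turing.FinTM2) (w : List (tm.Γ tm.k₀)) {k : tm.K}
    (h : k ≠ tm.k₀) : (Turing.initList tm w).stk k = [] := by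
  simp only [Turing.initList, dif_neg h]

theorem haltList_stk_self (tm : Turing.FinTM2) (w : List (tm.Γ tm.k₁)) :
    (Turing.haltList tm w).stk tm.k₁ = w := by
  simp only [Turing.haltList, dite_true]
  rfl

theorem haltList_stk_of_ne (tm : Turing.FinTM2) (w : List (tm.Γ tm.k₁)) {k : tm.K}
    (h : k ≠ tm.k₁) : (Turing.haltList tm w).stk k = [] := by
  simp only [Turing.haltList, dif_neg h]

theorem evalsTo_of_reachesIn {n B : ℕ} {Λ : Type} {m : Λ → MStmt n Λ} {a b : MCfg n Λ}
    (h : ReachesIn m B a b) :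
    Nonempty (StateTransition.EvalsTo (Turing.TM2.step m) a (some b)) := by
  induction h with
  | refl => exact ⟨StateTransition.EvalsTo.refl _ _⟩
  | tail _ h ih =>
    obtain ⟨ih⟩ := ih
    exact ⟨ih.trans _ _ _ _ ⟨1, h.1⟩⟩

/-- A deterministic computation that halts within space `B` reaches no configuration outside. -/
theorem stackSpace_le_of_reachesIn {n B : ℕ} {Λ : Type} {m : Λ → MStmt n Λ} {a b : MCfg n Λ}
    (h : ReachesIn m B a b) (hb : b.l = none) (ha : stackSpace a.stk ≤ B) {c : MCfg n Λ}
    (hc : StateTransition.Reaches (Turing.TM2.step m) a c) : stackSpace c.stk ≤ B := by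
  induction h using ReflTransGen.head_induction_on with
  | refl =>
    rcases hc.cases_head with rfl | ⟨d, hd, -⟩
    · exact ha
    · obtain ⟨l, v, S⟩ := b
      obtain rfl : l = none := hb
      simp at hd
  | head h _ ih =>
    rcases hc.cases_head with rfl | ⟨d, hd, hdc⟩
    · exact ha
    · obtain rfl := Option.mem_unique hd h.1
      exact ih h.2 hdc

/-- A language is in `PSPACE` if it is decided by a program on counters whose values have
polynomially many digits. The word is given by its number in the counter `0`; the verdict is `1` or
`0` in the counter `1`, and all the other counters are zero in the end, so that the stacks of the
machine are empty as its output convention demands. -/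
theorem inPSPACE_of_run {L : Language (Option Bool)} (p : Prog) (c : ℕ)
    (hp : ∀ w, ∃ N ≤ bd c (wordVal w), wordVal w ≤ N ∧ ∃ t, Run N p (update 0 0 (wordVal w)) t ∧
      (w ∈ L → t = update (0 : ℕ → ℕ) 1 1) ∧ (w ∉ L → t = 0)) : InPSPACE L := by
  set n := max p.regs 2 with hn
  have h0 : 0 < n := by omega
  have h1 : 1 < n := by omega
  have hi0 := regStack_ne h0
  have hi1 := regStack_ne h1
  have key : ∀ w : List (Option Bool), ∃ (b : Bool), (b = true ↔ w ∈ L) ∧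
      stackSpace (Turing.initList (p.machine n) w).stk ≤ n * ((2 * w.length + 2) ^ c + 1) + 1 ∧
      ReachesIn (p.machine n).m (n * ((2 * w.length + 2) ^ c + 1) + 1)
        (Turing.initList (p.machine n) w) (Turing.haltList (p.machine n) [b]) := by
    intro w
    obtain ⟨N, hN, hwN, t, hrun, ht1, ht0⟩ := hp w
    have hB : n * Nat.log 2 (N + 1) + 1 ≤ n * ((2 * w.length + 2) ^ c + 1) + 1 := by
      gcongr
      -- A word of length `ℓ` denotes a number with at most `2 * ℓ` binary digits, so that the
      -- bound `bd c` is the power of two of a polynomial in `ℓ`.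
      have hsize : (wordVal w).size ≤ 2 * w.length := by
        rw [Nat.size_le, pow_mul]
        exact wordVal_lt w
      rw [← Nat.lt_succ_iff]
      refine Nat.log_lt_of_lt_pow (by omega) ?_
      have h2 : N ≤ 2 ^ (2 * w.length + 2) ^ c :=
        hN.trans (Nat.pow_le_pow_right (by norm_num) (Nat.pow_le_pow_left (by omega) c))
      have h3 : 1 ≤ 2 ^ (2 * w.length + 2) ^ c := Nat.one_le_two_pow
      rw [Nat.succ_eq_add_one, pow_add]
      omega
    have hs : ∀ r, update (0 : ℕ → ℕ) 0 (wordVal w) r ≤ N := by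
      intro r
      by_cases hr : r = 0
      · subst hr; simpa using hwN
      · simp [hr]
    have hrep : Represents n (Turing.initList (p.machine n) w).stk
        (update 0 0 (wordVal w)) := by
      have hself := initList_stk_self (p.machine n) w
      have hne : ∀ k : Option (Fin (n + 1)), k ≠ some (regStack n 0) →
          (Turing.initList (p.machine n) w).stk k = [] :=
        fun k hk => initList_stk_of_ne (p.machine n) w hk
      refine ⟨fun i hi => ?_, hne _ (by simpa using hi0.symm), hne _ (by simp)⟩
      by_cases h : i = regStack n 0
      · subst h
        rw [regStack_val h0, update_self]
        exact congrArg wordVal hself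
      · have h' : (i : ℕ) ≠ 0 := fun h' => h (Fin.ext (by rw [h', regStack_val h0]))
        rw [hne _ (by simpa using h), update_of_ne h']
        rfl
    obtain ⟨S', v', hS', hr⟩ := hrun.reachesIn (m := (p.machine n).m) hB (le_max_left _ _) hs
      some none (fun l => rfl) _ none hrep
    have hsp := (stackSpace_le hrep hs).trans (Nat.le_of_succ_le hB)
    classical
    refine ⟨decide (w ∈ L), by simp, hsp, hr.tail ?_⟩
    have htl : (S' (some (regStack n 1))).tail = [] ∧
        (S' (some (regStack n 1))).head?.isSome = decide (w ∈ L) := by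
      have hv := hS'.val _ hi1
      rw [regStack_val h1] at hv
      by_cases hw : w ∈ L
      · rw [ht1 hw, update_self] at hv
        simp [wordVal_eq_one hv, hw]
      · rw [ht0 hw, Pi.zero_apply, wordVal_eq_zero] at hv
        simp [hv, hw]
    have hot : ∀ i, i ≠ regStack n 1 → S' (some i) = [] := by
      intro i hi
      by_cases hl : i = Fin.last n
      · rw [hl, hS'.aux]
      · rw [← wordVal_eq_zero, hS'.val i hl]
        have : (i : ℕ) ≠ 1 := fun h => hi (Fin.ext (by rw [h, regStack_val h1]))
        by_cases hw : w ∈ L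
        · rw [ht1 hw, update_of_ne this, Pi.zero_apply]
        · rw [ht0 hw, Pi.zero_apply]
    have hstk : update (update S' (some (regStack n 1)) (S' (some (regStack n 1))).tail) none
        [decide (w ∈ L)] = (Turing.haltList (p.machine n) [decide (w ∈ L)]).stk := by
      funext k
      rcases k with _ | i
      · rw [update_self]
        exact (haltList_stk_self (p.machine n) [decide (w ∈ L)]).symm
      · refine Eq.trans ?_ (haltList_stk_of_ne (p.machine n) [decide (w ∈ L)]
          (Option.some_ne_none i)).symm
        by_cases hi : i = regStack n 1
        · subst hi
          simp [htl.1]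
          rfl
        · simp [hi, hot i hi]
          rfl
    have hcfg : Turing.haltList (p.machine n) [decide (w ∈ L)] = (⟨none, none, update (update S'
        (some (regStack n 1)) (S' (some (regStack n 1))).tail) none [decide (w ∈ L)]⟩ :
          MCfg n (Option p.Label)) := by
      rw [hstk]
      rfl
    rw [hcfg]
    constructor
    · have hvs : (p.machine n).m none = verdictStmt := rfl
      simp only [Turing.TM2.step, hvs, verdictStmt, Turing.TM2.stepAux, htl.2,
        ne_eq, reduceCtorEq, not_false_eq_true, update_of_ne, hS'.out]
      cases decide (w ∈ L) <;> rfl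
    · have e1 := stackSpace_update (update S' (some (regStack n 1))
        (S' (some (regStack n 1))).tail) none [decide (w ∈ L)]
      have e2 := stackSpace_update S' (some (regStack n 1)) (S' (some (regStack n 1))).tail
      have e3 := stackSpace_le hS' (hrun.le hs)
      simp only [List.length_tail, List.length_singleton] at e1 e2 ⊢
      omega
  refine ⟨⟨p.machine n, Equiv.refl _, Equiv.refl _⟩,
    .C n * ((2 * .X + 2) ^ c + 1) + 1, ?_, fun w => ?_⟩
  · intro i
    rcases i with _ | i
    · exact inferInstanceAs (Finite Bool)
    · exact inferInstanceAs (Finite (Option Bool))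
  · obtain ⟨b, hb, hsp, hr⟩ := key w
    have hid : w.map (Equiv.refl (Option Bool)).symm = w := by simp
    refine ⟨fun hw => ?_, fun hw => ?_, fun c hc => ?_⟩
    · obtain rfl : b = true := hb.2 hw
      exact hid.symm ▸ evalsTo_of_reachesIn hr
    · obtain rfl : b = false := by simpa [hw] using hb
      exact hid.symm ▸ evalsTo_of_reachesIn hr
    · have := stackSpace_le_of_reachesIn hr rfl hsp (hid ▸ hc)
      exact le_of_le_of_eq this (by simp)

/-! ### Basic programs on counters -/

theorem Run.of_eq {N : ℕ} {p : Prog} {s s' t t' : ℕ → ℕ} (h : Run N p s t) (hs : s = s')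
    (ht : t = t') : Run N p s' t' := hs ▸ ht ▸ h

/-- A loop whose successive states are `F 0, …, F n`. -/
theorem Run.loop_of {N r : ℕ} {p : Prog} (n : ℕ) (F : ℕ → ℕ → ℕ) (h0 : F n r = 0)
    (h1 : ∀ i < n, F i r ≠ 0) (h : ∀ i < n, Run N p (F i) (F (i + 1))) :
    Run N (.loop r p) (F 0) (F n) := by
  induction n generalizing F with
  | zero => exact .loop_zero h0
  | succ n ih =>
    exact .loop_succ (h1 0 n.succ_pos) (h 0 n.succ_pos) (ih (fun i => F (i + 1)) h0
      (fun i hi => h1 _ (by omega)) fun i hi => h _ (by omega))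

theorem run_clear (N a : ℕ) (s : ℕ → ℕ) : Run N (.loop a (.dec a)) s (update s a 0) := by
  refine (Run.loop_of (s a) (fun i => update s a (s a - i)) (by simp)
    (fun i hi => by simp; omega) fun i hi => (Run.dec a _).of_eq rfl ?_).of_eq (by simp) (by simp)
  simp; congr 1

theorem run_move {N a b : ℕ} {s : ℕ → ℕ} (hab : a ≠ b) (hs : s a ≤ N) (hb : s b = 0) :
    Run N (.loop a (.seq (.dec a) (.inc b))) s (update (update s a 0) b (s a)) := by
  refine (Run.loop_of (s a) (fun i => update (update s a (s a - i)) b i) (by simp [hab])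
    (fun i hi => by simp [hab]; omega) fun i hi => (Run.seq (Run.dec a _)
      (Run.inc b _ (by simp [hab.symm]; omega))).of_eq rfl ?_).of_eq ?_ (by simp)
  · funext j
    by_cases h1 : j = a <;> by_cases h2 : j = b <;> simp_all
    omega
  · funext j
    by_cases h1 : j = a <;> by_cases h2 : j = b <;> simp_all

/-- Copies the counter `a` to the counter `b`, with the help of the counter `c`. -/
def copyProg (a b c : ℕ) : Prog :=
  .seq (.loop a (.seq (.dec a) (.seq (.inc b) (.inc c)))) (.loop c (.seq (.dec c) (.inc a)))

theorem run_copy {N a b c : ℕ} {s : ℕ → ℕ} (hab : a ≠ b) (hac : a ≠ c) (hbc : b ≠ c)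
    (hs : s a ≤ N) (hb : s b = 0) (hc : s c = 0) :
    Run N (copyProg a b c) s (update s b (s a)) := by
  have h1 : Run N (.loop a (.seq (.dec a) (.seq (.inc b) (.inc c)))) s
      (update (update (update s a 0) b (s a)) c (s a)) := by
    refine (Run.loop_of (s a) (fun i => update (update (update s a (s a - i)) b i) c i)
      (by simp [hab, hac]) (fun i hi => by simp [hab, hac]; omega)
      fun i hi => (Run.seq (Run.dec a _) (Run.seq (Run.inc b _ (by simp [hab.symm, hbc]; omega))
        (Run.inc c _ (by simp [hac.symm, hbc.symm]; omega)))).of_eq rfl ?_).of_eq ?_ (by simp)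
    · funext j
      by_cases h1 : j = a <;> by_cases h2 : j = b <;> by_cases h3 : j = c <;>
        simp_all
      omega
    · funext j
      by_cases h1 : j = a <;> by_cases h2 : j = b <;> by_cases h3 : j = c <;>
        simp_all
  refine h1.seq ((run_move hac.symm (by simpa using hs) (by simp [hab, hac])).of_eq rfl ?_)
  funext j
  by_cases h1 : j = a <;> by_cases h2 : j = b <;> by_cases h3 : j = c <;>
    simp_all

/-! ### Blocks of counters -/

/-- The state `s` with the counters from `r` on replaced by the list `l`, followed by zeros. -/
def blk (s : ℕ → ℕ) (r : ℕ) (l : List ℕ) : ℕ → ℕ :=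
  fun j => if j < r then s j else l.getD (j - r) 0

theorem blk_lt {s : ℕ → ℕ} {r j : ℕ} {l : List ℕ} (h : j < r) : blk s r l j = s j := if_pos h

theorem blk_add (s : ℕ → ℕ) (r j : ℕ) (l : List ℕ) : blk s r l (r + j) = l.getD j 0 := by
  simp [blk]

theorem blk_nil {s : ℕ → ℕ} {r : ℕ} (h : ∀ j, r ≤ j → s j = 0) : blk s r [] = s := by
  funext j
  by_cases hj : j < r
  · rw [blk_lt hj]
  · simp [blk, hj, h j (by omega)]

theorem blk_blk (s : ℕ → ℕ) (r : ℕ) (l l' : List ℕ) :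
    blk (blk s r l) (r + l.length) l' = blk s r (l ++ l') := by
  funext j
  by_cases h1 : j < r
  · simp [blk, h1, show j < r + l.length by omega]
  · by_cases h2 : j < r + l.length
    · simp only [blk, h1, h2, if_false, if_true]
      rw [List.getD_append _ _ _ _ (by omega)]
    · simp only [blk, h1, h2, if_false]
      rw [List.getD_append_right _ _ _ _ (by omega), Nat.sub_sub]

theorem blk_append_zero (s : ℕ → ℕ) (r : ℕ) (l : List ℕ) : blk s r (l ++ [0]) = blk s r l := by
  funext j
  by_cases h1 : j < r
  · simp [blk, h1]
  · simp only [blk, h1, if_false]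
    by_cases h2 : j - r < l.length
    · rw [List.getD_append _ _ _ _ h2]
    · rw [List.getD_append_right _ _ _ _ (by omega), List.getD_eq_default l _ (by omega)]
      cases j - r - l.length <;> simp

theorem update_blk (s : ℕ → ℕ) (r : ℕ) (l₁ l₂ : List ℕ) (a b : ℕ) {k : ℕ}
    (hk : k = r + l₁.length) :
    update (blk s r (l₁ ++ a :: l₂)) k b = blk s r (l₁ ++ b :: l₂) := by
  subst hk
  funext j
  by_cases h : j = r + l₁.length
  · subst h; simp [blk_add]
  · rw [update_of_ne h]
    by_cases h1 : j < r
    · simp [blk, h1]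
    · simp only [blk, h1, if_false]
      by_cases h2 : j - r < l₁.length
      · rw [List.getD_append _ _ _ _ h2, List.getD_append _ _ _ _ h2]
      · rw [List.getD_append_right _ _ _ _ (by omega), List.getD_append_right _ _ _ _ (by omega)]
        obtain ⟨i, hi⟩ : ∃ i, j - r - l₁.length = i + 1 := ⟨j - r - l₁.length - 1, by omega⟩
        simp [hi]

theorem update_blk_length (s : ℕ → ℕ) (r : ℕ) (l : List ℕ) (b : ℕ) {k : ℕ}
    (hk : k = r + l.length) : update (blk s r l) k b = blk s r (l ++ [b]) := by
  rw [← blk_append_zero, update_blk s r l [] 0 b hk]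

theorem blk_apply (s : ℕ → ℕ) (r : ℕ) (l₁ l₂ : List ℕ) (a : ℕ) {k : ℕ} (hk : k = r + l₁.length) :
    blk s r (l₁ ++ a :: l₂) k = a := by
  rw [hk, blk_add, List.getD_append_right _ _ _ _ le_rfl]; simp

theorem blk_eq_zero {s : ℕ → ℕ} {r k : ℕ} {l : List ℕ} (hk : r + l.length ≤ k) :
    blk s r l k = 0 := by
  obtain ⟨j, rfl⟩ : ∃ j, k = r + j := ⟨k - r, by omega⟩
  rw [blk_add, List.getD_eq_default _ _ (by omega)]

theorem blk_le {N : ℕ} {s : ℕ → ℕ} {r : ℕ} {l : List ℕ} (hs : ∀ j, s j ≤ N)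
    (hl : ∀ i ∈ l, i ≤ N) (j : ℕ) : blk s r l j ≤ N := by
  by_cases h1 : j < r
  · simp [blk, h1, hs]
  · simp only [blk, h1, if_false]
    by_cases h2 : j - r < l.length
    · rw [List.getD_eq_getElem _ _ h2]; exact hl _ (List.getElem_mem h2)
    · rw [List.getD_eq_default _ _ (by omega)]; exact N.zero_le

theorem map_blk {s : ℕ → ℕ} {r : ℕ} {e l : List ℕ} (h : ∀ i ∈ e, i < r) :
    e.map (blk s r l) = e.map s :=
  List.map_congr_left fun i hi => blk_lt (h i hi)

theorem map_blk_range' (s : ℕ → ℕ) (r : ℕ) (l₁ l₂ l₃ : List ℕ) :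
    (List.range' (r + l₁.length) l₂.length).map (blk s r (l₁ ++ l₂ ++ l₃)) = l₂ := by
  refine List.ext_getElem (by simp) fun i h1 h2 => ?_
  simp only [List.getElem_map, List.getElem_range', one_mul]
  rw [add_assoc, blk_add, List.append_assoc, List.getD_append_right _ _ _ _ (by omega)]
  rw [Nat.add_sub_cancel_left, List.getD_append _ _ _ _ h2, List.getD_eq_getElem _ _ h2]

/-- Moves the counters `r + 1, …, r + n` down by one. -/
def shiftProg : ℕ → ℕ → Prog
  | _, 0 => .skip
  | r, n + 1 => .seq (.loop (r + 1) (.seq (.dec (r + 1)) (.inc r))) (shiftProg (r + 1) n)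

theorem run_shift {N : ℕ} {s : ℕ → ℕ} {r : ℕ} (l₂ : List ℕ) : ∀ (l₁ : List ℕ),
    (∀ j, blk s r (l₁ ++ 0 :: l₂) j ≤ N) →
    Run N (shiftProg (r + l₁.length) l₂.length) (blk s r (l₁ ++ 0 :: l₂)) (blk s r (l₁ ++ l₂)) := by
  induction l₂ with
  | nil => intro l₁ _; rw [blk_append_zero, List.append_nil]; exact .skip _
  | cons a l₂ ih =>
    intro l₁ hN
    have hk : r + l₁.length + 1 = r + (l₁ ++ [0]).length := by simp; ring
    have h1 := blk_apply s r (l₁ ++ [0]) l₂ a hk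
    rw [List.append_assoc, List.singleton_append] at h1
    have h2 := run_move (N := N) (s := blk s r (l₁ ++ 0 :: a :: l₂)) (a := r + l₁.length + 1)
      (b := r + l₁.length) (by omega) (hN _) (blk_apply _ _ _ _ _ rfl)
    rw [h1, show l₁ ++ 0 :: a :: l₂ = (l₁ ++ [0]) ++ a :: l₂ by simp, update_blk _ _ _ _ _ _ hk,
      show (l₁ ++ [0]) ++ 0 :: l₂ = l₁ ++ 0 :: 0 :: l₂ by simp, update_blk _ _ _ _ _ _ rfl] at h2
    have h3 := ih (l₁ ++ [a]) (by
      have := h2.le (by simpa using hN)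
      simpa using this)
    simp only [List.length_append, List.length_singleton, ← add_assoc] at h3
    simp only [List.append_assoc, List.singleton_append] at h2 h3
    exact h2.seq h3

/-- Deletes the first `b` of the `b + n` counters that start at `r`. -/
def deleteProg (r n : ℕ) : ℕ → Prog
  | 0 => .skip
  | b + 1 => .seq (.seq (.loop r (.dec r)) (shiftProg r (b + n))) (deleteProg r n b)

/-- The list `l₁` is deleted between `l₀` and `l₂`. -/
theorem run_delete {N : ℕ} {s : ℕ → ℕ} {r r' : ℕ} {l₀ : List ℕ} (hr : r' = r + l₀.length)
    (l₂ l₁ : List ℕ) (hN : ∀ j, blk s r (l₀ ++ (l₁ ++ l₂)) j ≤ N) :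
    Run N (deleteProg r' l₂.length l₁.length) (blk s r (l₀ ++ (l₁ ++ l₂)))
      (blk s r (l₀ ++ l₂)) := by
  subst hr
  induction l₁ with
  | nil => exact .skip _
  | cons a l₁ ih =>
    have h1 := run_clear N (r + l₀.length) (blk s r (l₀ ++ a :: (l₁ ++ l₂)))
    rw [update_blk _ _ _ _ _ _ rfl] at h1
    have h2 := run_shift (l₁ ++ l₂) l₀ (h1.le hN)
    have h3 := ih ((h1.seq h2).le hN)
    rw [List.length_append] at h2
    exact (h1.seq h2).seq h3

/-! ### Growth -/

theorem bd_mono {c d m n : ℕ} (h : c ≤ d) (hm : m ≤ n) : bd c m ≤ bd d n :=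
  Nat.pow_le_pow_right (by norm_num) ((Nat.pow_le_pow_right (by omega) h).trans
    (Nat.pow_le_pow_left (by have := Nat.size_le_size hm; omega) d))

theorem two_le_bd (c m : ℕ) : 2 ≤ bd c m := by
  calc 2 = 2 ^ 1 := rfl
    _ ≤ bd c m := Nat.pow_le_pow_right (by norm_num) (Nat.one_le_pow _ _ (by omega))

theorem le_bd (m : ℕ) : m ≤ bd 1 m := by
  refine m.lt_size_self.le.trans (Nat.pow_le_pow_right (by norm_num) ?_)
  rw [pow_one]; omega

theorem bd_mul_bd (c d m : ℕ) : bd c m * bd d m ≤ bd (max c d + 1) m := by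
  rw [bd, bd, ← pow_add]
  refine Nat.pow_le_pow_right (by norm_num) ?_
  have h1 : (m.size + 2) ^ c ≤ (m.size + 2) ^ max c d :=
    Nat.pow_le_pow_right (by omega) (le_max_left _ _)
  have h2 : (m.size + 2) ^ d ≤ (m.size + 2) ^ max c d :=
    Nat.pow_le_pow_right (by omega) (le_max_right _ _)
  rw [pow_succ, mul_add]
  omega

theorem size_bd (c m : ℕ) : (bd c m).size ≤ (m.size + 2) ^ (c + 1) := by
  have : 0 < (m.size + 2) ^ c := by positivity
  rw [bd, Nat.size_pow, pow_succ]
  nlinarith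

/-- Polynomials are closed under composition. -/
theorem bd_bd (c d m : ℕ) : bd c (bd d m) ≤ bd ((d + 2) * c) m := by
  refine Nat.pow_le_pow_right (by norm_num) ?_
  rw [pow_mul]
  refine Nat.pow_le_pow_left ?_ c
  have := size_bd d m
  have h2 : 2 ≤ (m.size + 2) ^ (d + 1) := by
    calc 2 ≤ m.size + 2 := by omega
      _ ≤ _ := Nat.le_self_pow (by omega) _
  rw [pow_succ _ (d + 1)]
  nlinarith

/-- If two numbers have polynomially many digits, then so has the first one to the power of the
number of digits of the second one. -/
theorem bd_pow_size_bd (c d m : ℕ) : bd c m ^ (bd d m).size ≤ bd (c + (d + 1)) m := by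
  rw [bd, ← pow_mul]
  refine Nat.pow_le_pow_right (by norm_num) ?_
  rw [pow_add (m.size + 2)]
  gcongr
  exact size_bd d m

/-! ### Functions that are computable in polynomial space -/

/-- Data that is stored in a fixed number of counters. -/
class Coded (α : Type) where
  /-- the number of counters -/
  width : ℕ
  /-- the contents of the counters -/
  enc : α → List ℕ
  length_enc : ∀ x, (enc x).length = width

open Coded (enc width length_enc)

instance : Coded ℕ := ⟨1, fun n => [n], fun _ => rfl⟩

open Classical in
/-- Truth values are stored as `0` and `1`. -/
noncomputable instance : Coded Prop := ⟨1, fun p => [if p then 1 else 0], fun _ => rfl⟩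

/-- Words are stored as the numbers that they denote in bijective base 3. -/
instance : Coded (List (Option Bool)) := ⟨1, fun w => [wordVal w], fun _ => rfl⟩

instance {α β : Type} [Coded α] [Coded β] : Coded (α × β) :=
  ⟨width α + width β, fun x => enc x.1 ++ enc x.2, fun x => by simp [length_enc]⟩

/-- The sum of the numbers by which a datum is stored. -/
def sz {α : Type} [Coded α] (x : α) : ℕ := (enc x).sum

/-- The function has values with polynomially many digits. -/
def PolyBounded {α : Type} [Coded α] (f : α → ℕ) : Prop := ∃ c, ∀ x, f x ≤ bd c (sz x)

/-- The function is computable in polynomial space by a program on counters. For all addresses `e`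
of the argument and for every address `r` beyond them there is a program which, if there are only
zeros from `r` on, writes the value at the addresses from `r` on and leaves everything else as it
was. Its counters stay below every bound `N` that holds for the initial state and that is at least
`bd c` of the size of the argument, where `c` depends on the function only. -/
@[fun_prop]
def PSpaceFun {α β : Type} [Coded α] [Coded β] (f : α → β) : Prop :=
  ∃ c, ∀ (e : List ℕ) (r : ℕ), (∀ i ∈ e, i < r) → ∃ p, ∀ x (s : ℕ → ℕ) N, e.map s = enc x →
    (∀ j, r ≤ j → s j = 0) → (∀ j, s j ≤ N) → bd c (sz x) ≤ N → Run N p s (blk s r (enc (f x)))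

section

variable {α β γ : Type} [Coded α] [Coded β] [Coded γ]

@[simp] theorem sz_nat (n : ℕ) : sz n = n := by simp [sz, enc]

@[simp] theorem sz_prod (x : α × β) : sz x = sz x.1 + sz x.2 := by simp [sz, enc]

theorem sz_prop_le (P : Prop) : sz P ≤ 1 := by
  simp only [sz, enc]; split_ifs <;> simp

namespace PolyBounded

theorem mono {f g : α → ℕ} (hg : PolyBounded g) (h : ∀ x, f x ≤ g x) : PolyBounded f :=
  let ⟨c, hc⟩ := hg
  ⟨c, fun x => (h x).trans (hc x)⟩

theorem sz : PolyBounded (fun x : α => sz x) := ⟨1, fun _ => le_bd _⟩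

theorem const (n : ℕ) : PolyBounded (fun _ : α => n) :=
  ⟨n, fun x => by
    refine n.lt_two_pow_self.le.trans (Nat.pow_le_pow_right (by norm_num) ?_)
    exact n.lt_two_pow_self.le.trans (Nat.pow_le_pow_left (by omega) _)⟩

theorem mul {f g : α → ℕ} (hf : PolyBounded f) (hg : PolyBounded g) :
    PolyBounded fun x => f x * g x :=
  let ⟨c, hc⟩ := hf
  let ⟨d, hd⟩ := hg
  ⟨_, fun x => (Nat.mul_le_mul (hc x) (hd x)).trans (bd_mul_bd c d _)⟩

theorem add {f g : α → ℕ} (hf : PolyBounded f) (hg : PolyBounded g) :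
    PolyBounded fun x => f x + g x :=
  let ⟨c, hc⟩ := hf
  let ⟨d, hd⟩ := hg
  ⟨_, fun x => (Nat.add_le_add (hc x) (hd x)).trans
    ((by have := two_le_bd c (_root_.sz x); have := two_le_bd d (_root_.sz x); nlinarith :
      _ ≤ _ * _).trans (bd_mul_bd c d _))⟩

theorem pow_size {f g : α → ℕ} (hf : PolyBounded f) (hg : PolyBounded g) :
    PolyBounded fun x => f x ^ (g x).size :=
  let ⟨c, hc⟩ := hf
  let ⟨d, hd⟩ := hg
  ⟨_, fun x => by
    refine le_trans ?_ (bd_pow_size_bd c d (_root_.sz x))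
    exact (Nat.pow_le_pow_left (hc x) _).trans
      (Nat.pow_le_pow_right (by have := two_le_bd c (_root_.sz x); omega)
        (Nat.size_le_size (hd x)))⟩

/-- Polynomially bounded functions are closed under composition. -/
theorem comp {f : β → ℕ} {g : α → β} (hf : PolyBounded f)
    (hg : PolyBounded fun x => _root_.sz (g x)) : PolyBounded fun x => f (g x) :=
  let ⟨c, hc⟩ := hf
  let ⟨d, hd⟩ := hg
  ⟨_, fun x => (hc _).trans ((bd_mono le_rfl (hd x)).trans (bd_bd c d _))⟩

end PolyBounded

namespace PSpaceFun

theorem polyBounded {f : α → β} (hf : PSpaceFun f) : PolyBounded fun x => sz (f x) := by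
  obtain ⟨c, hc⟩ := hf
  obtain ⟨p, hp⟩ := hc (List.range (width α)) (width α) (by simp)
  refine ((PolyBounded.const (width β)).mul ⟨max c 1, fun x => le_rfl⟩).mono fun x => ?_
  have hle : ∀ i ∈ enc x, i ≤ bd (max c 1) (sz x) := fun i hi =>
    (List.le_sum_of_mem hi).trans ((le_bd _).trans (bd_mono (le_max_right _ _) le_rfl))
  have hrun := hp x (blk 0 0 (enc x)) (bd (max c 1) (sz x)) (by
      have := map_blk_range' 0 0 [] (enc x) []
      simpa [length_enc, List.range_eq_range'] using this)
    (fun j hj => blk_eq_zero (by simpa [length_enc] using hj))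
    (blk_le (fun _ => Nat.zero_le _) hle) (bd_mono (le_max_left _ _) le_rfl)
  have hle' := hrun.le (blk_le (fun _ => Nat.zero_le _) hle)
  have := List.sum_le_card_nsmul (enc (f x)) (bd (max c 1) (sz x)) (by
    intro i hi
    obtain ⟨j, hj, rfl⟩ := List.getElem_of_mem hi
    have := hle' (width α + j)
    rwa [blk_add, List.getD_eq_getElem _ _ hj] at this)
  rw [length_enc] at this
  exact this

/-- Only the counters of the value matter, not its type. -/
theorem of_enc_eq {f : α → β} {g : α → γ} (hf : PSpaceFun f) (h : ∀ x, enc (g x) = enc (f x)) :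
    PSpaceFun g := by
  obtain ⟨c, hc⟩ := hf
  refine ⟨c, fun e r he => ?_⟩
  simpa only [h] using hc e r he

/-- Copies the counters at the addresses `e` to the addresses from `r` on. -/
def copiesProg : List ℕ → ℕ → Prog
  | [], _ => .skip
  | a :: e, r => .seq (copyProg a r (r + 1)) (copiesProg e (r + 1))

theorem run_copies {N : ℕ} {s : ℕ → ℕ} {r : ℕ} (e : List ℕ) (he : ∀ i ∈ e, i < r) :
    ∀ l : List ℕ, (∀ j, blk s r l j ≤ N) →
    Run N (copiesProg e (r + l.length)) (blk s r l) (blk s r (l ++ e.map s)) := by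
  induction e with
  | nil => intro l _; rw [List.map_nil, List.append_nil]; exact .skip _
  | cons a e ih =>
    intro l hl
    have ha := he a (by simp)
    have h1 := run_copy (N := N) (a := a) (b := r + l.length) (c := r + l.length + 1)
      (s := blk s r l) (by omega) (by omega) (by omega) (hl _) (blk_eq_zero le_rfl)
      (blk_eq_zero (by omega))
    rw [update_blk_length _ _ _ _ rfl, blk_lt ha] at h1
    have h2 := ih (fun i hi => he i (by simp [hi])) (l ++ [s a]) (h1.le hl)
    rw [List.length_append, List.length_singleton, ← add_assoc, List.append_assoc] at h2
    exact h1.seq h2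

/-- Functions that only select and rearrange counters. -/
theorem of_copies {f : α → β} (g : List ℕ → List ℕ) (hg : ∀ e, ∀ i ∈ g e, i ∈ e)
    (h : ∀ (s : ℕ → ℕ) e x, e.map s = enc x → (g e).map s = enc (f x)) : PSpaceFun f := by
  refine ⟨0, fun e r he => ⟨copiesProg (g e) r, fun x s N hx h0 hN _ => ?_⟩⟩
  have := run_copies (g e) (fun i hi => he i (hg e i hi)) [] (by rwa [blk_nil h0])
  rwa [blk_nil h0, List.nil_append, h s e x hx] at this

@[fun_prop]
protected theorem id : PSpaceFun fun x : α => x :=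
  of_copies (fun e => e) (fun _ _ h => h) fun _ _ _ h => h

@[fun_prop]
theorem fst : PSpaceFun fun x : α × β => x.1 :=
  of_copies (fun e => e.take (width α)) (fun _ _ h => List.mem_of_mem_take h) fun s e x h => by
    rw [List.map_take, h]
    simp only [enc]
    rw [← length_enc x.1, List.take_left]

@[fun_prop]
theorem snd : PSpaceFun fun x : α × β => x.2 :=
  of_copies (fun e => e.drop (width α)) (fun _ _ h => List.mem_of_mem_drop h) fun s e x h => by
    rw [List.map_drop, h]
    simp only [enc]
    rw [← length_enc x.1, List.drop_left]

@[fun_prop]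
theorem prodMk {f : α → β} {g : α → γ} (hf : PSpaceFun f) (hg : PSpaceFun g) :
    PSpaceFun fun x => (f x, g x) := by
  obtain ⟨c, hc⟩ := hf
  obtain ⟨d, hd⟩ := hg
  refine ⟨max c d, fun e r he => ?_⟩
  obtain ⟨p, hp⟩ := hc e r he
  obtain ⟨q, hq⟩ := hd e (r + width β) fun i hi => (he i hi).trans_le (by omega)
  refine ⟨.seq p q, fun x s N hx h0 hN hb => ?_⟩
  have h1 := hp x s N hx h0 hN ((bd_mono (le_max_left _ _) le_rfl).trans hb)
  have h2 := hq x _ N ((map_blk he).trans hx) (fun j hj => blk_eq_zero (by rwa [length_enc]))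
    (h1.le hN) ((bd_mono (le_max_right _ _) le_rfl).trans hb)
  refine (h1.seq h2).of_eq rfl ?_
  rw [← length_enc (f x), blk_blk]
  rfl

@[fun_prop]
theorem comp {f : β → γ} {g : α → β} (hf : PSpaceFun f) (hg : PSpaceFun g) :
    PSpaceFun fun x => f (g x) := by
  obtain ⟨k, hk⟩ := hg.polyBounded
  obtain ⟨c, hc⟩ := hf
  obtain ⟨d, hd⟩ := hg
  refine ⟨max d ((k + 2) * c), fun e r he => ?_⟩
  obtain ⟨p, hp⟩ := hd e r he
  obtain ⟨q, hq⟩ := hc (List.range' r (width β)) (r + width β) (by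
    intro i hi; rw [List.mem_range'_1] at hi; exact hi.2)
  -- The value of `g` is written first, then the value of `f`; then the former is deleted.
  refine ⟨.seq (.seq p q) (deleteProg r (width γ) (width β)), fun x s N hx h0 hN hb => ?_⟩
  have h1 := hp x s N hx h0 hN ((bd_mono (le_max_left _ _) le_rfl).trans hb)
  have h2 := hq (g x) _ N (by
      have := map_blk_range' s r [] (enc (g x)) []
      simpa [length_enc] using this) (fun j hj => blk_eq_zero (by rwa [length_enc])) (h1.le hN)
    (((bd_mono le_rfl (hk x)).trans ((bd_bd _ _ _).trans
      (bd_mono (le_max_right _ _) le_rfl))).trans hb)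
  have hbb : blk (blk s r (enc (g x))) (r + width β) (enc (f (g x))) =
      blk s r (enc (g x) ++ enc (f (g x))) := by rw [← length_enc (g x), blk_blk]
  rw [hbb] at h2
  have h3 := run_delete (r' := r) (l₀ := []) rfl (enc (f (g x))) (enc (g x)) ((h1.seq h2).le hN)
  rw [length_enc, length_enc] at h3
  exact (h1.seq h2).seq h3

/-- Adds `n` to the counter `r`. -/
def incsProg (r : ℕ) : ℕ → Prog
  | 0 => .skip
  | n + 1 => .seq (incsProg r n) (.inc r)

theorem run_incs {N : ℕ} {s : ℕ → ℕ} {r : ℕ} (h : s r = 0) (n : ℕ) (hn : n ≤ N) :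
    Run N (incsProg r n) s (update s r n) := by
  induction n with
  | zero => exact (Run.skip s).of_eq rfl (by rw [← h, update_eq_self])
  | succ n ih =>
    exact ((ih (by omega)).seq (.inc r _ (by simpa using hn))).of_eq rfl (by simp)

@[fun_prop]
theorem natConst (n : ℕ) : PSpaceFun fun _ : α => n := by
  obtain ⟨c, hc⟩ := PolyBounded.const (α := α) n
  refine ⟨c, fun e r he => ⟨incsProg r n, fun x s N _ h0 hN hb => ?_⟩⟩
  refine (run_incs (h0 r le_rfl) n ((hc x).trans hb)).of_eq rfl ?_
  have := update_blk_length s r [] n rfl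
  rwa [blk_nil h0] at this

@[fun_prop]
theorem succ : PSpaceFun Nat.succ := by
  refine ⟨2, fun e r he => ?_⟩
  refine ⟨.seq (copiesProg e r) (.inc r), fun x s N hx h0 hN hb => ?_⟩
  have h1 := run_copies e he [] (by rwa [blk_nil h0])
  rw [blk_nil h0, List.nil_append, hx] at h1
  have hr : blk s r (enc x) r = x := blk_apply s r [] [] x rfl
  have hx' : x + 1 ≤ bd 2 (sz x) := by
    have h1 := le_bd x
    have h2 := two_le_bd 1 x
    have h3 := bd_mul_bd 1 1 x
    rw [sz_nat]
    simp only [max_self] at h3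
    nlinarith
  refine (h1.seq (.inc r _ (by rw [hr]; exact hx'.trans hb))).of_eq rfl ?_
  rw [hr]
  exact update_blk s r [] [] x (x + 1) rfl

/-- Recursion is computable in polynomial space if all the intermediate values have polynomially
many digits. The counter `r` holds the number of the iterations that remain, the counter `r + 1` the
number of those that are done, and the current value is stored from `r + 2` on. -/
theorem natRec {n : α → ℕ} {g : α → β} {h : (α × ℕ) × β → β} (hn : PSpaceFun n)
    (hg : PSpaceFun g) (hh : PSpaceFun h) {B : α → ℕ} (hB : PolyBounded B)
    (hle : ∀ x, ∀ i ≤ n x, sz (Nat.rec (g x) (fun i y => h ((x, i), y)) i : β) ≤ B x) :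
    PSpaceFun fun x => (Nat.rec (g x) (fun i y => h ((x, i), y)) (n x) : β) := by
  have hnb := hn.polyBounded
  simp only [sz_nat] at hnb
  obtain ⟨k, hk⟩ := (PolyBounded.sz (α := α)).add (hnb.add hB)
  replace hk : ∀ x, sz x + (n x + B x) ≤ bd k (sz x) := hk
  obtain ⟨cn, hcn⟩ := hn
  obtain ⟨cg, hcg⟩ := hg
  obtain ⟨ch, hch⟩ := hh
  refine ⟨max (max cn cg) (max k ((k + 2) * ch)), fun e r he => ?_⟩
  obtain ⟨p, hp⟩ := hcn e r he
  obtain ⟨q, hq⟩ := hcg e (r + 2) fun i hi => (he i hi).trans_le (by omega)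
  obtain ⟨u, hu⟩ := hch (e ++ [r + 1] ++ List.range' (r + 2) (width β)) (r + 2 + width β) (by
    intro i hi
    simp only [List.append_assoc, List.mem_append, List.mem_singleton, List.mem_range'_1] at hi
    rcases hi with hi | hi | hi
    · have := he i hi; omega
    · omega
    · omega)
  refine ⟨.seq (.seq (.seq p q) (.loop r (.seq (.dec r) (.seq (.seq u
    (deleteProg (r + 2) (width β) (width β))) (.inc (r + 1)))))) (deleteProg r (width β) 2),
    fun x s N hx h0 hN hb => ?_⟩
  have hbn := (bd_mono (le_max_left cn cg) le_rfl).trans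
    ((bd_mono (le_max_left _ _) le_rfl).trans hb)
  have hbg := (bd_mono (le_max_right cn cg) le_rfl).trans
    ((bd_mono (le_max_left _ _) le_rfl).trans hb)
  have hbk := (bd_mono (le_max_left k ((k + 2) * ch)) le_rfl).trans
    ((bd_mono (le_max_right _ _) le_rfl).trans hb)
  have hbh := (bd_mono (le_max_right k ((k + 2) * ch)) le_rfl).trans
    ((bd_mono (le_max_right _ _) le_rfl).trans hb)
  set F : ℕ → β := fun i => Nat.rec (g x) (fun i y => h ((x, i), y)) i with hF
  have h1 := hp x s N hx h0 hN hbn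
  have h2 : Run N q (blk s r (enc (n x))) (blk s r ([n x, 0] ++ enc (g x))) := by
    have := hq x (blk s r [n x]) N ((map_blk he).trans hx)
      (fun j hj => blk_eq_zero (by simp; omega)) (h1.le hN) hbg
    refine this.of_eq rfl ?_
    rw [show [n x, 0] = [n x] ++ [0] from rfl, ← blk_append_zero s r [n x]]
    exact blk_blk s r ([n x] ++ [0]) (enc (g x))
  have h12 := (h1.seq h2).le hN
  have hstate : ∀ i ≤ n x, ∀ j, blk s r ([n x - i, i] ++ enc (F i)) j ≤ N := by
    intro i hi
    have h1 := hk x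
    have h2 : sz (F i) ≤ B x := hle x i hi
    refine blk_le hN fun a ha => ?_
    rcases List.mem_append.1 ha with ha | ha
    · simp only [List.mem_cons, List.not_mem_nil, or_false] at ha
      omega
    · have h3 : a ≤ sz (F i) := List.le_sum_of_mem ha
      omega
  have h3 : Run N (.loop r (.seq (.dec r) (.seq (.seq u
      (deleteProg (r + 2) (width β) (width β))) (.inc (r + 1)))))
      (blk s r ([n x, 0] ++ enc (g x))) (blk s r ([0, n x] ++ enc (F (n x)))) := by
    refine (Run.loop_of (n x) (fun i => blk s r ([n x - i, i] ++ enc (F i)))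
      (blk_apply s r [] _ _ (by simp) |>.trans (by simp)) (fun i hi => ?_) fun i hi => ?_).of_eq
        (by simp [hF]) (by simp)
    · have := blk_apply s r [] (i :: enc (F i)) (n x - i) (k := r) (by simp)
      simp only [List.nil_append] at this
      show blk s r ((n x - i) :: i :: enc (F i)) r ≠ 0
      rw [this]; omega
    · have e1 : Run N (.dec r) (blk s r ([n x - i, i] ++ enc (F i)))
          (blk s r ([n x - (i + 1), i] ++ enc (F i))) := by
        refine (Run.dec r _).of_eq rfl ?_
        have := blk_apply s r [] (i :: enc (F i)) (n x - i) (k := r) (by simp)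
        simp only [List.nil_append] at this
        rw [show [n x - i, i] ++ enc (F i) = (n x - i) :: i :: enc (F i) from rfl, this,
          Nat.sub_sub]
        exact update_blk s r [] _ _ _ (by simp)
      have l1 := e1.le (hstate i hi.le)
      have e2 := hu ((x, i), F i) _ N (by
          have g1 := map_blk_range' s r [n x - (i + 1)] [i] (enc (F i))
          have g2 := map_blk_range' s r [n x - (i + 1), i] (enc (F i)) []
          rw [List.append_nil, length_enc] at g2
          rw [List.map_append, List.map_append, map_blk he, hx]
          exact congrArg₂ (· ++ ·) (congrArg _ g1) g2)
        (fun j hj => blk_eq_zero (by simp [length_enc]; omega)) l1 (by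
          refine le_trans ((bd_mono le_rfl ?_).trans (bd_bd ch k _)) hbh
          have h1 := hk x
          have h2 := hle x i hi.le
          simp only [sz_prod, sz_nat]
          change sz (F i) ≤ B x at h2
          omega)
      have hbb : blk (blk s r ([n x - (i + 1), i] ++ enc (F i))) (r + 2 + width β)
          (enc (h ((x, i), F i))) =
          blk s r ([n x - (i + 1), i] ++ (enc (F i) ++ enc (F (i + 1)))) := by
        have := blk_blk s r ([n x - (i + 1), i] ++ enc (F i)) (enc (F (i + 1)))
        rw [← List.append_assoc, ← this]
        rw [List.length_append, length_enc, ← add_assoc]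
        rfl
      rw [hbb] at e2
      have e3 := run_delete (r' := r + 2) (l₀ := [n x - (i + 1), i]) rfl (enc (F (i + 1)))
        (enc (F i)) (e2.le l1)
      rw [length_enc, length_enc] at e3
      have hr1 := blk_apply s r [n x - (i + 1)] (enc (F (i + 1))) i (k := r + 1) rfl
      have e4 := update_blk s r [n x - (i + 1)] (enc (F (i + 1))) i (i + 1) (k := r + 1) rfl
      refine e1.seq ((e2.seq e3).seq ((Run.inc (r + 1) _ ?_).of_eq rfl ?_))
      · have h1 := hk x
        refine le_trans (Nat.succ_le_succ hr1.le) ?_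
        omega
      · exact Eq.trans (congrArg (fun v => update _ (r + 1) (v + 1)) hr1) e4
  have h4 := run_delete (r' := r) (l₀ := []) rfl (enc (F (n x))) [0, n x]
    (by simpa using hstate (n x) le_rfl)
  rw [length_enc] at h4
  exact ((h1.seq h2).seq h3).seq h4

end PSpaceFun

end

/-- A language that is decidable by programs on counters is in `PSPACE`: the input is cleared after
the verdict has been written. -/
theorem inPSPACE_of_pspaceFun {L : Language (Option Bool)}
    (h : PSpaceFun fun w : List (Option Bool) => w ∈ L) : InPSPACE L := by
  obtain ⟨c, hc⟩ := h
  obtain ⟨p, hp⟩ := hc [0] 1 (by simp)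
  refine inPSPACE_of_run (.seq p (.loop 0 (.dec 0))) (max c 1) fun w => ?_
  have hsz : sz w = wordVal w := by simp [sz, enc]
  have h1 : wordVal w ≤ bd (max c 1) (wordVal w) :=
    (le_bd _).trans (bd_mono (le_max_right _ _) le_rfl)
  have hrun := hp w (update 0 0 (wordVal w)) (bd (max c 1) (wordVal w)) rfl
    (fun j hj => by rw [update_of_ne (by omega)]; rfl)
    (fun j => by
      by_cases hj : j = 0
      · rw [hj, update_self]; exact h1
      · rw [update_of_ne hj]; exact Nat.zero_le _)
    (by rw [hsz]; exact bd_mono (le_max_left _ _) le_rfl)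
  refine ⟨_, le_rfl, h1, _, hrun.seq (run_clear _ 0 _), fun hw => ?_, fun hw => ?_⟩ <;>
  · funext j
    rcases j with _ | _ | j
    · simp
    · simp [blk, enc, hw]
    · simp [blk, enc]

namespace PSpaceFun

variable {α β γ : Type} [Coded α] [Coded β] [Coded γ]

/-! ### Arithmetic and logic in polynomial space -/

/-- The closure under recursion for a step function with separate arguments. -/
theorem rec' {n : α → ℕ} {g : α → β} {h : α → ℕ → β → β} (hn : PSpaceFun n)
    (hg : PSpaceFun g) (hh : PSpaceFun fun p : (α × ℕ) × β => h p.1.1 p.1.2 p.2) {B : α → ℕ}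
    (hB : PolyBounded B) (hle : ∀ x, ∀ i ≤ n x, sz (Nat.rec (g x) (h x) i : β) ≤ B x) :
    PSpaceFun fun x => (Nat.rec (g x) (h x) (n x) : β) :=
  natRec hn hg hh hB hle

theorem bounded {f : α → ℕ} (hf : PSpaceFun f) : PolyBounded f := by
  simpa using hf.polyBounded

/-- Recursion with values in `Prop` needs no bound. -/
theorem recProp {n : α → ℕ} {g : α → Prop} {h : α → ℕ → Prop → Prop} (hn : PSpaceFun n)
    (hg : PSpaceFun g) (hh : PSpaceFun fun p : (α × ℕ) × Prop => h p.1.1 p.1.2 p.2) :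
    PSpaceFun fun x => (Nat.rec (g x) (h x) (n x) : Prop) :=
  rec' hn hg hh (.const 1) fun _ _ _ => sz_prop_le _

@[fun_prop]
theorem ite {P : α → Prop} {f g : α → β} [∀ x, Decidable (P x)] (hP : PSpaceFun P)
    (hf : PSpaceFun f) (hg : PSpaceFun g) : PSpaceFun fun x => if P x then f x else g x := by
  have hn : PSpaceFun fun x => if P x then 1 else 0 :=
    hP.of_enc_eq fun x => by by_cases h : P x <;> simp [enc, h]
  refine (rec' (h := fun x _ _ => f x) hn hg (by fun_prop) (hf.polyBounded.add hg.polyBounded)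
    fun x i _ => ?_).of_enc_eq fun x => ?_
  · cases i <;> simp
  · by_cases h : P x <;> simp [h]

/-- A proposition may be computed as a number, since it is stored as one. -/
theorem prop_of_ite {P : α → Prop} [∀ x, Decidable (P x)]
    (h : PSpaceFun fun x => if P x then 1 else 0) : PSpaceFun P :=
  h.of_enc_eq fun x => by by_cases h : P x <;> simp [enc, h]

@[fun_prop]
theorem not {P : α → Prop} (hP : PSpaceFun P) : PSpaceFun fun x => ¬ P x := by
  classical
  exact prop_of_ite (by simpa [ite_not] using hP.ite (natConst 0) (natConst 1))

@[fun_prop]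
theorem and {P Q : α → Prop} (hP : PSpaceFun P) (hQ : PSpaceFun Q) :
    PSpaceFun fun x => P x ∧ Q x := by
  classical
  exact prop_of_ite ((hP.ite (hQ.ite (natConst 1) (natConst 0)) (natConst 0)).of_enc_eq
    fun x => by by_cases h : P x <;> simp [h])

@[fun_prop]
theorem or {P Q : α → Prop} (hP : PSpaceFun P) (hQ : PSpaceFun Q) :
    PSpaceFun fun x => P x ∨ Q x := by
  classical
  exact prop_of_ite ((hP.ite (natConst 1) (hQ.ite (natConst 1) (natConst 0))).of_enc_eq
    fun x => by by_cases h : P x <;> simp [h])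

@[fun_prop]
theorem imp {P Q : α → Prop} (hP : PSpaceFun P) (hQ : PSpaceFun Q) :
    PSpaceFun fun x => P x → Q x := by
  simpa only [imp_iff_not_or] using hP.not.or hQ

@[fun_prop]
theorem iff {P Q : α → Prop} (hP : PSpaceFun P) (hQ : PSpaceFun Q) :
    PSpaceFun fun x => P x ↔ Q x := by
  simpa only [iff_iff_implies_and_implies] using (hP.imp hQ).and (hQ.imp hP)

@[fun_prop]
theorem succ' {f : α → ℕ} (hf : PSpaceFun f) : PSpaceFun fun x => (f x).succ := succ.comp hf

@[fun_prop]
theorem add {f g : α → ℕ} (hf : PSpaceFun f) (hg : PSpaceFun g) :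
    PSpaceFun fun x => f x + g x := by
  have e : ∀ (x : α) (i : ℕ), (Nat.rec (f x) (fun _ y => y.succ) i : ℕ) = f x + i := by
    intro x i
    induction i with
    | zero => rfl
    | succ i ih => simp [ih]; ring
  refine (rec' (h := fun _ _ y => Nat.succ y) hg hf (by fun_prop) (hf.bounded.add hg.bounded)
    fun x i hi => ?_).of_enc_eq fun x => by rw [e]
  rw [e, sz_nat]; omega

theorem pred {f : α → ℕ} (hf : PSpaceFun f) : PSpaceFun fun x => f x - 1 := by
  have e : ∀ i : ℕ, (Nat.rec 0 (fun i _ => i) i : ℕ) = i - 1 := fun i => by cases i <;> rfl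
  refine (rec' (g := fun _ => 0) (h := fun _ i _ => i) hf (by fun_prop) (by fun_prop) hf.bounded
    fun x i hi => ?_).of_enc_eq fun x => by rw [e]
  rw [e, sz_nat]; omega

@[fun_prop]
theorem sub {f g : α → ℕ} (hf : PSpaceFun f) (hg : PSpaceFun g) :
    PSpaceFun fun x => f x - g x := by
  have e : ∀ (x : α) (i : ℕ), (Nat.rec (f x) (fun _ y => y - 1) i : ℕ) = f x - i := by
    intro x i
    induction i with
    | zero => rfl
    | succ i ih => simp [ih]; omega
  refine (rec' (h := fun _ _ y => y - 1) hg hf (pred (by fun_prop)) hf.bounded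
    fun x i hi => ?_).of_enc_eq fun x => by rw [e]
  rw [e, sz_nat]; omega

@[fun_prop]
theorem mul {f g : α → ℕ} (hf : PSpaceFun f) (hg : PSpaceFun g) :
    PSpaceFun fun x => f x * g x := by
  have e : ∀ (x : α) (i : ℕ), (Nat.rec 0 (fun _ y => y + f x) i : ℕ) = f x * i := by
    intro x i
    induction i with
    | zero => rfl
    | succ i ih => simp [ih]; ring
  refine (rec' (g := fun _ => 0) (h := fun x _ y => y + f x) hg (by fun_prop) (by fun_prop)
    (hf.bounded.mul hg.bounded) fun x i hi => ?_).of_enc_eq fun x => by rw [e]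
  rw [e, sz_nat]; gcongr

theorem pow {f g : α → ℕ} (hf : PSpaceFun f) (hg : PSpaceFun g)
    (hb : PolyBounded fun x => f x ^ g x) : PSpaceFun fun x => f x ^ g x := by
  have e : ∀ (x : α) (i : ℕ), (Nat.rec 1 (fun _ y => y * f x) i : ℕ) = f x ^ i := by
    intro x i
    induction i with
    | zero => rfl
    | succ i ih => simp [ih]; ring
  refine (rec' (g := fun _ => 1) (h := fun x _ y => y * f x) hg (by fun_prop) (by fun_prop)
    (hb.add (.const 1)) fun x i hi => ?_).of_enc_eq fun x => by rw [e]
  rw [e, sz_nat]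
  rcases Nat.eq_zero_or_pos (f x) with h | h
  · cases i <;> simp [h]
  · exact (Nat.pow_le_pow_right h hi).trans (Nat.le_add_right _ _)

theorem eq_zero {f : α → ℕ} (hf : PSpaceFun f) : PSpaceFun fun x => f x = 0 := by
  refine (recProp (g := fun _ => True) (h := fun _ _ _ => False) hf (by fun_prop)
    (by fun_prop)).of_enc_eq fun x => ?_
  cases f x <;> simp

@[fun_prop]
theorem le {f g : α → ℕ} (hf : PSpaceFun f) (hg : PSpaceFun g) :
    PSpaceFun fun x => f x ≤ g x := by
  simpa only [Nat.sub_eq_zero_iff_le] using (hf.sub hg).eq_zero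

@[fun_prop]
theorem lt {f g : α → ℕ} (hf : PSpaceFun f) (hg : PSpaceFun g) :
    PSpaceFun fun x => f x < g x := by
  simpa only [not_le] using (hg.le hf).not

@[fun_prop]
theorem eq {f g : α → ℕ} (hf : PSpaceFun f) (hg : PSpaceFun g) :
    PSpaceFun fun x => f x = g x := by
  simpa only [le_antisymm_iff] using (hf.le hg).and (hg.le hf)

@[fun_prop]
theorem min {f g : α → ℕ} (hf : PSpaceFun f) (hg : PSpaceFun g) :
    PSpaceFun fun x => Min.min (f x) (g x) := by
  simpa only [min_def] using (hf.le hg).ite hf hg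

theorem ball {n : α → ℕ} {P : α → ℕ → Prop} (hn : PSpaceFun n)
    (hP : PSpaceFun fun p : α × ℕ => P p.1 p.2) : PSpaceFun fun x => ∀ i < n x, P x i := by
  refine (recProp (g := fun _ => True) (h := fun x i Q => Q ∧ P x i) hn (by fun_prop)
    (.and (by fun_prop) (hP.comp (by fun_prop)))).of_enc_eq fun x => congrArg enc ?_
  induction n x with
  | zero => simp
  | succ n ih => simp only [← ih, Nat.lt_succ_iff_lt_or_eq, or_imp, forall_and, forall_eq]

theorem bex {n : α → ℕ} {P : α → ℕ → Prop} (hn : PSpaceFun n)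
    (hP : PSpaceFun fun p : α × ℕ => P p.1 p.2) : PSpaceFun fun x => ∃ i < n x, P x i := by
  simpa using (hn.ball (P := fun x i => ¬ P x i) hP.not).not

theorem sum {n : α → ℕ} {f : α → ℕ → ℕ} (hn : PSpaceFun n)
    (hf : PSpaceFun fun p : α × ℕ => f p.1 p.2) :
    PSpaceFun fun x => ∑ i ∈ Finset.range (n x), f x i := by
  have e : ∀ (x : α) (i : ℕ), (Nat.rec 0 (fun i y => y + f x i) i : ℕ) =
      ∑ j ∈ Finset.range i, f x j := by
    intro x i
    induction i with
    | zero => rfl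
    | succ i ih => simp [ih, Finset.sum_range_succ]
  obtain ⟨c, hc⟩ := hf.bounded
  have hB : PolyBounded fun x => n x * bd c (sz x + n x) :=
    hn.bounded.mul (PolyBounded.comp (f := fun n : ℕ => bd c n) ⟨c, fun n => by rw [sz_nat]⟩
      (by simpa using PolyBounded.sz.add hn.bounded))
  refine (rec' (g := fun _ => 0) (h := fun x i y => y + f x i) hn (by fun_prop)
    (.add (by fun_prop) (hf.comp (by fun_prop))) hB fun x i hi => ?_).of_enc_eq fun x => by rw [e]
  rw [e, sz_nat]
  calc ∑ j ∈ Finset.range i, f x j ≤ ∑ j ∈ Finset.range i, bd c (sz x + n x) := by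
        refine Finset.sum_le_sum fun j hj => (hc (x, j)).trans (bd_mono le_rfl ?_)
        have := Finset.mem_range.1 hj
        simp only [sz_prod, sz_nat]
        omega
    _ ≤ n x * bd c (sz x + n x) := by simpa using Nat.mul_le_mul_right _ hi

end PSpaceFun

open Classical in
/-- The least number below `n` with the property `P`, or `n` if there is none. -/
noncomputable def leastBelow (n : ℕ) (P : ℕ → Prop) : ℕ :=
  Nat.rec 0 (fun i y => if y < i then y else if P i then i else i + 1) n

theorem leastBelow_spec (n : ℕ) (P : ℕ → Prop) : leastBelow n P ≤ n ∧
    (∀ i < leastBelow n P, ¬ P i) ∧ (leastBelow n P < n → P (leastBelow n P)) := by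
  classical
  induction n with
  | zero => simp [leastBelow]
  | succ n ih =>
    have h : leastBelow (n + 1) P = if leastBelow n P < n then leastBelow n P else
      if P n then n else n + 1 := rfl
    rw [h]
    split_ifs with h1 h2
    · exact ⟨by omega, ih.2.1, fun _ => ih.2.2 h1⟩
    · refine ⟨by omega, fun i hi => ih.2.1 i (by omega), fun _ => h2⟩
    · refine ⟨le_rfl, fun i hi => ?_, fun h => absurd h (lt_irrefl _)⟩
      rcases Nat.lt_succ_iff_lt_or_eq.1 hi with hi | rfl
      · exact ih.2.1 i (by omega)
      · exact h2

theorem leastBelow_eq {n m : ℕ} {P : ℕ → Prop} (hm : m ≤ n) (h1 : ∀ i < m, ¬ P i)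
    (h2 : m < n → P m) : leastBelow n P = m := by
  obtain ⟨g0, g1, g2⟩ := leastBelow_spec n P
  rcases lt_trichotomy (leastBelow n P) m with h | h | h
  · exact absurd (g2 (by omega)) (h1 _ h)
  · exact h
  · exact absurd (h2 (by omega)) (g1 _ h)

namespace PSpaceFun

variable {α β γ : Type} [Coded α] [Coded β] [Coded γ]

/-- Bounded search. It may take exponentially many steps, but only one candidate is stored. -/
theorem least {n : α → ℕ} {P : α → ℕ → Prop} (hn : PSpaceFun n)
    (hP : PSpaceFun fun p : α × ℕ => P p.1 p.2) : PSpaceFun fun x => leastBelow (n x) (P x) := by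
  classical
  have hP' : PSpaceFun fun p : (α × ℕ) × ℕ => P p.1.1 p.1.2 := hP.comp (by fun_prop)
  refine (rec' (g := fun _ => 0) (h := fun x i y => if y < i then y else if P x i then i else i + 1)
    hn (by fun_prop) (.ite (by fun_prop) (by fun_prop) (.ite hP' (by fun_prop) (by fun_prop)))
    hn.bounded fun x i hi => ?_).of_enc_eq fun x => ?_
  · rw [sz_nat]
    refine le_trans (le_of_eq_of_le ?_ (leastBelow_spec i (P x)).1) hi
    rw [leastBelow]
  · rw [leastBelow]

@[fun_prop]
theorem div {f g : α → ℕ} (hf : PSpaceFun f) (hg : PSpaceFun g) :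
    PSpaceFun fun x => f x / g x := by
  classical
  have h := (hg.eq_zero).ite (natConst 0) (least (P := fun x q => f x < (q + 1) * g x) hf.succ'
    (.lt (hf.comp fst) (.mul (by fun_prop) (hg.comp fst))))
  refine h.of_enc_eq fun x => ?_
  split_ifs with h0
  · simp [h0]
  · have h0 := Nat.pos_of_ne_zero h0
    refine congrArg enc (leastBelow_eq ((Nat.div_le_self _ _).trans (Nat.le_succ _))
      (fun i hi => ?_) fun _ => ?_).symm
    · rw [not_lt]
      exact (Nat.mul_le_mul_right _ hi).trans (Nat.div_mul_le_self _ _)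
    · rw [← Nat.div_lt_iff_lt_mul h0]
      exact Nat.lt_succ_self _

@[fun_prop]
theorem mod {f g : α → ℕ} (hf : PSpaceFun f) (hg : PSpaceFun g) :
    PSpaceFun fun x => f x % g x := by
  simpa only [Nat.mod_eq_sub_mul_div] using hf.sub (hg.mul (hf.div hg))

/-- The quotient by a power is computable although the power may be too large. -/
theorem div_pow {f g n : α → ℕ} (hf : PSpaceFun f) (hg : PSpaceFun g) (hn : PSpaceFun n) :
    PSpaceFun fun x => f x / g x ^ n x := by
  have e : ∀ (x : α) (i : ℕ), (Nat.rec (f x) (fun _ y => y / g x) i : ℕ) = f x / g x ^ i := by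
    intro x i
    induction i with
    | zero => simp
    | succ i ih => simp [ih, Nat.div_div_eq_div_mul, pow_succ]
  refine (rec' (h := fun x _ y => y / g x) hn hf (by fun_prop)
    hf.bounded fun x i hi => ?_).of_enc_eq fun x => by rw [e]
  rw [e, sz_nat]
  exact Nat.div_le_self _ _

@[fun_prop]
theorem size {f : α → ℕ} (hf : PSpaceFun f) : PSpaceFun fun x => (f x).size := by
  refine (least (P := fun x i => f x / 2 ^ i = 0) hf
    ((div_pow (hf.comp fst) (natConst 2) snd).eq_zero)).of_enc_eq fun x => congrArg enc ?_
  have key : ∀ i, f x / 2 ^ i = 0 ↔ (f x).size ≤ i := fun i => by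
    rw [Nat.div_eq_zero_iff, Nat.size_le]; simp
  refine (leastBelow_eq (Nat.size_le.2 (Nat.lt_two_pow_self)) (fun i hi => ?_) fun _ => ?_).symm
  · rw [key]; omega
  · rw [key]

end PSpaceFun

/-! ### Reachability in exponentially large graphs -/

/-- The edges of a graph on the numbers below `M`. -/
def EdgeBelow (E : ℕ → ℕ → Prop) (M u v : ℕ) : Prop := u < M ∧ v < M ∧ E u v

/-- There is a path of length at most `2 ^ d`, by recursion on the middle vertex. -/
def Midpoint (E : ℕ → ℕ → Prop) (M : ℕ) : ℕ → ℕ × ℕ → Prop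
  | 0, p => p.1 = p.2 ∨ EdgeBelow E M p.1 p.2
  | d + 1, p => ∃ w < M, Midpoint E M d (p.1, w) ∧ Midpoint E M d (w, p.2)

/-- There is a path of length at most `n`. -/
def Within (r : ℕ → ℕ → Prop) : ℕ → ℕ → ℕ → Prop
  | 0, u, v => u = v
  | n + 1, u, v => Within r n u v ∨ ∃ w, Within r n u w ∧ r w v

theorem Within.mono {r : ℕ → ℕ → Prop} {m n u v : ℕ} (h : Within r m u v) (hmn : m ≤ n) :
    Within r n u v := by
  induction hmn with
  | refl => exact h
  | step _ ih => exact Or.inl ih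

theorem within_add {r : ℕ → ℕ → Prop} {m n u v : ℕ} :
    Within r (m + n) u v ↔ ∃ w, Within r m u w ∧ Within r n w v := by
  induction n generalizing v with
  | zero => simp [Within]
  | succ n ih =>
    change (Within r (m + n) u v ∨ ∃ w, Within r (m + n) u w ∧ r w v) ↔ _
    simp only [ih, Within]
    constructor
    · rintro (⟨w, h1, h2⟩ | ⟨x, ⟨w, h1, h2⟩, h3⟩)
      · exact ⟨w, h1, Or.inl h2⟩
      · exact ⟨w, h1, Or.inr ⟨x, h2, h3⟩⟩
    · rintro ⟨w, h1, h2 | ⟨x, h2, h3⟩⟩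
      · exact Or.inl ⟨w, h1, h2⟩
      · exact Or.inr ⟨x, ⟨w, h1, h2⟩, h3⟩

theorem Within.reflTransGen {r : ℕ → ℕ → Prop} {n u v : ℕ} (h : Within r n u v) :
    ReflTransGen r u v := by
  induction n generalizing v with
  | zero => exact h ▸ .refl
  | succ n ih =>
    rcases h with h | ⟨w, h1, h2⟩
    · exact ih h
    · exact (ih h1).tail h2

theorem reach_lt {E : ℕ → ℕ → Prop} {M u v : ℕ} (hu : u < M)
    (h : ReflTransGen (EdgeBelow E M) u v) : v < M := by
  induction h with
  | refl => exact hu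
  | tail _ h _ => exact h.2.1

/-- In a graph with `M` vertices, paths of length at most `M` suffice: the set of the vertices
within distance `n` grows with `n` until it is closed. -/
theorem within_of_reach {E : ℕ → ℕ → Prop} {M u v : ℕ} (hu : u < M)
    (h : ReflTransGen (EdgeBelow E M) u v) : Within (EdgeBelow E M) M u v := by
  classical
  have key : ∀ n, (∀ v, ReflTransGen (EdgeBelow E M) u v → Within (EdgeBelow E M) n u v) ∨
      n + 1 ≤ ((Finset.range M).filter fun v => Within (EdgeBelow E M) n u v).card := by
    intro n
    induction n with
    | zero =>
      right
      exact Finset.card_pos.2 ⟨u, Finset.mem_filter.2 ⟨Finset.mem_range.2 hu, rfl⟩⟩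
    | succ n ih =>
      rcases ih with ih | ih
      · exact Or.inl fun v hv => Or.inl (ih v hv)
      · by_cases hc : ∀ v, Within (EdgeBelow E M) (n + 1) u v → Within (EdgeBelow E M) n u v
        · left
          intro v hv
          left
          induction hv with
          | refl => exact Within.mono (m := 0) rfl (Nat.zero_le _)
          | tail _ h2 ih => exact hc _ (Or.inr ⟨_, ih, h2⟩)
        · right
          push Not at hc
          obtain ⟨w, hw1, hw2⟩ := hc
          refine (Nat.succ_le_succ ih).trans (Finset.card_lt_card ?_)
          refine Finset.ssubset_iff_subset_ne.2 ⟨fun x hx => ?_, fun he => hw2 ?_⟩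
          · rw [Finset.mem_filter] at hx ⊢
            exact ⟨hx.1, Or.inl hx.2⟩
          · have : w ∈ (Finset.range M).filter fun v => Within (EdgeBelow E M) (n + 1) u v := by
              simp [hw1, reach_lt hu hw1.reflTransGen]
            rw [← he, Finset.mem_filter] at this
            exact this.2
  rcases key M with h' | h'
  · exact h' v h
  · have := Finset.card_filter_le (Finset.range M) fun v => Within (EdgeBelow E M) M u v
    rw [Finset.card_range] at this
    omega

theorem midpoint_iff {E : ℕ → ℕ → Prop} {M : ℕ} (d : ℕ) : ∀ {u v : ℕ}, u < M →
    (Midpoint E M d (u, v) ↔ Within (EdgeBelow E M) (2 ^ d) u v) := by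
  induction d with
  | zero => intro u v hu; simp [Midpoint, Within]
  | succ d ih =>
    intro u v hu
    rw [pow_succ, mul_two, within_add]
    constructor
    · rintro ⟨w, hw, h1, h2⟩
      exact ⟨w, (ih hu).1 h1, (ih hw).1 h2⟩
    · rintro ⟨w, h1, h2⟩
      have hw := reach_lt hu h1.reflTransGen
      exact ⟨w, hw, (ih hu).2 h1, (ih hw).2 h2⟩

theorem midpoint_size_iff {E : ℕ → ℕ → Prop} {M u v : ℕ} (hu : u < M) :
    Midpoint E M M.size (u, v) ↔ ReflTransGen (EdgeBelow E M) u v := by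
  rw [midpoint_iff _ hu]
  exact ⟨Within.reflTransGen, fun h => (within_of_reach hu h).mono M.lt_size_self.le⟩

/-! ### Depth-first search for the midpoints -/

/-- The digit of index `i` of `s` in base `B`. -/
def dig (B s i : ℕ) : ℕ := s / B ^ i % B

/-- The pair of vertices that is considered at depth `j` of the recursion. The state `s` of the
search is a number with `D` digits in base `2 * M`. The digit `2 * w + b` at a level tells that the
middle vertex is `w` and that the recursion has descended to the first half of the path (`b = 0`)
or to the second one (`b = 1`). -/
def pairAt (M D u v s : ℕ) (j : ℕ) : ℕ × ℕ :=
  Nat.rec (u, v) (fun j p => if dig (2 * M) s (D - 1 - j) % 2 = 0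
    then (p.1, dig (2 * M) s (D - 1 - j) / 2) else (dig (2 * M) s (D - 1 - j) / 2, p.2)) j

/-- The pair at the bottom of the recursion is joined by a path of length at most `1`. -/
def LeafTrue (E : ℕ → ℕ → Prop) (M D u v s : ℕ) : Prop :=
  (pairAt M D u v s D).1 = (pairAt M D u v s D).2 ∨
    EdgeBelow E M (pairAt M D u v s D).1 (pairAt M D u v s D).2

open Classical in
/-- One step of the search. After a success at the bottom it proceeds to the second half at the
lowest level that is in its first half; after a failure it proceeds to the next middle vertex at the
lowest level where there is one. If there is no such level, then the search is over. -/
noncomputable def searchStep (E : ℕ → ℕ → Prop) (M D u v s : ℕ) : ℕ :=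
  if LeafTrue E M D u v s then
    if leastBelow D (fun i => dig (2 * M) s i % 2 = 0) < D then
      (s / (2 * M) ^ leastBelow D (fun i => dig (2 * M) s i % 2 = 0) + 1) *
        (2 * M) ^ leastBelow D (fun i => dig (2 * M) s i % 2 = 0)
    else s
  else
    if leastBelow D (fun i => dig (2 * M) s i / 2 + 1 < M) < D then
      (s / (2 * M) ^ leastBelow D (fun i => dig (2 * M) s i / 2 + 1 < M) +
        (2 - dig (2 * M) s (leastBelow D (fun i => dig (2 * M) s i / 2 + 1 < M)) % 2)) *
        (2 * M) ^ leastBelow D (fun i => dig (2 * M) s i / 2 + 1 < M)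
    else s

/-- The verdict of the search: whether the last pair at the bottom was joined by an edge. Every step
increases the state until the search is over, and the states are below `(2 * M) ^ M.size`, so that
this number of steps suffices. -/
def Search (E : ℕ → ℕ → Prop) (M u v : ℕ) : Prop :=
  LeafTrue E M M.size u v
    (Nat.rec 0 (fun _ s => searchStep E M M.size u v s) ((2 * M) ^ M.size))

section Search

variable {E : ℕ → ℕ → Prop} {M D u v : ℕ}

theorem dig_mul_add {B h y d : ℕ} (hy : y < B ^ d) : dig B (h * B ^ d + y) d = h % B := by
  rw [dig, mul_comm, Nat.mul_add_div (by omega), Nat.div_eq_of_lt hy, add_zero]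

theorem pairAt_succ (s j : ℕ) : pairAt M D u v s (j + 1) =
    if dig (2 * M) s (D - 1 - j) % 2 = 0
    then ((pairAt M D u v s j).1, dig (2 * M) s (D - 1 - j) / 2)
    else (dig (2 * M) s (D - 1 - j) / 2, (pairAt M D u v s j).2) := rfl

/-- The pair at depth `j` depends only on the `j` highest digits of the state. -/
theorem pairAt_congr {s t : ℕ} (j : ℕ) (hj : j ≤ D)
    (h : s / (2 * M) ^ (D - j) = t / (2 * M) ^ (D - j)) :
    pairAt M D u v s j = pairAt M D u v t j := by
  induction j with
  | zero => rfl
  | succ j ih =>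
    have e : D - 1 - j = D - (j + 1) := by omega
    have h1 : pairAt M D u v s j = pairAt M D u v t j := by
      refine ih (by omega) ?_
      rw [show D - j = D - (j + 1) + 1 by omega, pow_succ, ← Nat.div_div_eq_div_mul, h,
        Nat.div_div_eq_div_mul]
    have h2 : dig (2 * M) s (D - 1 - j) = dig (2 * M) t (D - 1 - j) := by
      rw [e, dig, dig, h]
    rw [pairAt_succ, pairAt_succ, h1, h2]

theorem bump_le {B s i a : ℕ} (hB : 0 < B) (ha : 0 < a) : s ≤ (s / B ^ i + a) * B ^ i := by
  have h1 := Nat.div_add_mod s (B ^ i)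
  have h2 := Nat.mod_lt s (pow_pos hB i)
  have h3 := Nat.le_mul_of_pos_left (B ^ i) ha
  rw [add_mul, mul_comm (s / B ^ i)]
  omega

theorem bump_lt {B s i a D : ℕ} (hB : 0 < B) (hs : s < B ^ D) (hi : i < D)
    (ha : dig B s i + a < B) : (s / B ^ i + a) * B ^ i < B ^ D := by
  obtain ⟨k, rfl⟩ : ∃ k, D = k + 1 + i := ⟨D - i - 1, by omega⟩
  rw [pow_add] at hs ⊢
  refine Nat.mul_lt_mul_of_pos_right ?_ (pow_pos hB i)
  have h1 : s / B ^ i < B ^ (k + 1) := Nat.div_lt_of_lt_mul (by rwa [mul_comm])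
  rw [dig] at ha
  have h2 := Nat.div_add_mod (s / B ^ i) B
  have h3 : s / B ^ i / B < B ^ k := Nat.div_lt_of_lt_mul (by rwa [pow_succ, mul_comm] at h1)
  rw [pow_succ]
  nlinarith

theorem le_searchStep (hM : 0 < D → 0 < M) (s : ℕ) : s ≤ searchStep E M D u v s := by
  unfold searchStep
  split_ifs with h1 h2 h3
  · exact bump_le (by have := hM (by omega); omega) one_pos
  · exact le_rfl
  · exact bump_le (by have := hM (by omega); omega) (by omega)
  · exact le_rfl

theorem searchStep_lt (hM : 0 < D → 0 < M) {s : ℕ} (hs : s < (2 * M) ^ D) :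
    searchStep E M D u v s < (2 * M) ^ D := by
  unfold searchStep
  split_ifs with h1 h2 h3
  · have hB : 0 < 2 * M := by have := hM (by omega); omega
    refine bump_lt hB hs h2 ?_
    have := (leastBelow_spec D (fun i => dig (2 * M) s i % 2 = 0)).2.2 h2
    have h4 : dig (2 * M) s (leastBelow D (fun i => dig (2 * M) s i % 2 = 0)) < 2 * M :=
      Nat.mod_lt _ hB
    omega
  · exact hs
  · have hB : 0 < 2 * M := by have := hM (by omega); omega
    refine bump_lt hB hs h3 ?_
    have := (leastBelow_spec D (fun i => dig (2 * M) s i / 2 + 1 < M)).2.2 h3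
    omega
  · exact hs

/-- The search has succeeded at the levels below `d`. -/
def Succeeded (E : ℕ → ℕ → Prop) (M D u v d s : ℕ) : Prop :=
  LeafTrue E M D u v s ∧ ∀ i < d, dig (2 * M) s i % 2 = 1

/-- The search has failed at the levels below `d`. -/
def Failed (E : ℕ → ℕ → Prop) (M D u v d s : ℕ) : Prop :=
  ¬ LeafTrue E M D u v s ∧ ∀ i < d, ¬ dig (2 * M) s i / 2 + 1 < M

theorem Succeeded.searchStep {d s : ℕ} (h : Succeeded E M D u v d s) (hd : d < D)
    (h0 : dig (2 * M) s d % 2 = 0) :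
    searchStep E M D u v s = (s / (2 * M) ^ d + 1) * (2 * M) ^ d := by
  have : leastBelow D (fun i => dig (2 * M) s i % 2 = 0) = d :=
    leastBelow_eq hd.le (fun i hi => by have := h.2 i hi; omega) fun _ => h0
  rw [_root_.searchStep, if_pos h.1, this, if_pos hd]

theorem Failed.searchStep {d s : ℕ} (h : Failed E M D u v d s) (hd : d < D)
    (h0 : dig (2 * M) s d / 2 + 1 < M) : searchStep E M D u v s =
      (s / (2 * M) ^ d + (2 - dig (2 * M) s d % 2)) * (2 * M) ^ d := by
  have : leastBelow D (fun i => dig (2 * M) s i / 2 + 1 < M) = d :=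
    leastBelow_eq hd.le h.2 fun _ => h0
  rw [_root_.searchStep, if_neg h.1, this, if_pos hd]

theorem Succeeded.fixed {s : ℕ} (h : Succeeded E M D u v D s) :
    _root_.searchStep E M D u v s = s := by
  have : leastBelow D (fun i => dig (2 * M) s i % 2 = 0) = D :=
    leastBelow_eq le_rfl (fun i hi => by have := h.2 i hi; omega) (by simp)
  rw [_root_.searchStep, if_pos h.1, this, if_neg (lt_irrefl _)]

theorem Failed.fixed {s : ℕ} (h : Failed E M D u v D s) :
    _root_.searchStep E M D u v s = s := by
  have : leastBelow D (fun i => dig (2 * M) s i / 2 + 1 < M) = D :=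
    leastBelow_eq le_rfl h.2 (by simp)
  rw [_root_.searchStep, if_neg h.1, this, if_neg (lt_irrefl _)]

/-- One state of the search leads to another one. -/
def Leads (E : ℕ → ℕ → Prop) (M D u v s t : ℕ) : Prop := ∃ n, (searchStep E M D u v)^[n] s = t

theorem Leads.trans {s t w : ℕ} (h1 : Leads E M D u v s t) (h2 : Leads E M D u v t w) :
    Leads E M D u v s w := by
  obtain ⟨m, rfl⟩ := h1
  obtain ⟨n, rfl⟩ := h2
  exact ⟨n + m, iterate_add_apply _ _ _ _⟩

theorem Leads.step {s t w : ℕ} (h1 : Leads E M D u v s t) (h2 : searchStep E M D u v t = w) :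
    Leads E M D u v s w := h1.trans ⟨1, h2⟩

/-- Started with the digits `0` below the level `d`, the search decides whether there is a path of
length at most `2 ^ d` between the vertices that are considered at this level. -/
theorem leads_of_midpoint (hM : 0 < D → 0 < M) (d : ℕ) : d ≤ D → ∀ h : ℕ,
    ∃ y < (2 * M) ^ d, Leads E M D u v (h * (2 * M) ^ d) (h * (2 * M) ^ d + y) ∧
      (Midpoint E M d (pairAt M D u v (h * (2 * M) ^ d) (D - d)) →
        Succeeded E M D u v d (h * (2 * M) ^ d + y)) ∧
      (¬ Midpoint E M d (pairAt M D u v (h * (2 * M) ^ d) (D - d)) →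
        Failed E M D u v d (h * (2 * M) ^ d + y)) := by
  induction d with
  | zero =>
    intro _ h
    refine ⟨0, by simp, ⟨0, rfl⟩, fun h => ⟨h, by simp⟩, fun h => ⟨h, by simp⟩⟩
  | succ d ih =>
    intro hd h
    have hM0 : 0 < M := hM (by omega)
    have hB : 0 < 2 * M := by omega
    have hBd : 0 < (2 * M) ^ d := pow_pos hB d
    set B := 2 * M with hBdef
    set p := pairAt M D u v (h * B ^ (d + 1)) (D - (d + 1)) with hp
    clear_value B
    -- the state in which the recursion has just descended according to the digit `c`
    have hsub : ∀ c < B, pairAt M D u v ((h * B + c) * B ^ d) (D - d) =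
        if c % 2 = 0 then (p.1, c / 2) else (c / 2, p.2) := by
      intro c hc
      have e1 : pairAt M D u v ((h * B + c) * B ^ d) (D - (d + 1)) = p := by
        refine pairAt_congr _ (by omega) ?_
        rw [show D - (D - (d + 1)) = d + 1 by omega, ← hBdef,
          Nat.mul_div_cancel h (pow_pos hB _), pow_succ, ← Nat.div_div_eq_div_mul,
          Nat.mul_div_cancel _ hBd, mul_comm h, Nat.mul_add_div hB, Nat.div_eq_of_lt hc, add_zero]
      have e2 : dig B ((h * B + c) * B ^ d) d = c := by
        have := dig_mul_add (h := h * B + c) hBd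
        rw [add_zero] at this
        rw [this, mul_comm, Nat.mul_add_mod, Nat.mod_eq_of_lt hc]
      rw [show D - d = D - (d + 1) + 1 by omega, pairAt_succ, e1,
        show D - 1 - (D - (d + 1)) = d by omega, ← hBdef, e2]
    have hdig : ∀ c < B, ∀ y < B ^ d, dig B ((h * B + c) * B ^ d + y) d = c := by
      intro c hc y hy
      rw [dig_mul_add hy, mul_comm, Nat.mul_add_mod, Nat.mod_eq_of_lt hc]
    have hdiv : ∀ c, ∀ y < B ^ d, ((h * B + c) * B ^ d + y) / B ^ d = h * B + c := by
      intro c y hy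
      rw [mul_comm, Nat.mul_add_div hBd, Nat.div_eq_of_lt hy, add_zero]
    have hfirst : ∀ w < M, Midpoint E M d (p.1, w) →
        Leads E M D u v ((h * B + 2 * w) * B ^ d) ((h * B + (2 * w + 1)) * B ^ d) := by
      intro w hw h1
      obtain ⟨y, hy, hl, hs, -⟩ := ih (by omega) (h * B + 2 * w)
      rw [hsub _ (by omega), if_pos (by omega), Nat.mul_div_cancel_left _ two_pos] at hs
      refine hl.step ?_
      rw [(hs h1).searchStep (by omega) (by rw [← hBdef, hdig _ (by omega) y hy]; omega), ← hBdef,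
        hdiv _ y hy]
      rfl
    have hnext : ∀ w, w + 1 < M →
        ¬ (Midpoint E M d (p.1, w) ∧ Midpoint E M d (w, p.2)) →
        Leads E M D u v ((h * B + 2 * w) * B ^ d) ((h * B + 2 * (w + 1)) * B ^ d) := by
      intro w hw hnot
      by_cases h1 : Midpoint E M d (p.1, w)
      · refine (hfirst w (by omega) h1).trans ?_
        obtain ⟨y, hy, hl, -, hf⟩ := ih (by omega) (h * B + (2 * w + 1))
        rw [hsub _ (by omega), if_neg (by omega), show (2 * w + 1) / 2 = w by omega] at hf
        refine hl.step ?_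
        rw [(hf fun h2 => hnot ⟨h1, h2⟩).searchStep (by omega)
          (by rw [← hBdef, hdig _ (by omega) y hy]; omega), ← hBdef, hdiv _ y hy,
          hdig _ (by omega) y hy]
        congr 1
        omega
      · obtain ⟨y, hy, hl, -, hf⟩ := ih (by omega) (h * B + 2 * w)
        rw [hsub _ (by omega), if_pos (by omega), Nat.mul_div_cancel_left _ two_pos] at hf
        refine hl.step ?_
        rw [(hf h1).searchStep (by omega) (by rw [← hBdef, hdig _ (by omega) y hy]; omega), ← hBdef,
          hdiv _ y hy, hdig _ (by omega) y hy]
        congr 1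
        omega
    have hreach : ∀ w < M,
        (∀ w' < w, ¬ (Midpoint E M d (p.1, w') ∧ Midpoint E M d (w', p.2))) →
        Leads E M D u v (h * B ^ (d + 1)) ((h * B + 2 * w) * B ^ d) := by
      intro w
      induction w with
      | zero => intro _ _; exact ⟨0, by rw [pow_succ]; simp; ring⟩
      | succ w ihw =>
        intro hw hnot
        exact (ihw (by omega) fun w' hw' => hnot w' (by omega)).trans
          (hnext w hw (hnot w (by omega)))
    have heq : ∀ c y, (h * B + c) * B ^ d + y = h * B ^ (d + 1) + (c * B ^ d + y) := by
      intro c y; ring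
    have hlt : ∀ c < B, ∀ y < B ^ d, c * B ^ d + y < B ^ (d + 1) := by
      intro c hc y hy
      rw [pow_succ]
      nlinarith
    by_cases hmid : Midpoint E M (d + 1) p
    · classical
      have hex : ∃ w, w < M ∧ Midpoint E M d (p.1, w) ∧ Midpoint E M d (w, p.2) := hmid
      obtain ⟨hwM, hw1, hw2⟩ := Nat.find_spec hex
      set w := Nat.find hex with hw
      have hmin : ∀ w' < w, ¬ (Midpoint E M d (p.1, w') ∧ Midpoint E M d (w', p.2)) :=
        fun w' hw' hh => Nat.find_min hex hw' ⟨by omega, hh⟩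
      obtain ⟨y, hy, hl, hs, -⟩ := ih (by omega) (h * B + (2 * w + 1))
      rw [hsub _ (by omega), if_neg (by omega), show (2 * w + 1) / 2 = w by omega] at hs
      refine ⟨(2 * w + 1) * B ^ d + y, hlt _ (by omega) y hy, ?_, fun _ => ?_,
        fun hn => absurd hmid hn⟩
      · rw [← heq]
        exact ((hreach w hwM hmin).trans (hfirst w hwM hw1)).trans hl
      · rw [← heq]
        refine ⟨(hs hw2).1, fun i hi => ?_⟩
        rcases Nat.lt_succ_iff_lt_or_eq.1 hi with hi | rfl
        · exact (hs hw2).2 i hi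
        · rw [← hBdef, hdig _ (by omega) y hy]; omega
    · have hno : ∀ w < M, ¬ (Midpoint E M d (p.1, w) ∧ Midpoint E M d (w, p.2)) :=
        fun w hw hh => hmid ⟨w, hw, hh⟩
      have hlast := hreach (M - 1) (by omega) fun w' hw' => hno w' (by omega)
      have hend : ∀ c, c / 2 = M - 1 → c < B → ∀ y < B ^ d,
          Failed E M D u v d ((h * B + c) * B ^ d + y) →
          Failed E M D u v (d + 1) ((h * B + c) * B ^ d + y) := by
        intro c hc hcB y hy hf
        refine ⟨hf.1, fun i hi => ?_⟩
        rcases Nat.lt_succ_iff_lt_or_eq.1 hi with hi | rfl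
        · exact hf.2 i hi
        · rw [← hBdef, hdig c hcB y hy]; omega
      by_cases h1 : Midpoint E M d (p.1, M - 1)
      · obtain ⟨y, hy, hl, -, hf⟩ := ih (by omega) (h * B + (2 * (M - 1) + 1))
        rw [hsub _ (by omega), if_neg (by omega),
          show (2 * (M - 1) + 1) / 2 = M - 1 by omega] at hf
        refine ⟨(2 * (M - 1) + 1) * B ^ d + y, hlt _ (by omega) y hy, ?_,
          fun hn => absurd hn hmid, fun _ => ?_⟩
        · rw [← heq]
          exact (hlast.trans (hfirst _ (by omega) h1)).trans hl
        · rw [← heq]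
          exact hend _ (by omega) (by omega) y hy (hf fun h2 => hno _ (by omega) ⟨h1, h2⟩)
      · obtain ⟨y, hy, hl, -, hf⟩ := ih (by omega) (h * B + 2 * (M - 1))
        rw [hsub _ (by omega), if_pos (by omega), Nat.mul_div_cancel_left _ two_pos] at hf
        refine ⟨2 * (M - 1) * B ^ d + y, hlt _ (by omega) y hy, ?_,
          fun hn => absurd hn hmid, fun _ => ?_⟩
        · rw [← heq]
          exact hlast.trans hl
        · rw [← heq]
          exact hend _ (by omega) (by omega) y hy (hf h1)

/-- An increasing iteration that reaches the fixed point `y` is there after `y` steps. -/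
theorem iterate_eq_of_fixed {f : ℕ → ℕ} (hf : ∀ s, s ≤ f s) {y n : ℕ} (hn : f^[n] 0 = y)
    (hy : f y = y) {T : ℕ} (hT : y ≤ T) : f^[T] 0 = y := by
  have hfix : ∀ k, f^[k] y = y := fun k => iterate_fixed hy k
  have hge : ∀ k s, s ≤ f^[k] s := by
    intro k
    induction k with
    | zero => exact fun s => le_rfl
    | succ k ih => exact fun s => (hf s).trans (ih (f s))
  have hle : ∀ T, n ≤ T ∨ f^[T] 0 ≤ y := by
    intro T
    rcases le_total n T with h | h
    · exact Or.inl h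
    · right
      rw [← hn, ← Nat.sub_add_cancel h, iterate_add_apply]
      exact hge _ _
  have key : ∀ T, f^[T] 0 = y ∨ T ≤ f^[T] 0 := by
    intro T
    induction T with
    | zero => right; simp
    | succ T ih =>
      rw [iterate_succ_apply']
      rcases ih with ih | ih
      · left; rw [ih, hy]
      · rcases (hf (f^[T] 0)).eq_or_lt with h | h
        · left
          rw [← h]
          rcases le_total n T with hnT | hnT
          · rw [← Nat.sub_add_cancel hnT, iterate_add_apply, hn, hfix]
          · rw [← hn, ← Nat.sub_add_cancel hnT, iterate_add_apply]
            exact (iterate_fixed h.symm _).symm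
        · right; omega
  rcases hle T with h | h
  · rw [← Nat.sub_add_cancel h, iterate_add_apply, hn, hfix]
  · rcases key T with h' | h' <;> omega

theorem rec_eq_iterate (f : ℕ → ℕ) (n : ℕ) : (Nat.rec 0 (fun _ s => f s) n : ℕ) = f^[n] 0 := by
  induction n with
  | zero => rfl
  | succ n ih => rw [iterate_succ_apply', ← ih]

/-- The search decides reachability. -/
theorem search_iff (hu : u < M) : Search E M u v ↔ ReflTransGen (EdgeBelow E M) u v := by
  have hM : 0 < M.size → 0 < M := fun _ => by omega
  obtain ⟨y, hy, ⟨n, hn⟩, hs, hf⟩ := leads_of_midpoint (E := E) (u := u) (v := v) hM M.size le_rfl 0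
  simp only [zero_mul, zero_add, Nat.sub_self] at hn hs hf
  have hmid : Midpoint E M M.size (pairAt M M.size u v 0 0) ↔ ReflTransGen (EdgeBelow E M) u v :=
    midpoint_size_iff hu
  rw [Search, rec_eq_iterate (searchStep E M M.size u v)]
  by_cases h : Midpoint E M M.size (pairAt M M.size u v 0 0)
  · rw [iterate_eq_of_fixed (le_searchStep hM) hn (hs h).fixed hy.le]
    exact iff_of_true (hs h).1 (hmid.1 h)
  · rw [iterate_eq_of_fixed (le_searchStep hM) hn (hf h).fixed hy.le]
    exact iff_of_false (hf h).1 (fun h' => h (hmid.2 h'))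

end Search

namespace PSpaceFun

variable {α : Type} [Coded α]

theorem dig {B s i : α → ℕ} (hB : PSpaceFun B) (hs : PSpaceFun s) (hi : PSpaceFun i) :
    PSpaceFun fun x => dig (B x) (s x) (i x) :=
  .mod (.div_pow hs hB hi) hB

/-- Savitch's theorem: if the edges of a graph are decidable in polynomial space, then so is
reachability in this graph. -/
theorem search {M u v : α → ℕ} {E : α → ℕ → ℕ → Prop} (hM : PSpaceFun M)
    (hE : PSpaceFun fun p : (α × ℕ) × ℕ => E p.1.1 p.1.2 p.2) (hu : PSpaceFun u)
    (hv : PSpaceFun v) : PSpaceFun fun x => Search (E x) (M x) (u x) (v x) := by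
  classical
  have hdig : PSpaceFun fun p : (α × ℕ) × ℕ => _root_.dig (2 * M p.1.1) p.1.2 p.2 :=
    .dig (by fun_prop) (by fun_prop) (by fun_prop)
  have hpair : PSpaceFun fun p : α × ℕ =>
      pairAt (M p.1) (M p.1).size (u p.1) (v p.1) p.2 (M p.1).size := by
    have hd : PSpaceFun fun q : ((α × ℕ) × ℕ) × ℕ × ℕ =>
        _root_.dig (2 * M q.1.1.1) q.1.1.2 ((M q.1.1.1).size - 1 - q.1.2) :=
      .dig (by fun_prop) (by fun_prop) (by fun_prop)
    refine rec' (n := fun p : α × ℕ => (M p.1).size) (g := fun p => (u p.1, v p.1))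
      (B := fun p => u p.1 + v p.1 + 2 * (2 * M p.1)) (by fun_prop) (by fun_prop)
      (.ite (by fun_prop) (by fun_prop) (by fun_prop)) (bounded (by fun_prop)) fun p i _ => ?_
    rcases Nat.eq_zero_or_pos (M p.1) with h | h
    · obtain rfl : i = 0 := by simp_all
      simp
    · have hlt : ∀ i, _root_.dig (2 * M p.1) p.2 i / 2 ≤ 2 * M p.1 := fun i =>
        (Nat.div_le_self _ _).trans (Nat.mod_lt _ (by omega)).le
      suffices hs : ∀ i, (pairAt (M p.1) (M p.1).size (u p.1) (v p.1) p.2 i).1 ≤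
          u p.1 + 2 * M p.1 ∧ (pairAt (M p.1) (M p.1).size (u p.1) (v p.1) p.2 i).2 ≤
          v p.1 + 2 * M p.1 by
        have := hs i
        rw [sz_prod, sz_nat, sz_nat]
        exact (Nat.add_le_add this.1 this.2).trans (by omega)
      intro i
      induction i with
      | zero => exact ⟨Nat.le_add_right _ _, Nat.le_add_right _ _⟩
      | succ i ih =>
        have := hlt ((M p.1).size - 1 - i)
        rw [pairAt_succ]
        split_ifs
        · exact ⟨ih.1, by dsimp only; omega⟩
        · exact ⟨by dsimp only; omega, ih.2⟩
  have hleaf : PSpaceFun fun p : α × ℕ =>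
      LeafTrue (E p.1) (M p.1) (M p.1).size (u p.1) (v p.1) p.2 := by
    unfold LeafTrue EdgeBelow
    have := hE.comp (g := fun p : α × ℕ => ((p.1,
      (pairAt (M p.1) (M p.1).size (u p.1) (v p.1) p.2 (M p.1).size).1),
      (pairAt (M p.1) (M p.1).size (u p.1) (v p.1) p.2 (M p.1).size).2)) (by fun_prop)
    exact .or (by fun_prop) (.and (by fun_prop) (.and (by fun_prop) this))
  have hpow : ∀ {i : α × ℕ → ℕ}, PSpaceFun i → (∀ p, i p ≤ (M p.1).size) →
      PSpaceFun fun p : α × ℕ => (2 * M p.1) ^ i p := by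
    intro i hi hle
    refine .pow (by fun_prop) hi ((((show PSpaceFun fun p : α × ℕ => 2 * M p.1 by
      fun_prop).bounded.pow_size (show PSpaceFun fun p : α × ℕ => M p.1 by
        fun_prop).bounded).add (.const 1)).mono fun p => ?_)
    rcases Nat.eq_zero_or_pos (2 * M p.1) with h | h
    · rw [h]
      cases i p <;> simp
    · exact (Nat.pow_le_pow_right h (hle p)).trans (Nat.le_add_right _ _)
  have hstep : PSpaceFun fun p : α × ℕ =>
      searchStep (E p.1) (M p.1) (M p.1).size (u p.1) (v p.1) p.2 := by
    have hl1 : PSpaceFun fun p : α × ℕ => leastBelow (M p.1).size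
        (fun i => _root_.dig (2 * M p.1) p.2 i % 2 = 0) := .least (by fun_prop) (by fun_prop)
    have hl2 : PSpaceFun fun p : α × ℕ => leastBelow (M p.1).size
        (fun i => _root_.dig (2 * M p.1) p.2 i / 2 + 1 < M p.1) :=
      .least (by fun_prop) (by fun_prop)
    have hp1 := hpow hl1 fun p => (leastBelow_spec _ _).1
    have hp2 := hpow hl2 fun p => (leastBelow_spec _ _).1
    have hd2 := hdig.comp (g := fun p : α × ℕ => (p, leastBelow (M p.1).size
        (fun i => _root_.dig (2 * M p.1) p.2 i / 2 + 1 < M p.1))) (by fun_prop)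
    unfold searchStep
    refine .ite hleaf (.ite (by fun_prop) ?_ (by fun_prop)) (.ite (by fun_prop) ?_ (by fun_prop))
    · fun_prop
    · fun_prop
  have hT : PSpaceFun fun x => (2 * M x) ^ (M x).size :=
    .pow (by fun_prop) (by fun_prop) (PolyBounded.pow_size (bounded (by fun_prop)) hM.bounded)
  have hiter : PSpaceFun fun x => (Nat.rec 0 (fun _ s => searchStep (E x) (M x) (M x).size (u x)
      (v x) s) ((2 * M x) ^ (M x).size) : ℕ) := by
    refine rec' (g := fun _ => 0) (h := fun x _ s => searchStep (E x) (M x) (M x).size (u x)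
      (v x) s) hT (by fun_prop) (hstep.comp (g := fun p : (α × ℕ) × ℕ => (p.1.1, p.2))
        (by fun_prop)) hT.bounded fun x i _ => ?_
    rw [sz_nat]
    have hM0 : 0 < (M x).size → 0 < M x := Nat.size_pos.1
    have : (Nat.rec 0 (fun _ s => searchStep (E x) (M x) (M x).size (u x) (v x) s) i : ℕ) <
        (2 * M x) ^ (M x).size := by
      induction i with
      | zero =>
        rcases Nat.eq_zero_or_pos (M x) with h | h
        · simp [h]
        · exact pow_pos (by omega) _
      | succ i ih => exact searchStep_lt hM0 (ih (by omega))
    exact this.le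
  exact hleaf.comp (g := fun x => (x, _)) (PSpaceFun.id.prodMk hiter)

end PSpaceFun

/-! ### Words in polynomial space -/

theorem wordVal_tail (l : List (Option Bool)) : wordVal l.tail = (wordVal l - 1) / 3 := by
  cases l with
  | nil => rfl
  | cons a l => rcases a with _ | _ | _ <;> simp only [wordVal, digitVal, List.tail_cons] <;> omega

theorem wordVal_tail_le (l : List (Option Bool)) : wordVal l.tail ≤ wordVal l := by
  rw [wordVal_tail]; omega

theorem wordVal_drop_le (l : List (Option Bool)) (i : ℕ) : wordVal (l.drop i) ≤ wordVal l := by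
  induction i with
  | zero => rfl
  | succ i ih => rw [← List.tail_drop]; exact (wordVal_tail_le _).trans ih

theorem length_le_wordVal (l : List (Option Bool)) : l.length ≤ wordVal l := by
  have h1 := two_pow_length_le l
  have h2 := l.length.lt_two_pow_self
  omega

/-- The first letter of a word is the lowest digit of its number. -/
theorem head?_eq_iff (l : List (Option Bool)) (a : Option Bool) :
    l.head? = some a ↔ wordVal l ≠ 0 ∧ (wordVal l - 1) % 3 + 1 = digitVal a := by
  cases l with
  | nil => simp [wordVal]
  | cons b l =>
    rcases a with _ | _ | _ <;> rcases b with _ | _ | _ <;> simp [wordVal, digitVal]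

@[simp] theorem sz_word (w : List (Option Bool)) : sz w = wordVal w := by simp [sz, enc]

namespace PSpaceFun

variable {α : Type} [Coded α]

@[fun_prop]
theorem wordVal {f : α → List (Option Bool)} (hf : PSpaceFun f) :
    PSpaceFun fun x => wordVal (f x) :=
  hf.of_enc_eq fun _ => rfl

theorem eq_nil {f : α → List (Option Bool)} (hf : PSpaceFun f) : PSpaceFun fun x => f x = [] := by
  simpa only [wordVal_eq_zero] using hf.wordVal.eq_zero

theorem head_eq {f : α → List (Option Bool)} (hf : PSpaceFun f) (a : Option Bool) :
    PSpaceFun fun x => (f x).head? = some a := by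
  simp only [head?_eq_iff]
  fun_prop

theorem tail {f : α → List (Option Bool)} (hf : PSpaceFun f) : PSpaceFun fun x => (f x).tail := by
  refine PSpaceFun.of_enc_eq (f := fun x => (_root_.wordVal (f x) - 1) / 3) (by fun_prop)
    fun x => ?_
  simp only [enc, wordVal_tail]

@[fun_prop]
theorem drop {f : α → List (Option Bool)} {n : α → ℕ} (hf : PSpaceFun f) (hn : PSpaceFun n) :
    PSpaceFun fun x => (f x).drop (n x) := by
  have e : ∀ (x : α) (i : ℕ),
      (Nat.rec (f x) (fun _ l => l.tail) i : List (Option Bool)) = (f x).drop i := by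
    intro x i
    induction i with
    | zero => rfl
    | succ i ih => simp [ih]
  refine (rec' (h := fun _ _ l => l.tail) hn hf (tail (by fun_prop)) hf.wordVal.bounded
    fun x i _ => ?_).of_enc_eq fun x => by rw [e]
  rw [e, sz_word]
  exact wordVal_drop_le _ _

@[fun_prop]
theorem length {f : α → List (Option Bool)} (hf : PSpaceFun f) :
    PSpaceFun fun x => (f x).length := by
  refine (least (P := fun x i => (f x).drop i = []) hf.wordVal
    (eq_nil (by fun_prop))).of_enc_eq fun x => congrArg enc ?_
  refine (leastBelow_eq (length_le_wordVal _) (fun i hi => ?_) fun _ => ?_).symm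
  · rw [List.drop_eq_nil_iff]; omega
  · rw [List.drop_eq_nil_iff]

end PSpaceFun

/-! ### Decoding lists of numbers -/

/-- The list of numbers that is encoded by a word. -/
def decodeNats : List (Option Bool) → List ℕ
  | [] => []
  | none :: w => 0 :: decodeNats w
  | some b :: w =>
    match decodeNats w with
    | [] => []
    | n :: l => Nat.bit b n :: l

/-- The words that encode lists of numbers: each digit is followed by a digit or a separator, and
the digit `0` is not followed by a separator. -/
def WellFormed (w : List (Option Bool)) : Prop :=
  ∀ i < w.length, (w.drop i).head? ≠ some none → w.drop (i + 1) ≠ [] ∧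
    ((w.drop i).head? = some (some false) → (w.drop (i + 1)).head? ≠ some none)

theorem wellFormed_nil : WellFormed [] := by simp [WellFormed]

theorem wellFormed_cons {a : Option Bool} {w : List (Option Bool)} :
    WellFormed (a :: w) ↔ (a ≠ none → w ≠ [] ∧ (a = some false → w.head? ≠ some none)) ∧
      WellFormed w := by
  constructor
  · intro h
    refine ⟨by simpa using h 0 (by simp), fun i hi => ?_⟩
    simpa using h (i + 1) (by simpa using hi)
  · rintro ⟨h1, h2⟩ i hi
    rcases i with _ | i
    · simpa using h1
    · simpa using h2 i (by simpa using hi)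

theorem encodeNats_cons (n : ℕ) (l : List ℕ) :
    encodeNats (n :: l) = n.bits.map some ++ none :: encodeNats l := by
  simp [encodeNats]

theorem decodeNats_bits (n : ℕ) (w : List (Option Bool)) :
    decodeNats (n.bits.map some ++ none :: w) = n :: decodeNats w := by
  induction n using Nat.binaryRec' with
  | zero => simp [decodeNats]
  | bit b n hn ih => simp [Nat.bits_append_bit _ _ hn, decodeNats, ih]

theorem decodeNats_encodeNats (l : List ℕ) : decodeNats (encodeNats l) = l := by
  induction l with
  | nil => rfl
  | cons n l ih => rw [encodeNats_cons, decodeNats_bits, ih]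

theorem wellFormed_encodeNats (l : List ℕ) : WellFormed (encodeNats l) := by
  induction l with
  | nil => exact wellFormed_nil
  | cons n l ih =>
    rw [encodeNats_cons]
    induction n using Nat.binaryRec' with
    | zero => simpa [wellFormed_cons] using ih
    | bit b n hn ih' =>
      rw [Nat.bits_append_bit _ _ hn]
      simp only [List.map_cons, List.cons_append, wellFormed_cons]
      refine ⟨fun _ => ⟨by simp, fun hb => ?_⟩, ih'⟩
      have hn0 : n ≠ 0 := by rintro rfl; simp_all
      cases hbits : n.bits with
      | nil =>
        have := decodeNats_bits n []
        rw [hbits] at this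
        simp [decodeNats] at this
        exact absurd this.symm hn0
      | cons => simp

theorem decodeNats_ne_nil {w : List (Option Bool)} (h : WellFormed w) (hw : w ≠ []) :
    decodeNats w ≠ [] := by
  induction w with
  | nil => exact absurd rfl hw
  | cons a w ih =>
    rw [wellFormed_cons] at h
    rcases a with _ | b
    · simp [decodeNats]
    · have := ih h.2 (h.1 (by simp)).1
      cases hd : decodeNats w with
      | nil => exact absurd hd this
      | cons n l => simp [decodeNats, hd]

theorem encodeNats_decodeNats {w : List (Option Bool)} (h : WellFormed w) :
    encodeNats (decodeNats w) = w := by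
  induction w with
  | nil => rfl
  | cons a w ih =>
    rw [wellFormed_cons] at h
    have ih := ih h.2
    rcases a with _ | b
    · simp [decodeNats, encodeNats_cons, ih]
    · obtain ⟨h1, h2⟩ := h.1 (by simp)
      have := decodeNats_ne_nil h.2 h1
      cases hd : decodeNats w with
      | nil => exact absurd hd this
      | cons n l =>
        rw [hd, encodeNats_cons] at ih
        have hn : n = 0 → b = true := by
          rintro rfl
          by_contra hb
          refine h2 (by simpa using hb) ?_
          rw [← ih]
          simp
        simp [decodeNats, hd, encodeNats_cons, Nat.bits_append_bit _ _ hn, ih]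

/-- The number of index `j` in the list that is encoded by a word. -/
def numAt : List (Option Bool) → ℕ → ℕ
  | [], _ => 0
  | none :: _, 0 => 0
  | none :: w, j + 1 => numAt w j
  | some b :: w, 0 => b.toNat + 2 * numAt w 0
  | some _ :: w, j + 1 => numAt w (j + 1)

theorem numAt_eq {w : List (Option Bool)} (h : WellFormed w) (j : ℕ) :
    numAt w j = (decodeNats w).getD j 0 := by
  induction w generalizing j with
  | nil => simp [numAt, decodeNats]
  | cons a w ih =>
    rw [wellFormed_cons] at h
    have ih := ih h.2
    rcases a with _ | b
    · cases j <;> simp [numAt, decodeNats, ih]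
    · have := decodeNats_ne_nil h.2 (h.1 (by simp)).1
      cases hd : decodeNats w with
      | nil => exact absurd hd this
      | cons n l => cases j <;> simp [numAt, decodeNats, ih, hd, Nat.bit_val, add_comm]

theorem numAt_le (w : List (Option Bool)) (j : ℕ) : numAt w j ≤ wordVal w := by
  induction w generalizing j with
  | nil => simp [numAt]
  | cons a w ih =>
    have h0 := ih 0
    rcases a with _ | b
    · rcases j with _ | j
      · simp [numAt]
      · have := ih j
        simp only [numAt, wordVal]; omega
    · rcases j with _ | j
      · cases b <;> simp only [numAt, wordVal, digitVal, Bool.toNat] <;> simp <;> omega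
      · have := ih (j + 1)
        simp only [numAt, wordVal]; omega

theorem length_decodeNats {w : List (Option Bool)} (h : WellFormed w) :
    (decodeNats w).length = w.count none := by
  induction w with
  | nil => rfl
  | cons a w ih =>
    rw [wellFormed_cons] at h
    have ih := ih h.2
    rcases a with _ | b
    · simp [decodeNats, ih]
    · have := decodeNats_ne_nil h.2 (h.1 (by simp)).1
      cases hd : decodeNats w with
      | nil => exact absurd hd this
      | cons n l => simp [decodeNats, hd, ← ih]

theorem count_eq_sum {α : Type*} [BEq α] [LawfulBEq α] [DecidableEq α] (a : α) (w : List α) :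
    w.count a = ∑ i ∈ Finset.range w.length, if w[i]? = some a then 1 else 0 := by
  induction w with
  | nil => rfl
  | cons b w ih =>
    rw [List.length_cons, Finset.sum_range_succ', List.count_cons]
    simp [← ih]

/-- One step of the computation of `numAt`: the state consists of the number of separators that are
still to be passed, the weight of the next digit, and the sum of the digits that were read. -/
def numStep (w : List (Option Bool)) (i : ℕ) (y : (ℕ × ℕ) × ℕ) : (ℕ × ℕ) × ℕ :=
  if (w.drop i).head? = some none then
    if y.1.1 = 0 then ((0, 0), y.2) else ((y.1.1 - 1, y.1.2), y.2)
  else if y.1.1 = 0 then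
    ((0, 2 * y.1.2), if (w.drop i).head? = some (some true) then y.2 + y.1.2 else y.2)
  else y

/-- The invariant of the computation of `numAt` after `i` letters. -/
theorem numStep_spec (w : List (Option Bool)) (j i : ℕ) (hi : i ≤ w.length) :
    let y : (ℕ × ℕ) × ℕ := Nat.rec ((j, 1), 0) (numStep w) i
    y.2 + y.1.2 * numAt (w.drop i) y.1.1 = numAt w j ∧ y.1.1 ≤ j ∧ y.1.2 ≤ 2 ^ i := by
  induction i with
  | zero => simp
  | succ i ih =>
    obtain ⟨h1, h2, h3⟩ := ih (by omega)
    obtain ⟨a, ha⟩ : ∃ a, w.drop i = a :: w.drop (i + 1) :=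
      ⟨w[i], List.drop_eq_getElem_cons (by omega)⟩
    rw [ha] at h1
    intro y
    have hy : y = numStep w i (Nat.rec ((j, 1), 0) (numStep w) i) := rfl
    generalize (Nat.rec ((j, 1), 0) (numStep w) i : (ℕ × ℕ) × ℕ) = z at *
    obtain ⟨⟨j', p⟩, s⟩ := z
    rw [hy, numStep, ha]
    rw [pow_succ]
    rcases a with _ | b
    · rcases j' with _ | j'
      · simp_all [numAt]
      · simp_all [numAt]; omega
    · rcases j' with _ | j'
      · cases b <;> simp_all [numAt] <;> constructor <;> first | omega | linarith
      · simp_all [numAt]; omega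

namespace PSpaceFun

variable {α : Type} [Coded α]

@[fun_prop]
theorem numAt {f : α → List (Option Bool)} {n : α → ℕ} (hf : PSpaceFun f) (hn : PSpaceFun n) :
    PSpaceFun fun x => numAt (f x) (n x) := by
  have key : PSpaceFun fun x =>
      (Nat.rec ((n x, 1), 0) (numStep (f x)) (f x).length : (ℕ × ℕ) × ℕ) := by
    have h1 : PSpaceFun fun p : (α × ℕ) × (ℕ × ℕ) × ℕ =>
      ((f p.1.1).drop p.1.2).head? = some none := head_eq (by fun_prop) _
    have h2 : PSpaceFun fun p : (α × ℕ) × (ℕ × ℕ) × ℕ =>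
      ((f p.1.1).drop p.1.2).head? = some (some true) := head_eq (by fun_prop) _
    refine rec' (g := fun x => ((n x, 1), 0)) (h := fun x i y => numStep (f x) i y)
      (B := fun x => n x + (_root_.wordVal (f x) + 1) + _root_.wordVal (f x)) hf.length
      (by fun_prop) ?_ (bounded (by fun_prop)) fun x i hi => ?_
    · unfold numStep
      fun_prop
    · obtain ⟨g1, g2, g3⟩ := numStep_spec (f x) (n x) i hi
      have g4 := numAt_le (f x) (n x)
      have g5 := (Nat.pow_le_pow_right two_pos hi).trans (two_pow_length_le (f x))
      simp only [sz_prod, sz_nat]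
      change (_ : ℕ) ≤ _
      have g6 := Nat.le_of_add_right_le g1.le
      have := Nat.add_le_add (Nat.add_le_add g2 (g3.trans g5)) (g6.trans g4)
      exact this
  refine (snd.comp key).of_enc_eq fun x => congrArg enc ?_
  obtain ⟨g1, -, -⟩ := numStep_spec (f x) (n x) _ le_rfl
  rw [List.drop_length] at g1
  simpa [_root_.numAt] using g1.symm

@[fun_prop]
theorem wellFormed : PSpaceFun WellFormed := by
  have h1 : ∀ a, PSpaceFun fun p : List (Option Bool) × ℕ => (p.1.drop p.2).head? = some a :=
    fun a => head_eq (by fun_prop) a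
  have h2 : ∀ a, PSpaceFun fun p : List (Option Bool) × ℕ =>
      (p.1.drop (p.2 + 1)).head? = some a := fun a => head_eq (by fun_prop) a
  have h3 : PSpaceFun fun p : List (Option Bool) × ℕ => p.1.drop (p.2 + 1) = [] :=
    eq_nil (by fun_prop)
  have e1 := h1 none
  have e2 := h1 (some false)
  have e3 := h2 none
  exact .ball (by fun_prop) (.imp (.not e1) (.and (.not h3) (.imp e2 (.not e3))))

theorem count_none : PSpaceFun fun w : List (Option Bool) => w.count none := by
  have h : ∀ w : List (Option Bool), w.count none =
      ∑ i ∈ Finset.range w.length, if (w.drop i).head? = some none then 1 else 0 := fun w => by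
    rw [count_eq_sum]
    simp only [List.head?_drop]
  simp only [h]
  exact .sum (by fun_prop) (.ite (head_eq (by fun_prop) _) (by fun_prop) (by fun_prop))

end PSpaceFun

/-! ### Round simulation as reachability -/

section RoundEquiv

variable {α : Type*} {k : ℕ}

theorem roundAt_append_of_lt {y u : List α} {R r : ℕ} (hy : y.length = k * R) (hr : r < R) :
    roundAt k r (y ++ u) = roundAt k r y := by
  have h1 : r * k + k ≤ y.length := by
    rw [hy, mul_comm k]
    calc r * k + k = (r + 1) * k := by ring
      _ ≤ R * k := Nat.mul_le_mul_right _ hr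
  rw [roundAt, roundAt, List.drop_append_of_le_length (by omega),
    List.take_append_of_le_length (by rw [List.length_drop]; omega)]

theorem roundAt_append_eq {y u : List α} {R : ℕ} (hy : y.length = k * R) (hu : u.length = k) :
    roundAt k R (y ++ u) = u := by
  rw [roundAt, mul_comm, ← hy, List.drop_left, ← hu, List.take_length]

variable [DecidableEq α]

theorem roundEquiv_append (hk : 0 < k) {y u y' u' : List α} {R : ℕ} (hy : y.length = k * R)
    (hu : u.length = k) (hy' : y'.length = k * R) (hu' : u'.length = k) :
    RoundEquiv k (y ++ u) (y' ++ u') ↔ RoundEquiv k y y' ∧ parikh u = parikh u' := by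
  constructor
  · rintro ⟨R', h1, -, h3⟩
    obtain rfl : R' = R + 1 := by
      rw [List.length_append, hy, hu, ← Nat.mul_succ] at h1
      exact (Nat.eq_of_mul_eq_mul_left hk h1).symm
    refine ⟨⟨R, hy, hy', fun r hr => ?_⟩, ?_⟩
    · have := h3 r (by omega)
      rwa [roundAt_append_of_lt hy hr, roundAt_append_of_lt hy' hr] at this
    · have := h3 R (by omega)
      rwa [roundAt_append_eq hy hu, roundAt_append_eq hy' hu'] at this
  · rintro ⟨⟨R', h1, -, h3⟩, h4⟩
    obtain rfl : R = R' := Nat.eq_of_mul_eq_mul_left hk (hy.symm.trans h1)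
    refine ⟨R + 1, by rw [List.length_append, hy, hu]; ring,
      by rw [List.length_append, hy', hu']; ring, fun r hr => ?_⟩
    rcases Nat.lt_succ_iff_lt_or_eq.1 hr with hr | rfl
    · rw [roundAt_append_of_lt hy hr, roundAt_append_of_lt hy' hr]
      exact h3 r hr
    · rw [roundAt_append_eq hy hu, roundAt_append_eq hy' hu', h4]

theorem RoundEquiv.length_eq {x y : List α} (h : RoundEquiv k x y) : y.length = x.length := by
  obtain ⟨R, h1, h2, -⟩ := h
  rw [h1, h2]

end RoundEquiv

namespace Transducer

variable {I O Q : Type*} (T : Transducer I O Q)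

/-- The state that is reached from `q` on a word. -/
def run (q : Q) (w : List I) : Q := w.foldl T.step q

theorem outputFrom_append (q : Q) (u v : List I) :
    T.outputFrom q (u ++ v) = T.outputFrom q u ++ T.outputFrom (T.run q u) v := by
  induction u generalizing q with
  | nil => rfl
  | cons a u ih => simp [outputFrom, run, ih]

theorem length_outputFrom (q : Q) (u : List I) : (T.outputFrom q u).length = u.length := by
  induction u generalizing q with
  | nil => rfl
  | cons a u ih => simp [outputFrom, ih]

end Transducer

section Graph

variable {I O Q₁ Q₂ Q₃ : Type*} [DecidableEq I] [DecidableEq O]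

/-- In a round in which the first transducer reads `u` from the state `p`, the second one can go
from `q` to `q'`. -/
def CanAnswer (k : ℕ) (T₁ : Transducer I O Q₁) (T₂ : Transducer I O Q₂) (p : Q₁) (u : List I)
    (q q' : Q₂) : Prop :=
  ∃ u' : List I, u'.length = k ∧ parikh u = parikh u' ∧
    parikh (T₁.outputFrom p u) = parikh (T₂.outputFrom q u') ∧ T₂.run q u' = q'

/-- One round of the game on triples of a state of the first transducer, a state of the automaton
and the set of those states of the second transducer that are reached by suitable answers. -/
def RoundStep (k : ℕ) (T₁ : Transducer I O Q₁) (T₂ : Transducer I O Q₂) (A : NFA I Q₃)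
    (a b : (Q₁ × Q₃) × Set Q₂) : Prop :=
  ∃ u : List I, u.length = k ∧ b.1.1 = T₁.run a.1.1 u ∧ b.1.2 ∈ A.evalFrom {a.1.2} u ∧
    b.2 = {q' | ∃ q ∈ a.2, CanAnswer k T₁ T₂ a.1.1 u q q'}

/-- The states that the second transducer can reach by answering the word `x`. -/
def answers (k : ℕ) (T₁ : Transducer I O Q₁) (T₂ : Transducer I O Q₂) (x : List I) : Set Q₂ :=
  {q | ∃ x', RoundEquiv k x x' ∧ RoundEquiv k (T₁.output x) (T₂.output x') ∧
    T₂.run T₂.start x' = q}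

variable {k : ℕ} {T₁ : Transducer I O Q₁} {T₂ : Transducer I O Q₂} {A : NFA I Q₃}

theorem answers_nil : answers k T₁ T₂ [] = {T₂.start} := by
  ext q
  constructor
  · rintro ⟨x', h1, -, h3⟩
    obtain rfl : x' = [] := List.length_eq_zero_iff.1 h1.length_eq
    exact h3.symm
  · rintro rfl
    exact ⟨[], ⟨0, by simp⟩, ⟨0, by simp [Transducer.output, Transducer.outputFrom]⟩, rfl⟩

/-- The set of answers can be computed round by round. -/
theorem answers_append (hk : 0 < k) {x u : List I} {R : ℕ} (hx : x.length = k * R)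
    (hu : u.length = k) : answers k T₁ T₂ (x ++ u) =
      {q' | ∃ q ∈ answers k T₁ T₂ x, CanAnswer k T₁ T₂ (T₁.run T₁.start x) u q q'} := by
  ext q'
  constructor
  · rintro ⟨z, h1, h2, h3⟩
    have hz : z.length = k * R + k := by rw [h1.length_eq, List.length_append, hx, hu]
    obtain ⟨x', u', rfl, hx', hu'⟩ : ∃ x' u', z = x' ++ u' ∧ x'.length = k * R ∧ u'.length = k :=
      ⟨z.take (k * R), z.drop (k * R), (List.take_append_drop _ _).symm,
        by rw [List.length_take]; omega, by rw [List.length_drop]; omega⟩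
    rw [roundEquiv_append hk hx hu hx' hu'] at h1
    rw [Transducer.output, Transducer.output, Transducer.outputFrom_append,
      Transducer.outputFrom_append, roundEquiv_append hk
        (by rw [Transducer.length_outputFrom, hx]) (by rw [Transducer.length_outputFrom, hu])
        (by rw [Transducer.length_outputFrom, hx']) (by rw [Transducer.length_outputFrom, hu'])]
      at h2
    exact ⟨_, ⟨x', h1.1, h2.1, rfl⟩, u', hu', h1.2, h2.2, by rw [← h3]; simp [Transducer.run]⟩
  · rintro ⟨q, ⟨x', h1, h2, rfl⟩, u', hu', h3, h4, rfl⟩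
    have hx' : x'.length = k * R := h1.length_eq.trans hx
    refine ⟨x' ++ u', (roundEquiv_append hk hx hu hx' hu').2 ⟨h1, h3⟩, ?_,
      by simp [Transducer.run]⟩
    rw [Transducer.output, Transducer.output, Transducer.outputFrom_append,
      Transducer.outputFrom_append, roundEquiv_append hk
        (by rw [Transducer.length_outputFrom, hx]) (by rw [Transducer.length_outputFrom, hu])
        (by rw [Transducer.length_outputFrom, hx']) (by rw [Transducer.length_outputFrom, hu'])]
    exact ⟨h2, h4⟩

/-- The reachable triples belong to the words that consist of rounds. -/
theorem reach_roundStep_iff (hk : 0 < k) {s : Q₃} {v : (Q₁ × Q₃) × Set Q₂} :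
    ReflTransGen (RoundStep k T₁ T₂ A) ((T₁.start, s), {T₂.start}) v ↔
      ∃ (R : ℕ) (x : List I), x.length = k * R ∧ v.1.1 = T₁.run T₁.start x ∧
        v.1.2 ∈ A.evalFrom {s} x ∧ v.2 = answers k T₁ T₂ x := by
  constructor
  · intro h
    induction h with
    | refl => exact ⟨0, [], rfl, rfl, rfl, answers_nil.symm⟩
    | tail _ h ih =>
      obtain ⟨R, x, h1, h2, h3, h4⟩ := ih
      obtain ⟨u, g1, g2, g3, g4⟩ := h
      refine ⟨R + 1, x ++ u, by rw [List.length_append, h1, g1]; ring, ?_, ?_, ?_⟩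
      · rw [g2, h2]; simp [Transducer.run]
      · rw [NFA.evalFrom_append, NFA.mem_evalFrom_iff_exists]
        exact ⟨_, h3, g3⟩
      · rw [g4, answers_append hk h1 g1, h4, h2]
  · rintro ⟨R, x, h1, h2, h3, h4⟩
    induction R generalizing x v with
    | zero =>
      obtain rfl : x = [] := List.length_eq_zero_iff.1 h1
      obtain ⟨⟨p, a⟩, S⟩ := v
      obtain rfl : p = T₁.start := h2
      obtain rfl : a = s := h3
      obtain rfl : S = _ := h4
      rw [answers_nil]
    | succ R ih =>
      obtain ⟨y, u, rfl, hy, hu⟩ : ∃ y u, x = y ++ u ∧ y.length = k * R ∧ u.length = k :=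
        ⟨x.take (k * R), x.drop (k * R), (List.take_append_drop _ _).symm,
          by rw [List.length_take, h1, Nat.mul_succ]; omega,
          by rw [List.length_drop, h1, Nat.mul_succ]; omega⟩
      rw [NFA.evalFrom_append, NFA.mem_evalFrom_iff_exists] at h3
      obtain ⟨a, ha, h3⟩ := h3
      refine (ih (v := ((T₁.run T₁.start y, a), answers k T₁ T₂ y)) y hy rfl ha rfl).tail
        ⟨u, hu, ?_, h3, ?_⟩
      · rw [h2]; simp [Transducer.run]
      · rw [h4, answers_append hk hy hu]

/-- The second transducer simulates the first one unless a triple is reachable whose state of the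
automaton is accepting and whose set of answers is empty. -/
theorem roundSimulated_iff (hk : 0 < k) {s : Q₃} (hA : A.start = {s}) :
    RoundSimulated k A.accepts T₁ T₂ ↔ ¬ ∃ v : (Q₁ × Q₃) × Set Q₂,
      ReflTransGen (RoundStep k T₁ T₂ A) ((T₁.start, s), {T₂.start}) v ∧
        v.1.2 ∈ A.accept ∧ v.2 = ∅ := by
  constructor
  · rintro h ⟨v, h1, h2, h3⟩
    obtain ⟨R, x, g1, g2, g3, g4⟩ := (reach_roundStep_iff hk).1 h1
    obtain ⟨x', -, e1, e2⟩ := h x (NFA.mem_accepts.2 ⟨_, h2, by rwa [hA]⟩) ⟨R, g1⟩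
    have : T₂.run T₂.start x' ∈ v.2 := g4 ▸ ⟨x', e1, e2, rfl⟩
    rw [h3] at this
    exact this
  · rintro h x hx ⟨R, hR⟩
    obtain ⟨a, ha, hax⟩ := NFA.mem_accepts.1 hx
    rw [hA] at hax
    by_contra hno
    refine h ⟨((T₁.run T₁.start x, a), answers k T₁ T₂ x),
      (reach_roundStep_iff hk).2 ⟨R, x, hR, rfl, hax, rfl⟩, ha, ?_⟩
    refine Set.eq_empty_iff_forall_notMem.2 ?_
    rintro q ⟨x', h1, h2, -⟩
    exact hno ⟨x', ⟨R, h1.length_eq.trans hR⟩, h1, h2⟩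

end Graph

/-! ### The game on numbers -/

/-- Every sequence of `k` digits is the sequence of the digits of a number. -/
theorem exists_code (B : ℕ) (k : ℕ) : ∀ f : ℕ → ℕ, (∀ i < k, f i < B) →
    ∃ c < B ^ k, ∀ i < k, dig B c i = f i := by
  induction k with
  | zero => exact fun f _ => ⟨0, by simp, by simp⟩
  | succ k ih =>
    intro f hf
    obtain ⟨c, hc, h⟩ := ih (fun i => f (i + 1)) fun i hi => hf _ (by omega)
    have h0 := hf 0 (by omega)
    refine ⟨f 0 + B * c, ?_, fun i hi => ?_⟩
    · rw [pow_succ]; nlinarith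
    · rcases i with _ | i
      · simp [dig, Nat.mod_eq_of_lt h0]
      · rw [← h i (by omega), dig, dig, pow_succ', ← Nat.div_div_eq_div_mul,
          Nat.add_mul_div_left _ _ (by omega), Nat.div_eq_of_lt h0, zero_add]

/-- An instance of fixed round simulation in which letters and states are arbitrary numbers. The
indices `1`, `2` and `3` refer to the transducers and to the automaton; `s` stands for initial
states, `δ` for transitions and `l` for labels. -/
structure RawInstance where
  nI : ℕ
  nO : ℕ
  n₁ : ℕ
  n₂ : ℕ
  m : ℕ
  k : ℕ
  s₁ : ℕ
  δ₁ : ℕ → ℕ → ℕ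
  l₁ : ℕ → ℕ
  s₂ : ℕ
  δ₂ : ℕ → ℕ → ℕ
  l₂ : ℕ → ℕ
  s₃ : ℕ
  δ₃ : ℕ → ℕ → ℕ → Prop
  acc : ℕ → Prop

/-- The components of the instance `X` are given by `R`. -/
structure RawInstance.Describes (R : RawInstance) (X : Instance) : Prop where
  nI : R.nI = X.nI
  nO : R.nO = X.nO
  n₁ : R.n₁ = X.n₁
  n₂ : R.n₂ = X.n₂
  m : R.m = X.m
  k : R.k = X.k
  s₁ : R.s₁ = X.T₁.start
  δ₁ : ∀ (q : Fin X.n₁) (i : Fin X.nI), R.δ₁ q i = X.T₁.step q i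
  l₁ : ∀ q : Fin X.n₁, R.l₁ q = X.T₁.label q
  s₂ : R.s₂ = X.T₂.start
  δ₂ : ∀ (q : Fin X.n₂) (i : Fin X.nI), R.δ₂ q i = X.T₂.step q i
  l₂ : ∀ q : Fin X.n₂, R.l₂ q = X.T₂.label q
  s₃ : R.s₃ = X.aut.start
  δ₃ : ∀ (q : Fin X.m) (i : Fin X.nI) (q' : Fin X.m), R.δ₃ q i q' ↔ q' ∈ X.aut.step q i
  acc : ∀ q : Fin X.m, R.acc q ↔ q ∈ X.aut.accept

/-- The state after `i` letters of the word with code `c` in base `n`. -/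
def rawRun (δ : ℕ → ℕ → ℕ) (n c q i : ℕ) : ℕ := Nat.rec q (fun i p => δ p (dig n c i)) i

open Classical in
/-- The number of indices below `k` with the property `P`. -/
noncomputable def countBelow (k : ℕ) (P : ℕ → Prop) : ℕ :=
  ∑ i ∈ Finset.range k, if P i then 1 else 0

namespace RawInstance

variable (R : RawInstance)

/-- The counterpart of `CanAnswer` for the word with code `c`. -/
def Answer (c p q q' : ℕ) : Prop :=
  ∃ c' < R.nI ^ R.k,
    (∀ a < R.nI, countBelow R.k (fun i => dig R.nI c i = a) =
      countBelow R.k (fun i => dig R.nI c' i = a)) ∧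
    (∀ o < R.nO, countBelow R.k (fun i => R.l₁ (rawRun R.δ₁ R.nI c p (i + 1)) = o) =
      countBelow R.k (fun i => R.l₂ (rawRun R.δ₂ R.nI c' q (i + 1)) = o)) ∧
    rawRun R.δ₂ R.nI c' q R.k = q'

/-- The automaton can go from `a` to `a'` on the word with code `c`; the run is guessed. -/
def AutRun (c a a' : ℕ) : Prop :=
  ∃ r < R.m ^ (R.k + 1), dig R.m r 0 = a ∧ dig R.m r R.k = a' ∧
    ∀ i < R.k, R.δ₃ (dig R.m r i) (dig R.nI c i) (dig R.m r (i + 1))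

/-- The number of codes of triples. The code of the triple `(p, a, S)` is `p + n₁ * (a + m * S)`,
where the set `S` is given by the binary digits of a number. -/
def size : ℕ := R.n₁ * R.m * 2 ^ R.n₂

/-- The state of the first transducer in a triple. -/
def fstState (u : ℕ) : ℕ := u % R.n₁

/-- The state of the automaton in a triple. -/
def autState (u : ℕ) : ℕ := u / R.n₁ % R.m

/-- The membership in the set of states of the second transducer in a triple. -/
def HasState (u q : ℕ) : Prop := dig 2 (u / R.n₁ / R.m) q = 1

/-- The counterpart of `RoundStep` for codes. -/
def Step (u v : ℕ) : Prop :=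
  ∃ c < R.nI ^ R.k, R.fstState v = rawRun R.δ₁ R.nI c (R.fstState u) R.k ∧
    R.AutRun c (R.autState u) (R.autState v) ∧
    ∀ q' < R.n₂, R.HasState v q' ↔ ∃ q < R.n₂, R.HasState u q ∧ R.Answer c (R.fstState u) q q'

/-- The code of the initial triple. -/
def Initial (u : ℕ) : Prop :=
  R.fstState u = R.s₁ ∧ R.autState u = R.s₃ ∧ ∀ q < R.n₂, R.HasState u q ↔ q = R.s₂

/-- The codes of triples that refute the simulation. -/
def Refutes (v : ℕ) : Prop := R.acc (R.autState v) ∧ ∀ q < R.n₂, ¬ R.HasState v q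

/-- Round simulation in terms of codes. -/
def Simulated : Prop :=
  ¬ ∃ u < R.size, R.Initial u ∧ ∃ v < R.size, Search R.Step R.size u v ∧ R.Refutes v

end RawInstance

/-- The number `c` is the code of the word `u` in base `n`. -/
def CodesWord {n : ℕ} (c : ℕ) (u : List (Fin n)) : Prop :=
  ∀ i (h : i < u.length), dig n c i = (u[i] : ℕ)

theorem exists_codesWord {n : ℕ} (u : List (Fin n)) : ∃ c < n ^ u.length, CodesWord c u := by
  obtain ⟨c, hc, h⟩ := exists_code n u.length (fun i => if h : i < u.length then u[i] else 0)
    fun i hi => by simp [hi]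
  exact ⟨c, hc, fun i hi => by simpa [hi] using h i hi⟩

theorem exists_word {n k c : ℕ} (hk : 0 < k) (hc : c < n ^ k) :
    ∃ u : List (Fin n), u.length = k ∧ CodesWord c u := by
  have hn : 0 < n := by
    rcases Nat.eq_zero_or_pos n with rfl | h
    · rw [zero_pow (by omega)] at hc; omega
    · exact h
  exact ⟨List.ofFn fun i : Fin k => ⟨dig n c i, Nat.mod_lt _ hn⟩, by simp, fun i hi => by simp⟩

section Transfer

variable {nI nO nQ : ℕ} {T : Transducer (Fin nI) (Fin nO) (Fin nQ)} {δ : ℕ → ℕ → ℕ} {l : ℕ → ℕ}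

theorem rawRun_eq (hδ : ∀ q i, δ (q : Fin nQ) (i : Fin nI) = T.step q i) {c : ℕ}
    {u : List (Fin nI)} (hc : CodesWord c u) (q : Fin nQ) (i : ℕ) (hi : i ≤ u.length) :
    rawRun δ nI c q i = T.run q (u.take i) := by
  induction i with
  | zero => rfl
  | succ i ih =>
    have h1 : rawRun δ nI c q (i + 1) = δ (rawRun δ nI c q i) (dig nI c i) := rfl
    rw [h1, ih (by omega), hc i (by omega), hδ, Transducer.run, Transducer.run,
      List.take_succ_eq_append_getElem (by omega), List.foldl_append]
    rfl

theorem getElem?_outputFrom (q : Fin nQ) (u : List (Fin nI)) (i : ℕ) (hi : i < u.length) :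
    (T.outputFrom q u)[i]? = some (T.label (T.run q (u.take (i + 1)))) := by
  induction u generalizing q i with
  | nil => simp at hi
  | cons a u ih =>
    rcases i with _ | i
    · simp [Transducer.outputFrom, Transducer.run]
    · simp only [Transducer.outputFrom, List.getElem?_cons_succ]
      rw [ih _ _ (by simpa using hi)]
      simp [Transducer.run]

theorem countBelow_eq_count {n : ℕ} {w : List (Fin n)} {f : ℕ → ℕ}
    (h : ∀ i (hi : i < w.length), f i = (w[i] : ℕ)) (a : Fin n) :
    countBelow w.length (fun i => f i = a) = w.count a := by
  rw [countBelow, count_eq_sum]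
  refine Finset.sum_congr rfl fun i hi => ?_
  have hi := Finset.mem_range.1 hi
  simp [h i hi, List.getElem?_eq_getElem hi, Fin.ext_iff]

theorem parikh_eq_iff {n : ℕ} {w w' : List (Fin n)} {f f' : ℕ → ℕ} (hl : w.length = w'.length)
    (h : ∀ i (hi : i < w.length), f i = (w[i] : ℕ))
    (h' : ∀ i (hi : i < w'.length), f' i = (w'[i] : ℕ)) :
    parikh w = parikh w' ↔ ∀ a < n, countBelow w.length (fun i => f i = a) =
      countBelow w.length (fun i => f' i = a) := by
  rw [funext_iff, Fin.forall_iff]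
  refine forall₂_congr fun a ha => ?_
  have h1 := countBelow_eq_count h ⟨a, ha⟩
  have h2 := countBelow_eq_count h' ⟨a, ha⟩
  rw [← hl] at h2
  rw [parikh, parikh, ← h1, ← h2]

theorem output_eq (hδ : ∀ q i, δ (q : Fin nQ) (i : Fin nI) = T.step q i)
    (hl : ∀ q, l (q : Fin nQ) = T.label q) {c : ℕ} {u : List (Fin nI)} (hc : CodesWord c u)
    (q : Fin nQ) (i : ℕ) (hi : i < (T.outputFrom q u).length) :
    l (rawRun δ nI c q (i + 1)) = ((T.outputFrom q u)[i] : ℕ) := by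
  have hi' : i < u.length := by rwa [Transducer.length_outputFrom] at hi
  have h1 := getElem?_outputFrom (T := T) q u i hi'
  rw [List.getElem?_eq_getElem hi, Option.some.injEq] at h1
  rw [rawRun_eq hδ hc q _ hi', hl, h1]

end Transfer

/-- A state is reached by a word if and only if there is a run. -/
theorem mem_evalFrom_iff_run {I Q : Type*} (A : NFA I Q) (u : List I) (a a' : Q) :
    a' ∈ A.evalFrom {a} u ↔ ∃ f : ℕ → Q, f 0 = a ∧ f u.length = a' ∧
      ∀ i (h : i < u.length), f (i + 1) ∈ A.step (f i) u[i] := by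
  induction u generalizing a with
  | nil =>
    constructor
    · intro h
      exact ⟨fun _ => a, rfl, h.symm, by simp⟩
    · rintro ⟨f, rfl, rfl, -⟩
      rfl
  | cons b u ih =>
    rw [NFA.evalFrom_cons, NFA.stepSet_singleton, NFA.mem_evalFrom_iff_exists]
    constructor
    · rintro ⟨t, ht, h⟩
      obtain ⟨f, rfl, rfl, hf⟩ := (ih t).1 h
      refine ⟨fun i => Nat.casesOn i a f, rfl, rfl, fun i hi => ?_⟩
      rcases i with _ | i
      · exact ht
      · exact hf i (by simpa using hi)
    · rintro ⟨f, rfl, rfl, hf⟩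
      exact ⟨f 1, hf 0 (by simp), (ih _).2 ⟨fun i => f (i + 1), rfl, rfl,
        fun i hi => hf (i + 1) (by simpa using hi)⟩⟩

section Codes

variable {R : RawInstance} {X : Instance}

/-- Answers are words, and words correspond to codes. -/
theorem RawInstance.Describes.answer_iff (h : R.Describes X) {c : ℕ} {u : List (Fin X.nI)}
    (hu : u.length = X.k) (hc : CodesWord c u) (p : Fin X.n₁) (q q' : Fin X.n₂) :
    R.Answer c p q q' ↔ CanAnswer X.k X.T₁ X.T₂ p u q q' := by
  have key : ∀ (c' : ℕ) (u' : List (Fin X.nI)), u'.length = X.k → CodesWord c' u' →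
      (((∀ a < R.nI, countBelow R.k (fun i => dig R.nI c i = a) =
        countBelow R.k (fun i => dig R.nI c' i = a)) ∧
      (∀ o < R.nO, countBelow R.k (fun i => R.l₁ (rawRun R.δ₁ R.nI c p (i + 1)) = o) =
        countBelow R.k (fun i => R.l₂ (rawRun R.δ₂ R.nI c' q (i + 1)) = o)) ∧
      rawRun R.δ₂ R.nI c' q R.k = q') ↔ (parikh u = parikh u' ∧
        parikh (X.T₁.outputFrom p u) = parikh (X.T₂.outputFrom q u') ∧
        X.T₂.run q u' = q')) := by
    intro c' u' hu' hc'
    have e1 := parikh_eq_iff (hu.trans hu'.symm) hc hc'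
    have e2 := parikh_eq_iff (w := X.T₁.outputFrom p u) (w' := X.T₂.outputFrom q u')
      (by rw [Transducer.length_outputFrom, Transducer.length_outputFrom, hu, hu'])
      (output_eq h.δ₁ h.l₁ hc p) (output_eq h.δ₂ h.l₂ hc' q)
    have e3 := rawRun_eq h.δ₂ hc' q X.k hu'.ge
    rw [hu] at e1
    rw [Transducer.length_outputFrom, hu] at e2
    rw [← hu', List.take_length, hu'] at e3
    rw [h.nI, h.nO, h.k, e1, e2, e3, Fin.ext_iff]
  constructor
  · rintro ⟨c', hc'lt, hh⟩
    rw [h.nI, h.k] at hc'lt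
    obtain ⟨u', hu', hc'⟩ := exists_word X.k_pos hc'lt
    exact ⟨u', hu', (key c' u' hu' hc').1 hh⟩
  · rintro ⟨u', hu', hh⟩
    obtain ⟨c', hc'lt, hc'⟩ := exists_codesWord u'
    refine ⟨c', ?_, (key c' u' hu' hc').2 hh⟩
    rwa [h.nI, h.k, ← hu']

theorem RawInstance.Describes.autRun_iff (h : R.Describes X) {c : ℕ} {u : List (Fin X.nI)}
    (hu : u.length = X.k) (hc : CodesWord c u) (a a' : Fin X.m) :
    R.AutRun c a a' ↔ a' ∈ X.aut.toNFA.evalFrom {a} u := by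
  rw [mem_evalFrom_iff_run]
  have hstep : ∀ q i q', q' ∈ X.aut.toNFA.step q i ↔ R.δ₃ q i q' := fun q i q' =>
    (h.δ₃ q i q').symm
  constructor
  · rintro ⟨r, -, h1, h2, h3⟩
    rw [h.m, h.k] at *
    have hm : 0 < X.m := a.pos
    refine ⟨fun i => ⟨dig X.m r i, Nat.mod_lt _ hm⟩, Fin.ext h1, Fin.ext (by rw [hu]; exact h2),
      fun i hi => ?_⟩
    rw [hstep, ← hc i hi, ← h.nI]
    exact h3 i (by omega)
  · rintro ⟨f, rfl, rfl, h3⟩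
    obtain ⟨r, hr, hf⟩ := exists_code X.m (X.k + 1) (fun i => f i) fun i _ => (f i).2
    refine ⟨r, by rwa [h.m, h.k], by rw [h.m, hf 0 (by omega)],
      by rw [h.m, h.k, hf _ (by omega), hu], fun i hi => ?_⟩
    rw [h.k] at hi
    rw [h.m, h.nI, hf _ (by omega), hf _ (by omega), hc i (by omega), ← hstep]
    exact h3 i (by omega)

/-- The number `u` is a code of the triple `v`. -/
def CodesTriple (R : RawInstance) (X : Instance) (u : ℕ)
    (v : (Fin X.n₁ × Fin X.m) × Set (Fin X.n₂)) : Prop :=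
  R.fstState u = v.1.1 ∧ R.autState u = v.1.2 ∧ ∀ q : Fin X.n₂, R.HasState u q ↔ q ∈ v.2

theorem RawInstance.Describes.exists_codesTriple (h : R.Describes X)
    (v : (Fin X.n₁ × Fin X.m) × Set (Fin X.n₂)) :
    ∃ u < R.size, CodesTriple R X u v := by
  classical
  obtain ⟨⟨p, a⟩, S⟩ := v
  obtain ⟨s, hs, hd⟩ := exists_code 2 X.n₂
    (fun i => if hi : i < X.n₂ then (if (⟨i, hi⟩ : Fin X.n₂) ∈ S then 1 else 0) else 0)
    fun i hi => by simp only [hi, dite_true]; split_ifs <;> omega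
  have hp := p.2
  have ha := a.2
  have h1 : (p + X.n₁ * (a + X.m * s)) / X.n₁ = a + X.m * s := by
    rw [Nat.add_mul_div_left _ _ (by omega), Nat.div_eq_of_lt hp, zero_add]
  have h2 : (a + X.m * s) / X.m = s := by
    rw [Nat.add_mul_div_left _ _ (by omega), Nat.div_eq_of_lt ha, zero_add]
  refine ⟨p + X.n₁ * (a + X.m * s), ?_, ?_, ?_, fun q => ?_⟩
  · rw [RawInstance.size, h.n₁, h.m, h.n₂]
    have g1 : a + X.m * s < X.m * 2 ^ X.n₂ := by nlinarith
    rw [mul_assoc]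
    nlinarith
  · rw [RawInstance.fstState, h.n₁, Nat.add_mul_mod_self_left, Nat.mod_eq_of_lt hp]
  · rw [RawInstance.autState, h.n₁, h.m, h1, Nat.add_mul_mod_self_left, Nat.mod_eq_of_lt ha]
  · rw [RawInstance.HasState, h.n₁, h.m, h1, h2, hd q q.2]
    simp

theorem RawInstance.Describes.exists_triple (h : R.Describes X) (u : ℕ) :
    ∃ v, CodesTriple R X u v := by
  refine ⟨((⟨R.fstState u, ?_⟩, ⟨R.autState u, ?_⟩), {q | R.HasState u q}), rfl, rfl,
    fun q => Iff.rfl⟩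
  · rw [RawInstance.fstState, h.n₁]; exact Nat.mod_lt _ X.T₁.start.pos
  · rw [RawInstance.autState, h.m]; exact Nat.mod_lt _ X.aut.start.pos

theorem RawInstance.Describes.step_iff (h : R.Describes X) {u u' : ℕ}
    {v v' : (Fin X.n₁ × Fin X.m) × Set (Fin X.n₂)}
    (hu : CodesTriple R X u v) (hu' : CodesTriple R X u' v') :
    R.Step u u' ↔ RoundStep X.k X.T₁ X.T₂ X.aut.toNFA v v' := by
  have key : ∀ (c : ℕ) (w : List (Fin X.nI)), w.length = X.k → CodesWord c w →
      ((R.fstState u' = rawRun R.δ₁ R.nI c (R.fstState u) R.k ∧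
        R.AutRun c (R.autState u) (R.autState u') ∧
        ∀ q' < R.n₂, R.HasState u' q' ↔
          ∃ q < R.n₂, R.HasState u q ∧ R.Answer c (R.fstState u) q q') ↔
      (v'.1.1 = X.T₁.run v.1.1 w ∧ v'.1.2 ∈ X.aut.toNFA.evalFrom {v.1.2} w ∧
        v'.2 = {q' | ∃ q ∈ v.2, CanAnswer X.k X.T₁ X.T₂ v.1.1 w q q'})) := by
    intro c w hw hc
    have e1 := rawRun_eq h.δ₁ hc v.1.1 X.k hw.ge
    rw [← hw, List.take_length, hw] at e1
    rw [hu.1, hu'.1, hu.2.1, hu'.2.1, h.autRun_iff hw hc, h.nI, h.k, e1, ← Fin.ext_iff,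
      Set.ext_iff, h.n₂, Fin.forall_iff]
    refine and_congr Iff.rfl (and_congr Iff.rfl (forall₂_congr fun q' hq' => ?_))
    rw [hu'.2.2 ⟨q', hq'⟩, Set.mem_ofPred_eq, Fin.exists_iff]
    refine iff_congr Iff.rfl ⟨?_, ?_⟩
    · rintro ⟨q, hq, h1, h2⟩
      exact ⟨q, hq, (hu.2.2 ⟨q, hq⟩).1 h1, (h.answer_iff hw hc _ ⟨q, hq⟩ ⟨q', hq'⟩).1 h2⟩
    · rintro ⟨q, hq, h1, h2⟩
      exact ⟨q, hq, (hu.2.2 ⟨q, hq⟩).2 h1, (h.answer_iff hw hc _ ⟨q, hq⟩ ⟨q', hq'⟩).2 h2⟩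
  constructor
  · rintro ⟨c, hclt, hh⟩
    rw [h.nI, h.k] at hclt
    obtain ⟨w, hw, hc⟩ := exists_word X.k_pos hclt
    exact ⟨w, hw, (key c w hw hc).1 hh⟩
  · rintro ⟨w, hw, hh⟩
    obtain ⟨c, hclt, hc⟩ := exists_codesWord w
    refine ⟨c, ?_, (key c w hw hc).2 hh⟩
    rwa [h.nI, h.k, ← hw]

/-- Round simulation is non-reachability of a refuting triple, in terms of triples and in terms of
their codes. A triple may have several codes, but the codes of a triple have the same steps. -/
theorem RawInstance.Describes.simulated_iff (h : R.Describes X) :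
    R.Simulated ↔ RoundSimulated X.k X.aut.toNFA.accepts X.T₁ X.T₂ := by
  rw [roundSimulated_iff X.k_pos (s := X.aut.start) rfl, RawInstance.Simulated]
  refine not_congr ⟨?_, ?_⟩
  · rintro ⟨u, hu, hi, v, hv, hs, hr⟩
    have hu0 : CodesTriple R X u ((X.T₁.start, X.aut.start), {X.T₂.start}) := by
      refine ⟨hi.1.trans h.s₁, hi.2.1.trans h.s₃, fun q => ?_⟩
      rw [hi.2.2 q (by rw [h.n₂]; exact q.2), h.s₂, Set.mem_singleton_iff, Fin.ext_iff]
    have hreach : ∀ v, ReflTransGen (EdgeBelow R.Step R.size) u v → ∃ b, CodesTriple R X v b ∧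
        ReflTransGen (RoundStep X.k X.T₁ X.T₂ X.aut.toNFA)
          ((X.T₁.start, X.aut.start), {X.T₂.start}) b := by
      intro v hv
      induction hv with
      | refl => exact ⟨_, hu0, .refl⟩
      | tail _ h2 ih =>
        obtain ⟨b, hb, hb'⟩ := ih
        obtain ⟨b', hb''⟩ := h.exists_triple _
        exact ⟨b', hb'', hb'.tail ((h.step_iff hb hb'').1 h2.2.2)⟩
    obtain ⟨b, hb, hb'⟩ := hreach v ((search_iff hu).1 hs)
    refine ⟨b, hb', ?_, Set.eq_empty_iff_forall_notMem.2 fun q hq => ?_⟩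
    · have := hr.1
      rw [hb.2.1, h.acc] at this
      exact this
    · exact hr.2 q (by rw [h.n₂]; exact q.2) ((hb.2.2 q).2 hq)
  · rintro ⟨b, hb, ha, he⟩
    obtain ⟨u, hu, hu0⟩ := h.exists_codesTriple ((X.T₁.start, X.aut.start), {X.T₂.start})
    have hreach : ∀ b, ReflTransGen (RoundStep X.k X.T₁ X.T₂ X.aut.toNFA)
          ((X.T₁.start, X.aut.start), {X.T₂.start}) b → ∃ v < R.size, CodesTriple R X v b ∧
        ReflTransGen (EdgeBelow R.Step R.size) u v := by
      intro b hb
      induction hb with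
      | refl => exact ⟨u, hu, hu0, .refl⟩
      | tail _ h2 ih =>
        obtain ⟨v, hv, hv', hvr⟩ := ih
        obtain ⟨v', hv1, hv2⟩ := h.exists_codesTriple _
        exact ⟨v', hv1, hv2, hvr.tail ⟨hv, hv1, (h.step_iff hv' hv2).2 h2⟩⟩
    obtain ⟨v, hv, hv', hvr⟩ := hreach b hb
    refine ⟨u, hu, ⟨hu0.1.trans h.s₁.symm, hu0.2.1.trans h.s₃.symm, fun q hq => ?_⟩, v, hv,
      (search_iff hu).2 hvr, ?_, fun q hq => ?_⟩
    · rw [h.n₂] at hq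
      rw [hu0.2.2 ⟨q, hq⟩, h.s₂, Set.mem_singleton_iff, Fin.ext_iff]
    · rw [hv'.2.1, h.acc]
      exact ha
    · rw [h.n₂] at hq
      rw [hv'.2.2 ⟨q, hq⟩, he]
      exact Set.notMem_empty _

end Codes

/-! ### Reading an instance from its encoding -/

theorem append_eq_append_iff_of_length {α : Type*} {a b c d : List α} (h : a.length = c.length) :
    a ++ b = c ++ d ↔ a = c ∧ b = d :=
  ⟨fun e => List.append_inj e h, by rintro ⟨rfl, rfl⟩; rfl⟩

theorem map_range_add (g : ℕ → ℕ) (a b : ℕ) : (List.range (a + b)).map g =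
    (List.range a).map g ++ (List.range b).map fun j => g (a + j) := by
  rw [List.range_add, List.map_append, List.map_map]
  rfl

theorem map_finRange_eq_iff {n : ℕ} (F : Fin n → ℕ) (g : ℕ → ℕ) :
    (List.finRange n).map F = (List.range n).map g ↔ ∀ i : Fin n, F i = g i := by
  rw [← List.map_coe_finRange_eq_range, List.map_map, List.map_inj_left]
  simp

/-- The entries of a table that consists of blocks of the same length. -/
theorem flatMap_finRange_eq_iff {n L : ℕ} (F : Fin n → List ℕ) (hF : ∀ q, (F q).length = L)
    (g : ℕ → ℕ) : (List.finRange n).flatMap F = (List.range (n * L)).map g ↔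
      ∀ q : Fin n, F q = (List.range L).map fun j => g (q * L + j) := by
  induction n with
  | zero => simp
  | succ n ih =>
    rw [List.finRange_succ_last, List.flatMap_append, Nat.succ_mul, map_range_add,
      append_eq_append_iff_of_length, List.flatMap_map, ih _ fun q => hF _, Fin.forall_fin_succ']
    · simp
    · simp [List.length_flatMap, hF, Function.comp_def]

theorem Transducer.length_table {a b n : ℕ} (T : Transducer (Fin a) (Fin b) (Fin n)) :
    T.table.length = 1 + (n * a + n) := by
  simp [Transducer.table, List.length_flatMap]
  omega

theorem AutomatonData.length_table {a n : ℕ} (A : AutomatonData (Fin a) (Fin n)) :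
    A.table.length = 1 + (n * (a * n) + n) := by
  simp [AutomatonData.table, List.length_flatMap]
  omega

theorem Transducer.table_eq_iff {a b n : ℕ} (T : Transducer (Fin a) (Fin b) (Fin n))
    (g : ℕ → ℕ) : T.table = (List.range (1 + (n * a + n))).map g ↔ (T.start : ℕ) = g 0 ∧
      (∀ (q : Fin n) (i : Fin a), (T.step q i : ℕ) = g (1 + (q * a + i))) ∧
      ∀ q : Fin n, (T.label q : ℕ) = g (1 + (n * a + q)) := by
  rw [map_range_add, map_range_add, Transducer.table, List.range_one, List.map_singleton,
    List.singleton_append, List.cons.injEq, append_eq_append_iff_of_length,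
    flatMap_finRange_eq_iff _ (L := a) (by simp), map_finRange_eq_iff]
  · simp only [map_finRange_eq_iff]
  · simp [List.length_flatMap]

theorem AutomatonData.table_eq_iff {a n : ℕ} (A : AutomatonData (Fin a) (Fin n))
    (g : ℕ → ℕ) : A.table = (List.range (1 + (n * (a * n) + n))).map g ↔ (A.start : ℕ) = g 0 ∧
      (∀ (q : Fin n) (i : Fin a) (q' : Fin n),
        (if q' ∈ A.step q i then 1 else 0) = g (1 + (q * (a * n) + (i * n + q')))) ∧
      ∀ q : Fin n, (if q ∈ A.accept then 1 else 0) = g (1 + (n * (a * n) + q)) := by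
  rw [map_range_add, map_range_add, AutomatonData.table, List.range_one, List.map_singleton,
    List.singleton_append, List.cons.injEq, append_eq_append_iff_of_length,
    flatMap_finRange_eq_iff _ (L := a * n) (by simp [List.length_flatMap]), map_finRange_eq_iff]
  · refine and_congr Iff.rfl (and_congr (forall_congr' fun q => ?_) Iff.rfl)
    rw [flatMap_finRange_eq_iff _ (L := n) (by simp)]
    simp only [map_finRange_eq_iff]
  · simp [List.length_flatMap]

/-- The encoding of an instance as a list of numbers. The block of `k` ones is read as the binary
representation of `2 ^ k - 1`. -/
def Instance.numbers (X : Instance) : List ℕ :=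
  [2 ^ X.k - 1, X.nI, X.nO, X.n₁, X.n₂, X.m] ++ (X.T₁.table ++ (X.T₂.table ++ X.aut.table))

theorem bits_two_pow_sub_one (k : ℕ) : (2 ^ k - 1).bits = List.replicate k true := by
  induction k with
  | zero => rfl
  | succ k ih =>
    have h : 2 ^ (k + 1) - 1 = 2 * (2 ^ k - 1) + 1 := by
      have := Nat.one_le_two_pow (n := k)
      omega
    rw [h, Nat.bit1_bits, ih, List.replicate_succ]

theorem Instance.encode_eq (X : Instance) : X.encode = encodeNats X.numbers := by
  rw [Instance.encode, Instance.numbers]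
  simp [encodeNats_cons, bits_two_pow_sub_one]

/-- The instance that is given by the sequence `d` of numbers, if `d` has at least `len` terms. The
minimum has no effect on valid encodings; it keeps `2 ^ n₂` small on all words. -/
def rawOf (d : ℕ → ℕ) (len : ℕ) : RawInstance where
  k := (d 0).size
  nI := d 1
  nO := d 2
  n₁ := d 3
  n₂ := min (d 4) len
  m := d 5
  s₁ := d 6
  δ₁ q i := d (6 + (1 + (q * d 1 + i)))
  l₁ q := d (6 + (1 + (d 3 * d 1 + q)))
  s₂ := d (6 + (1 + (d 3 * d 1 + d 3)))
  δ₂ q i := d (6 + (1 + (d 3 * d 1 + d 3)) + (1 + (q * d 1 + i)))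
  l₂ q := d (6 + (1 + (d 3 * d 1 + d 3)) + (1 + (d 4 * d 1 + q)))
  s₃ := d (6 + (1 + (d 3 * d 1 + d 3)) + (1 + (d 4 * d 1 + d 4)))
  δ₃ q i q' := d (6 + (1 + (d 3 * d 1 + d 3)) + (1 + (d 4 * d 1 + d 4)) +
    (1 + (q * (d 1 * d 5) + (i * d 5 + q')))) = 1
  acc q := d (6 + (1 + (d 3 * d 1 + d 3)) + (1 + (d 4 * d 1 + d 4)) +
    (1 + (d 5 * (d 1 * d 5) + q))) = 1

/-- The first `len` terms of the sequence `d` encode an instance. -/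
def Valid (d : ℕ → ℕ) (len : ℕ) : Prop :=
  ((0 < (d 0).size ∧ d 0 = 2 ^ (d 0).size - 1) ∧
    len = 6 + (1 + (d 3 * d 1 + d 3)) + (1 + (d 4 * d 1 + d 4)) +
      (1 + (d 5 * (d 1 * d 5) + d 5))) ∧
  (d 6 < d 3 ∧ (∀ j < d 3 * d 1, d (6 + (1 + j)) < d 3) ∧
    ∀ q < d 3, d (6 + (1 + (d 3 * d 1 + q))) < d 2) ∧
  (d (6 + (1 + (d 3 * d 1 + d 3))) < d 4 ∧
    (∀ j < d 4 * d 1, d (6 + (1 + (d 3 * d 1 + d 3)) + (1 + j)) < d 4) ∧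
    ∀ q < d 4, d (6 + (1 + (d 3 * d 1 + d 3)) + (1 + (d 4 * d 1 + q))) < d 2) ∧
  (d (6 + (1 + (d 3 * d 1 + d 3)) + (1 + (d 4 * d 1 + d 4))) < d 5 ∧
    ∀ j < d 5 * (d 1 * d 5) + d 5,
      d (6 + (1 + (d 3 * d 1 + d 3)) + (1 + (d 4 * d 1 + d 4)) + (1 + j)) < 2)

/-- The list of an instance consists of the first `len` terms of `d` if and only if its parts do
so at their respective positions. -/
theorem Instance.numbers_eq_iff (X : Instance) (d : ℕ → ℕ) (len : ℕ)
    (hlen : len = 6 + (1 + (X.n₁ * X.nI + X.n₁)) + (1 + (X.n₂ * X.nI + X.n₂)) +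
      (1 + (X.m * (X.nI * X.m) + X.m))) :
    X.numbers = (List.range len).map d ↔
      (2 ^ X.k - 1 = d 0 ∧ X.nI = d 1 ∧ X.nO = d 2 ∧ X.n₁ = d 3 ∧ X.n₂ = d 4 ∧ X.m = d 5) ∧
      X.T₁.table = (List.range (1 + (X.n₁ * X.nI + X.n₁))).map (fun j => d (6 + j)) ∧
      X.T₂.table = (List.range (1 + (X.n₂ * X.nI + X.n₂))).map
        (fun j => d (6 + (1 + (X.n₁ * X.nI + X.n₁)) + j)) ∧
      X.aut.table = (List.range (1 + (X.m * (X.nI * X.m) + X.m))).map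
        (fun j => d (6 + (1 + (X.n₁ * X.nI + X.n₁)) + (1 + (X.n₂ * X.nI + X.n₂)) + j)) := by
  rw [hlen, Instance.numbers, map_range_add, map_range_add, map_range_add, List.append_assoc,
    List.append_assoc, append_eq_append_iff_of_length (by simp),
    append_eq_append_iff_of_length (by rw [Transducer.length_table]; simp),
    append_eq_append_iff_of_length (by rw [Transducer.length_table]; simp)]
  simp [List.range_succ]

theorem Instance.length_numbers (X : Instance) : X.numbers.length =
    6 + (1 + (X.n₁ * X.nI + X.n₁)) + (1 + (X.n₂ * X.nI + X.n₂)) +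
      (1 + (X.m * (X.nI * X.m) + X.m)) := by
  rw [Instance.numbers]
  simp only [List.length_append, Transducer.length_table, AutomatonData.length_table,
    List.length_cons, List.length_nil]
  omega

theorem size_two_pow_sub_one (k : ℕ) : (2 ^ k - 1).size = k := by
  rw [← Nat.size_eq_bits_len, bits_two_pow_sub_one, List.length_replicate]

theorem describes_rawOf {X : Instance} {d : ℕ → ℕ} {len : ℕ}
    (h : X.numbers = (List.range len).map d) : (rawOf d len).Describes X := by
  have hlen := (congrArg List.length h).symm
  rw [List.length_map, List.length_range, X.length_numbers] at hlen
  obtain ⟨⟨h0, h1, h2, h3, h4, h5⟩, t1, t2, t3⟩ := (X.numbers_eq_iff d len hlen).1 h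
  obtain ⟨a1, a2, a3⟩ := (X.T₁.table_eq_iff _).1 t1
  obtain ⟨b1, b2, b3⟩ := (X.T₂.table_eq_iff _).1 t2
  obtain ⟨c1, c2, c3⟩ := (X.aut.table_eq_iff _).1 t3
  have hn : X.n₂ ≤ len := by omega
  constructor <;> simp only [rawOf, ← h0, ← h1, ← h2, ← h3, ← h4, ← h5]
  · exact min_eq_left hn
  · exact size_two_pow_sub_one _
  · exact a1.symm
  · exact fun q i => (a2 q i).symm
  · exact fun q => (a3 q).symm
  · exact b1.symm
  · exact fun q i => (b2 q i).symm
  · exact fun q => (b3 q).symm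
  · exact c1.symm
  · intro q i q'
    rw [← c2]
    simp
  · intro q
    rw [← c3]
    simp

/-- The sequences that start with the encoding of an instance are valid. -/
theorem valid_of_numbers {X : Instance} {d : ℕ → ℕ} {len : ℕ}
    (h : X.numbers = (List.range len).map d) : Valid d len := by
  have hlen := (congrArg List.length h).symm
  rw [List.length_map, List.length_range, X.length_numbers] at hlen
  obtain ⟨⟨h0, h1, h2, h3, h4, h5⟩, t1, t2, t3⟩ := (X.numbers_eq_iff d len hlen).1 h
  obtain ⟨a1, a2, a3⟩ := (X.T₁.table_eq_iff _).1 t1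
  obtain ⟨b1, b2, b3⟩ := (X.T₂.table_eq_iff _).1 t2
  obtain ⟨c1, c2, c3⟩ := (X.aut.table_eq_iff _).1 t3
  -- An index into the transition table is split into its row and its column.
  have split : ∀ {n a j : ℕ}, j < n * a → ∃ (q : Fin n) (i : Fin a), j = q * a + i := by
    intro n a j hj
    have ha : 0 < a := Nat.pos_of_ne_zero (by rintro rfl; simp at hj)
    exact ⟨⟨j / a, (Nat.div_lt_iff_lt_mul ha).2 hj⟩, ⟨j % a, Nat.mod_lt _ ha⟩,
      (Nat.div_add_mod' j a).symm⟩
  simp only [Valid, ← h0, ← h1, ← h2, ← h3, ← h4, ← h5, size_two_pow_sub_one]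
  refine ⟨⟨⟨X.k_pos, trivial⟩, hlen⟩, ⟨?_, fun j hj => ?_, fun q hq => ?_⟩,
    ⟨?_, fun j hj => ?_, fun q hq => ?_⟩, ?_, fun j hj => ?_⟩
  · exact a1 ▸ X.T₁.start.2
  · obtain ⟨q, i, rfl⟩ := split hj
    exact a2 q i ▸ (X.T₁.step q i).2
  · exact a3 ⟨q, hq⟩ ▸ (X.T₁.label _).2
  · exact b1 ▸ X.T₂.start.2
  · obtain ⟨q, i, rfl⟩ := split hj
    exact b2 q i ▸ (X.T₂.step q i).2
  · exact b3 ⟨q, hq⟩ ▸ (X.T₂.label _).2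
  · exact c1 ▸ X.aut.start.2
  · rcases lt_or_ge j (X.m * (X.nI * X.m)) with hj' | hj'
    · obtain ⟨q, r, rfl⟩ := split hj'
      obtain ⟨i, q', hr⟩ := split r.2
      rw [hr, ← c2 q i q']
      split_ifs <;> simp
    · obtain ⟨q, rfl⟩ := Nat.exists_eq_add_of_le hj'
      rw [← c3 ⟨q, by omega⟩]
      split_ifs <;> simp

/-- Every valid sequence starts with the encoding of an instance. -/
theorem exists_numbers_eq {d : ℕ → ℕ} {len : ℕ} (h : Valid d len) :
    ∃ X : Instance, X.numbers = (List.range len).map d := by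
  classical
  obtain ⟨⟨⟨hk, h0⟩, hlen⟩, ⟨a1, a2, a3⟩, ⟨b1, b2, b3⟩, c1, c2⟩ := h
  have hidx : ∀ {n a : ℕ} (q : Fin n) (i : Fin a), (q * a + i : ℕ) < n * a := by
    intro n a q i
    have h1 := i.2
    have h2 : (q + 1) * a ≤ n * a := Nat.mul_le_mul_right _ q.2
    rw [Nat.succ_mul] at h2
    omega
  have h01 : ∀ {P : Prop} [Decidable P] {x : ℕ}, (P ↔ x = 1) → x < 2 →
      (if P then 1 else 0) = x := by
    intro P _ x hP hx
    split_ifs with h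
    · exact (hP.1 h).symm
    · have := mt hP.2 h
      omega
  refine ⟨{ nI := d 1, nO := d 2, n₁ := d 3, n₂ := d 4, m := d 5, k := (d 0).size, k_pos := hk
            T₁ := ⟨⟨_, a1⟩, fun q i => ⟨_, a2 _ (hidx q i)⟩, fun q => ⟨_, a3 q q.2⟩⟩
            T₂ := ⟨⟨_, b1⟩, fun q i => ⟨_, b2 _ (hidx q i)⟩, fun q => ⟨_, b3 q q.2⟩⟩
            aut := ⟨⟨_, c1⟩, fun q i => Finset.univ.filter fun q' => (rawOf d len).δ₃ q i q',
              Finset.univ.filter fun q => (rawOf d len).acc q⟩ }, ?_⟩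
  refine (Instance.numbers_eq_iff _ d len hlen).2 ⟨⟨h0.symm, rfl, rfl, rfl, rfl, rfl⟩,
    (Transducer.table_eq_iff _ _).2 ⟨rfl, fun q i => rfl, fun q => rfl⟩,
    (Transducer.table_eq_iff _ _).2 ⟨rfl, fun q i => rfl, fun q => rfl⟩,
    (AutomatonData.table_eq_iff _ _).2 ⟨rfl, fun q i q' => ?_, fun q => ?_⟩⟩
  · simp only [Finset.mem_filter, Finset.mem_univ, true_and]
    refine h01 Iff.rfl (c2 _ ?_)
    have e1 := hidx i q'
    have e2 := hidx q (⟨_, e1⟩ : Fin (d 1 * d 5))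
    exact Nat.lt_add_right _ e2
  · simp only [Finset.mem_filter, Finset.mem_univ, true_and]
    exact h01 Iff.rfl (c2 _ (Nat.add_lt_add_left q.2 _))

/-- A list that is encoded by a word consists of the numbers `numAt`, one for each separator. -/
theorem map_numAt {w : List (Option Bool)} (h : WellFormed w) :
    (List.range (w.count none)).map (numAt w) = decodeNats w := by
  refine List.ext_getElem (by simp [length_decodeNats, h]) fun i h1 h2 => ?_
  rw [List.getElem_map, List.getElem_range, numAt_eq h, List.getD_eq_getElem _ _ h2]

/-- The encoded instances are recognized, and the simulation is decided on numbers. -/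
theorem mem_fixedRoundSimulation_iff (w : List (Option Bool)) : w ∈ fixedRoundSimulation ↔
    WellFormed w ∧ Valid (numAt w) (w.count none) ∧
      (rawOf (numAt w) (w.count none)).Simulated := by
  constructor
  · rintro ⟨X, rfl, hX⟩
    rw [X.encode_eq]
    have hw := wellFormed_encodeNats X.numbers
    have hn := map_numAt hw
    rw [decodeNats_encodeNats] at hn
    exact ⟨hw, valid_of_numbers hn.symm, (describes_rawOf hn.symm).simulated_iff.2 hX⟩
  · rintro ⟨hw, hv, hs⟩
    obtain ⟨X, hX⟩ := exists_numbers_eq hv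
    refine ⟨X, ?_, (describes_rawOf hX).simulated_iff.1 hs⟩
    rw [X.encode_eq, hX, map_numAt hw, encodeNats_decodeNats hw]

/-! ### The decision procedure uses polynomial space -/

/-- The instance that is read off from a word. -/
noncomputable def rawOfWord (w : List (Option Bool)) : RawInstance := rawOf (numAt w) (w.count none)

theorem pSpaceFun_valid : PSpaceFun fun w => Valid (numAt w) (w.count none) := by
  have hc := PSpaceFun.count_none
  have h0 : PSpaceFun fun w => 2 ^ (numAt w 0).size :=
    .pow (by fun_prop) (by fun_prop)
      (.pow_size (PSpaceFun.bounded (by fun_prop)) (PSpaceFun.bounded (by fun_prop)))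
  unfold Valid
  exact .and (by fun_prop) (.and (.and (by fun_prop) (.and (.ball (by fun_prop) (by fun_prop))
    (.ball (by fun_prop) (by fun_prop)))) (.and (.and (by fun_prop)
      (.and (.ball (by fun_prop) (by fun_prop)) (.ball (by fun_prop) (by fun_prop))))
        (.and (by fun_prop) (.ball (by fun_prop) (by fun_prop)))))

namespace PSpaceFun

variable {α : Type} [Coded α]

/-- Runs are computable in polynomial space if there is a polynomial bound for the digits of the
states. -/
theorem rawRun {δ : α → ℕ → ℕ → ℕ} {n c q i B : α → ℕ}
    (hδ : PSpaceFun fun p : (α × ℕ) × ℕ => δ p.1.1 p.1.2 p.2) (hB : PolyBounded B)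
    (hle : ∀ x q i, δ x q i ≤ B x) (hn : PSpaceFun n) (hc : PSpaceFun c) (hq : PSpaceFun q)
    (hi : PSpaceFun i) : PSpaceFun fun x => rawRun (δ x) (n x) (c x) (q x) (i x) := by
  have hd : PSpaceFun fun p : (α × ℕ) × ℕ => _root_.dig (n p.1.1) (c p.1.1) p.1.2 :=
    .dig (by fun_prop) (by fun_prop) (by fun_prop)
  refine rec' (h := fun x i p => δ x p (_root_.dig (n x) (c x) i)) hi hq
    (hδ.comp (g := fun p : (α × ℕ) × ℕ => ((p.1.1, p.2), _root_.dig (n p.1.1) (c p.1.1) p.1.2))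
      (by fun_prop)) (hq.bounded.add hB) fun x j _ => ?_
  rw [sz_nat]
  cases j with
  | zero => exact Nat.le_add_right _ _
  | succ j => exact (hle _ _ _).trans (Nat.le_add_left _ _)

theorem countBelow {k : α → ℕ} {P : α → ℕ → Prop} (hk : PSpaceFun k)
    (hP : PSpaceFun fun p : α × ℕ => P p.1 p.2) : PSpaceFun fun x => countBelow (k x) (P x) := by
  classical
  exact (sum (f := fun x i => if P x i then 1 else 0) hk
    (.ite hP (by fun_prop) (by fun_prop))).of_enc_eq fun x => by rw [_root_.countBelow]

variable {f : α → List (Option Bool)} {c p q q' u v i a a' : α → ℕ}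

theorem raw_nI (hf : PSpaceFun f) : PSpaceFun fun x => (rawOfWord (f x)).nI := by
  simp only [rawOfWord, rawOf]; fun_prop

theorem raw_nO (hf : PSpaceFun f) : PSpaceFun fun x => (rawOfWord (f x)).nO := by
  simp only [rawOfWord, rawOf]; fun_prop

theorem raw_n₁ (hf : PSpaceFun f) : PSpaceFun fun x => (rawOfWord (f x)).n₁ := by
  simp only [rawOfWord, rawOf]; fun_prop

theorem raw_n₂ (hf : PSpaceFun f) : PSpaceFun fun x => (rawOfWord (f x)).n₂ := by
  have h := count_none.comp hf
  simp only [rawOfWord, rawOf]; fun_prop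

theorem raw_m (hf : PSpaceFun f) : PSpaceFun fun x => (rawOfWord (f x)).m := by
  simp only [rawOfWord, rawOf]; fun_prop

theorem raw_k (hf : PSpaceFun f) : PSpaceFun fun x => (rawOfWord (f x)).k := by
  simp only [rawOfWord, rawOf]; fun_prop

theorem raw_s₁ (hf : PSpaceFun f) : PSpaceFun fun x => (rawOfWord (f x)).s₁ := by
  simp only [rawOfWord, rawOf]; fun_prop

theorem raw_s₂ (hf : PSpaceFun f) : PSpaceFun fun x => (rawOfWord (f x)).s₂ := by
  simp only [rawOfWord, rawOf]; fun_prop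

theorem raw_s₃ (hf : PSpaceFun f) : PSpaceFun fun x => (rawOfWord (f x)).s₃ := by
  simp only [rawOfWord, rawOf]; fun_prop

theorem raw_l₁ (hf : PSpaceFun f) (hq : PSpaceFun q) :
    PSpaceFun fun x => (rawOfWord (f x)).l₁ (q x) := by
  simp only [rawOfWord, rawOf]; fun_prop

theorem raw_l₂ (hf : PSpaceFun f) (hq : PSpaceFun q) :
    PSpaceFun fun x => (rawOfWord (f x)).l₂ (q x) := by
  simp only [rawOfWord, rawOf]; fun_prop

theorem raw_δ₃ (hf : PSpaceFun f) (hq : PSpaceFun q) (hi : PSpaceFun i) (hq' : PSpaceFun q') :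
    PSpaceFun fun x => (rawOfWord (f x)).δ₃ (q x) (i x) (q' x) := by
  simp only [rawOfWord, rawOf]; fun_prop

theorem raw_acc (hf : PSpaceFun f) (hq : PSpaceFun q) :
    PSpaceFun fun x => (rawOfWord (f x)).acc (q x) := by
  simp only [rawOfWord, rawOf]; fun_prop

theorem raw_run₁ (hf : PSpaceFun f) (hc : PSpaceFun c) (hq : PSpaceFun q) (hi : PSpaceFun i) :
    PSpaceFun fun x => _root_.rawRun (rawOfWord (f x)).δ₁ (rawOfWord (f x)).nI (c x) (q x) (i x) :=
  rawRun (by simp only [rawOfWord, rawOf]; fun_prop) (hf.wordVal.bounded)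
    (fun _ _ _ => numAt_le _ _) (raw_nI hf) hc hq hi

theorem raw_run₂ (hf : PSpaceFun f) (hc : PSpaceFun c) (hq : PSpaceFun q) (hi : PSpaceFun i) :
    PSpaceFun fun x => _root_.rawRun (rawOfWord (f x)).δ₂ (rawOfWord (f x)).nI (c x) (q x) (i x) :=
  rawRun (by simp only [rawOfWord, rawOf]; fun_prop) (hf.wordVal.bounded)
    (fun _ _ _ => numAt_le _ _) (raw_nI hf) hc hq hi

/-- The number of words of length `k` has polynomially many digits, as `k` is the number of digits
of a number in the encoding. -/
theorem raw_pow_k (hf : PSpaceFun f) (hp : PSpaceFun p) :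
    PSpaceFun fun x => p x ^ (rawOfWord (f x)).k :=
  .pow hp (raw_k hf) (hp.bounded.pow_size (g := fun x => _root_.numAt (f x) 0)
    (bounded (by fun_prop)))

theorem raw_answer (hf : PSpaceFun f) (hc : PSpaceFun c) (hp : PSpaceFun p) (hq : PSpaceFun q)
    (hq' : PSpaceFun q') :
    PSpaceFun fun x => (rawOfWord (f x)).Answer (c x) (p x) (q x) (q' x) := by
  unfold RawInstance.Answer
  refine .bex (raw_pow_k hf (raw_nI hf)) (.and (.ball (raw_nI (by fun_prop)) ?_)
    (.and (.ball (raw_nO (by fun_prop)) ?_) ?_))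
  · exact .eq (.countBelow (raw_k (by fun_prop)) (.eq (.dig (raw_nI (by fun_prop)) (by fun_prop)
      (by fun_prop)) (by fun_prop))) (.countBelow (raw_k (by fun_prop))
        (.eq (.dig (raw_nI (by fun_prop)) (by fun_prop) (by fun_prop)) (by fun_prop)))
  · exact .eq (.countBelow (raw_k (by fun_prop)) (.eq (raw_l₁ (by fun_prop) (raw_run₁ (by fun_prop)
      (by fun_prop) (by fun_prop) (by fun_prop))) (by fun_prop))) (.countBelow (raw_k (by fun_prop))
        (.eq (raw_l₂ (by fun_prop) (raw_run₂ (by fun_prop) (by fun_prop) (by fun_prop)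
          (by fun_prop))) (by fun_prop)))
  · exact .eq (raw_run₂ (by fun_prop) (by fun_prop) (by fun_prop) (raw_k (by fun_prop)))
      (by fun_prop)

theorem raw_autRun (hf : PSpaceFun f) (hc : PSpaceFun c) (ha : PSpaceFun a) (ha' : PSpaceFun a') :
    PSpaceFun fun x => (rawOfWord (f x)).AutRun (c x) (a x) (a' x) := by
  unfold RawInstance.AutRun
  simp only [pow_succ]
  refine .bex (.mul (raw_pow_k hf (raw_m hf)) (raw_m hf)) (.and
    (.eq (.dig (raw_m (by fun_prop)) (by fun_prop) (by fun_prop)) (by fun_prop)) (.and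
    (.eq (.dig (raw_m (by fun_prop)) (by fun_prop) (raw_k (by fun_prop))) (by fun_prop))
    (.ball (raw_k (by fun_prop)) ?_)))
  exact raw_δ₃ (by fun_prop) (.dig (raw_m (by fun_prop)) (by fun_prop) (by fun_prop))
    (.dig (raw_nI (by fun_prop)) (by fun_prop) (by fun_prop))
    (.dig (raw_m (by fun_prop)) (by fun_prop) (by fun_prop))

theorem raw_size (hf : PSpaceFun f) : PSpaceFun fun x => (rawOfWord (f x)).size := by
  refine .mul (.mul (raw_n₁ hf) (raw_m hf)) (.pow (by fun_prop) (raw_n₂ hf)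
    ((hf.wordVal.bounded.add (.const 1)).mono fun x => ?_))
  -- The number of states of the second transducer is at most the number of separators.
  refine (Nat.pow_le_pow_right two_pos ?_).trans (two_pow_length_le (f x))
  exact (min_le_right _ _).trans List.count_le_length

theorem raw_fstState (hf : PSpaceFun f) (hu : PSpaceFun u) :
    PSpaceFun fun x => (rawOfWord (f x)).fstState (u x) :=
  .mod hu (raw_n₁ hf)

theorem raw_autState (hf : PSpaceFun f) (hu : PSpaceFun u) :
    PSpaceFun fun x => (rawOfWord (f x)).autState (u x) :=
  .mod (.div hu (raw_n₁ hf)) (raw_m hf)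

theorem raw_hasState (hf : PSpaceFun f) (hu : PSpaceFun u) (hq : PSpaceFun q) :
    PSpaceFun fun x => (rawOfWord (f x)).HasState (u x) (q x) :=
  .eq (.dig (by fun_prop) (.div (.div hu (raw_n₁ hf)) (raw_m hf)) hq) (by fun_prop)

theorem raw_step (hf : PSpaceFun f) (hu : PSpaceFun u) (hv : PSpaceFun v) :
    PSpaceFun fun x => (rawOfWord (f x)).Step (u x) (v x) := by
  unfold RawInstance.Step
  refine .bex (raw_pow_k hf (raw_nI hf)) (.and (.eq (raw_fstState (by fun_prop) (by fun_prop))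
    (raw_run₁ (by fun_prop) (by fun_prop) (raw_fstState (by fun_prop) (by fun_prop))
      (raw_k (by fun_prop)))) (.and (raw_autRun (by fun_prop) (by fun_prop)
        (raw_autState (by fun_prop) (by fun_prop)) (raw_autState (by fun_prop) (by fun_prop)))
    (.ball (raw_n₂ (by fun_prop)) (.iff (raw_hasState (by fun_prop) (by fun_prop) (by fun_prop))
      (.bex (raw_n₂ (by fun_prop)) (.and (raw_hasState (by fun_prop) (by fun_prop) (by fun_prop))
        (raw_answer (by fun_prop) (by fun_prop) (raw_fstState (by fun_prop) (by fun_prop))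
          (by fun_prop) (by fun_prop))))))))

theorem raw_initial (hf : PSpaceFun f) (hu : PSpaceFun u) :
    PSpaceFun fun x => (rawOfWord (f x)).Initial (u x) :=
  .and (.eq (raw_fstState hf hu) (raw_s₁ hf)) (.and (.eq (raw_autState hf hu) (raw_s₃ hf))
    (.ball (raw_n₂ hf) (.iff (raw_hasState (by fun_prop) (by fun_prop) (by fun_prop))
      (.eq (by fun_prop) (raw_s₂ (by fun_prop))))))

theorem raw_refutes (hf : PSpaceFun f) (hv : PSpaceFun v) :
    PSpaceFun fun x => (rawOfWord (f x)).Refutes (v x) :=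
  .and (raw_acc hf (raw_autState hf hv)) (.ball (raw_n₂ hf)
    (.not (raw_hasState (by fun_prop) (by fun_prop) (by fun_prop))))

theorem raw_simulated (hf : PSpaceFun f) : PSpaceFun fun x => (rawOfWord (f x)).Simulated := by
  refine .not (.bex (raw_size hf) (.and (raw_initial (by fun_prop) (by fun_prop))
    (.bex (raw_size (by fun_prop)) (.and ?_ (raw_refutes (by fun_prop) (by fun_prop))))))
  exact .search (raw_size (by fun_prop)) (raw_step (by fun_prop) (by fun_prop) (by fun_prop))
    (by fun_prop) (by fun_prop)

end PSpaceFun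

theorem mainTheorem3 : InPSPACE fixedRoundSimulation := by
  apply inPSPACE_of_pspaceFun
  simp only [mem_fixedRoundSimulation_iff]
  exact .and PSpaceFun.wellFormed (.and pSpaceFun_valid (PSpaceFun.raw_simulated .id))
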